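/- **Theorem (0-1 law for Bloch interpolation).** Let $(r_n)_{n\in\mathbb N}$ be a deterministic sequence in $[0,1)$, let $(\theta_n)_{n\in\mathbb N}$ be independent random variables on a probability space $(\Omega,\mathcal A,\mathbb P)$, each uniformly distributed in $[0,1)$, and let $\Lambda=(\lambda_n)_n$ be the random sequence $\lambda_n=r_ne^{2\pi i\theta_n}$ in the unit disc $\mathbb D$. For $m\in\mathbb N=\{0,1,2,\dots\}$ let $$N_m=\#\{n : 2^{-(m+1)}\le 1-|\lambda_n|<2^{-m}\}\in\{0,1,2,\dots\}\cup\{\infty\},$$ which is deterministic because $|\lambda_n|=r_n$. The Bloch space $\mathcal B$ consists of the holomorphic $f:\mathbb D\to\mathbb C$ with $|f(0)|+\sup_{z\in\mathbb D}(1-|z|^2)|f'(z)|<\infty$. A sequence $(z_n)_n$ in $\mathbb D$ is called interpolating for $\mathcal B$ if for every sequence $(a_n)_n$ of complex numbers for which there is a constant $C$ with $|a_n-a_m|\le C\,\beta(z_n,z_m)$ for all $n,m$, there exists $f\in\mathcal B$ with $f(z_n)=a_n$ for all $n$; here $\beta(z,w)=\frac12\log\frac{1+\rho(z,w)}{1-\rho(z,w)}$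 with $\rho(z,w)=\left|\frac{z-w}{1-\overline wz}\right|$ is the hyperbolic distance. Then $$\mathbb P(\Lambda\text{ is interpolating for }\mathcal B)=\begin{cases}1&\text{if }\sum_{m\in\mathbb N}N_m^3\,2^{-2m}<\infty,\\ 0&\text{if }\sum_{m\in\mathbb N}N_m^3\,2^{-2m}=\infty,\end{cases}$$ that is, $\Lambda$ is almost surely interpolating in the first case and almost surely not interpolating in the second. -/

import Mathlib

open MeasureTheory ProbabilityTheory
open scoped ENNReal ComplexConjugate

noncomputable section

/-- The pseudo-hyperbolic distance `ρ(z, w)` on the unit disc. -/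
def pseudoHyperbolicDist (z w : ℂ) : ℝ := ‖(z - w) / (1 - conj w * z)‖

/-- The hyperbolic distance `β(z, w) = (1/2) log ((1 + ρ) / (1 - ρ))` on the unit disc, the distance
of the metric `|dz| / (1 - |z|²)`. -/
def hyperbolicDist (z w : ℂ) : ℝ :=
  (1 / 2) * Real.log ((1 + pseudoHyperbolicDist z w) / (1 - pseudoHyperbolicDist z w))

/-- `f` (restricted to the open unit disc) belongs to the Bloch space. The summand `|f(0)|` of the
Bloch norm is always finite, so finiteness of the norm is finiteness of the supremum. -/
structure IsBloch (f : ℂ → ℂ) : Prop where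
  holomorphic : DifferentiableOn ℂ f (Metric.ball 0 1)
  bounded : BddAbove ((fun z : ℂ => (1 - ‖z‖ ^ 2) * ‖deriv f z‖) '' Metric.ball 0 1)

/-- The sequence `z` in the unit disc is interpolating for the Bloch space: every sequence of values
`a` that is Lipschitz with respect to the hyperbolic distance is attained on `z` by a Bloch
function. -/
def IsBlochInterpolating (z : ℕ → ℂ) : Prop :=
  ∀ a : ℕ → ℂ, (∃ C : ℝ, ∀ n m, ‖a n - a m‖ ≤ C * hyperbolicDist (z n) (z m)) →
    ∃ f : ℂ → ℂ, IsBloch f ∧ ∀ n, f (z n) = a n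

/-- The points `λ_n(ω) = r_n exp (2 π i θ_n(ω))`. -/
def randomPoint {Ω : Type*} (r : ℕ → ℝ) (θ : ℕ → Ω → ℝ) (ω : Ω) (n : ℕ) : ℂ :=
  (r n : ℂ) * Complex.exp (2 * Real.pi * Complex.I * (θ n ω : ℂ))

/-- The dyadic annulus `A_m`. -/
def dyadicAnnulus (m : ℕ) : Set ℂ :=
  {z | ((2 : ℝ) ^ (m + 1))⁻¹ ≤ 1 - ‖z‖ ∧ 1 - ‖z‖ < ((2 : ℝ) ^ m)⁻¹}

/-- `N_m`: the number (possibly infinite) of indices `n` for which a point of modulus `r_n` lies in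
the dyadic annulus `A_m`. -/
def dyadicCount (r : ℕ → ℝ) (m : ℕ) : ℕ∞ := {n : ℕ | (r n : ℂ) ∈ dyadicAnnulus m}.encard

/-- The number of points of the random sequence in `A_m` is deterministic. -/
theorem encard_randomPoint_mem_dyadicAnnulus {Ω : Type*} (r : ℕ → ℝ) (θ : ℕ → Ω → ℝ) (ω : Ω)
    (m : ℕ) : {n : ℕ | randomPoint r θ ω n ∈ dyadicAnnulus m}.encard = dyadicCount r m := by
  have h : ∀ n, ‖randomPoint r θ ω n‖ = ‖(r n : ℂ)‖ := by
    intro n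
    have e : 2 * (Real.pi : ℂ) * Complex.I * (θ n ω : ℂ)
        = ((2 * Real.pi * θ n ω : ℝ) : ℂ) * Complex.I := by push_cast; ring
    rw [randomPoint, e, norm_mul, Complex.norm_exp_ofReal_mul_I, mul_one]
  simp only [dyadicCount, dyadicAnnulus, Set.mem_ofPred_eq, h]

end

/-! The exponent three has one source on both sides of the dichotomy: what destroys interpolation is
a triple of distinct points that are mutually very close, and N_m uniform points on the circle
produce about N_m^3 2^(-2m) triples at scale 2^(-m).

Necessity. Move to 0 the vertex q of a tight triple that lies opposite its longest side, and
prescribe at the other two vertices their distance to q. If g is the interpolating function in this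
coordinate, with g(0) = 0, then g(w)/w is Lipschitz near 0 with a constant controlled by the Bloch
seminorm, but at the two other vertices it takes unimodular values that stay apart, because the
angle at 0 is not small. A triple of diameter ε thus forces a seminorm of order 1/ε
(`one_sub_sq_le_of_bloch_eq_pseudoHyperbolicDist`). Doing this along a hyperbolically separated
sequence of ever tighter triples rules out interpolation
(`not_isBlochInterpolating_of_tight_triples`). When the series diverges, a second moment argument
over small boxes finds such triples almost surely (`measureReal_inter_compl_mul_sum_le`,
`ae_exists_triple`). If some annulus is hit infinitely often, the identity theorem suffices.

Sufficiency. When the series converges, Borel-Cantelli excludes, beyond some level, both a point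
with two others in a small Whitney neighbourhood of it and four points of comparable levels m with
directions within about 2^(-0.93 m) of one another. This is `DiscFamily.Sparse`, and everything else
is deterministic. A sparse family splits into clusters of at most three points. On a cluster of
level m the data are interpolated by a function h built from logarithms, of size O(m) and invariant
gradient O(1) (`exists_bloch_cluster`). It is localised with a function E that vanishes on the
cluster, is close to 1 away from its directions and has invariant gradient O(1/m), since the
transition is spread logarithmically between the scales 2^(-m) and 2^(-399m/400)
(`exists_log_bump`). The clusters are processed by increasing level through S ↦ S ∏ E + ∑ h (1 - E).
Here S grows only linearly in the level, so the factor 1/m in the gradient of E compensates its size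
and the gradients stay uniformly bounded.

The limit f misses the data by an error proportional to a tail over the levels at least m₀. Near
each cluster this error is the value of a small holomorphic function, so by the Schwarz lemma it is
itself Lipschitz data with a small constant (`DiscFamily.Sparse.exists_approx`). For m₀ large the
constant is at least halved, and iteration gives exact interpolation
(`DiscFamily.exists_forall_sparse_interpolating`). The finitely many points of low level are put
back one at a time (`IsBlochInterpolatingSet.insert`). -/

noncomputable section

/-! ### Hyperbolic geometry of the unit disc -/

/-- The disc automorphism sending `p` to `0`. -/
def mobius (p z : ℂ) : ℂ := (z - p) / (1 - conj p * z)

lemma pseudoHyperbolicDist_eq_norm_mobius (z w : ℂ) :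
    pseudoHyperbolicDist z w = ‖mobius w z‖ := rfl

lemma one_sub_conj_mul_ne_zero {z w : ℂ} (hz : ‖z‖ < 1) (hw : ‖w‖ < 1) : 1 - conj w * z ≠ 0 := by
  intro h
  have h1 : ‖conj w * z‖ = 1 := by rw [← sub_eq_zero.1 h, norm_one]
  rw [norm_mul, RCLike.norm_conj] at h1
  nlinarith [norm_nonneg z, norm_nonneg w]

lemma norm_one_sub_conj_mul_comm (z w : ℂ) : ‖1 - conj w * z‖ = ‖1 - conj z * w‖ := by
  rw [← RCLike.norm_conj (1 - conj w * z)]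
  simp [mul_comm]

lemma norm_one_sub_conj_mul_sq (z w : ℂ) :
    ‖1 - conj w * z‖ ^ 2 = ‖z - w‖ ^ 2 + (1 - ‖z‖ ^ 2) * (1 - ‖w‖ ^ 2) := by
  simp only [← Complex.normSq_eq_norm_sq, Complex.normSq_apply]
  simp
  ring

lemma one_sub_norm_le_norm_one_sub_conj_mul {z w : ℂ} (hw : ‖w‖ ≤ 1) :
    1 - ‖z‖ ≤ ‖1 - conj w * z‖ := by
  have h1 : ‖(1 : ℂ)‖ - ‖conj w * z‖ ≤ ‖1 - conj w * z‖ := norm_sub_norm_le _ _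
  rw [norm_one, norm_mul, RCLike.norm_conj] at h1
  nlinarith [norm_nonneg z, norm_nonneg w]

lemma pseudoHyperbolicDist_comm (z w : ℂ) :
    pseudoHyperbolicDist z w = pseudoHyperbolicDist w z := by
  rw [pseudoHyperbolicDist, pseudoHyperbolicDist, norm_div, norm_div, norm_sub_rev,
    norm_one_sub_conj_mul_comm]

lemma pseudoHyperbolicDist_nonneg (z w : ℂ) : 0 ≤ pseudoHyperbolicDist z w := norm_nonneg _

lemma one_sub_pseudoHyperbolicDist_sq {z w : ℂ} (hz : ‖z‖ < 1) (hw : ‖w‖ < 1) :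
    1 - pseudoHyperbolicDist z w ^ 2
      = (1 - ‖z‖ ^ 2) * (1 - ‖w‖ ^ 2) / ‖1 - conj w * z‖ ^ 2 := by
  have h0 : ‖1 - conj w * z‖ ^ 2 ≠ 0 := by
    have := one_sub_conj_mul_ne_zero hz hw
    positivity
  rw [pseudoHyperbolicDist, norm_div, div_pow, eq_div_iff h0, sub_mul, div_mul_cancel₀ _ h0,
    norm_one_sub_conj_mul_sq]
  ring

lemma one_sub_norm_sq_pos {z : ℂ} (hz : ‖z‖ < 1) : 0 < 1 - ‖z‖ ^ 2 := by
  nlinarith [norm_nonneg z]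

lemma pseudoHyperbolicDist_lt_one {z w : ℂ} (hz : ‖z‖ < 1) (hw : ‖w‖ < 1) :
    pseudoHyperbolicDist z w < 1 := by
  have h1 := one_sub_pseudoHyperbolicDist_sq hz hw
  have h0 : 0 < ‖1 - conj w * z‖ := norm_pos_iff.2 (one_sub_conj_mul_ne_zero hz hw)
  have h2 : 0 < (1 - ‖z‖ ^ 2) * (1 - ‖w‖ ^ 2) / ‖1 - conj w * z‖ ^ 2 :=
    div_pos (mul_pos (one_sub_norm_sq_pos hz) (one_sub_norm_sq_pos hw)) (by positivity)
  nlinarith [pseudoHyperbolicDist_nonneg z w]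

lemma pseudoHyperbolicDist_self (z : ℂ) : pseudoHyperbolicDist z z = 0 := by
  simp [pseudoHyperbolicDist]

lemma pseudoHyperbolicDist_pos {z w : ℂ} (hz : ‖z‖ < 1) (hw : ‖w‖ < 1) (h : z ≠ w) :
    0 < pseudoHyperbolicDist z w :=
  norm_pos_iff.2 (div_ne_zero (sub_ne_zero.2 h) (one_sub_conj_mul_ne_zero hz hw))

lemma norm_sub_eq_pseudoHyperbolicDist_mul {z w : ℂ} (hz : ‖z‖ < 1) (hw : ‖w‖ < 1) :
    ‖z - w‖ = pseudoHyperbolicDist z w * ‖1 - conj w * z‖ := by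
  rw [pseudoHyperbolicDist, norm_div, div_mul_cancel₀]
  exact norm_ne_zero_iff.2 (one_sub_conj_mul_ne_zero hz hw)

lemma norm_sub_le_two_mul_pseudoHyperbolicDist {z w : ℂ} (hz : ‖z‖ < 1) (hw : ‖w‖ < 1) :
    ‖z - w‖ ≤ 2 * pseudoHyperbolicDist z w := by
  rw [norm_sub_eq_pseudoHyperbolicDist_mul hz hw, mul_comm]
  have h1 : ‖1 - conj w * z‖ ≤ ‖(1 : ℂ)‖ + ‖conj w * z‖ := norm_sub_le _ _
  rw [norm_one, norm_mul, RCLike.norm_conj] at h1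
  have := pseudoHyperbolicDist_nonneg z w
  gcongr
  nlinarith [norm_nonneg z, norm_nonneg w]

lemma pseudoHyperbolicDist_mobius {p z w : ℂ} (hp : ‖p‖ < 1) (hz : ‖z‖ < 1) (hw : ‖w‖ < 1) :
    pseudoHyperbolicDist (mobius p z) (mobius p w) = pseudoHyperbolicDist z w := by
  have hpz := one_sub_conj_mul_ne_zero hz hp
  have hpw := one_sub_conj_mul_ne_zero hw hp
  have hwz := one_sub_conj_mul_ne_zero hz hw
  have hwp := one_sub_conj_mul_ne_zero hp hw
  have hpp := one_sub_conj_mul_ne_zero hp hp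
  have hwp' : 1 - conj (conj p) * conj w ≠ 0 := by rwa [Complex.conj_conj, mul_comm]
  have e1 : mobius p z - mobius p w
      = (z - w) * (1 - conj p * p) / ((1 - conj p * z) * (1 - conj p * w)) := by
    rw [mobius, mobius, div_sub_div _ _ hpz hpw]
    congr 1
    ring
  have e2 : 1 - conj (mobius p w) * mobius p z
      = (1 - conj w * z) * (1 - conj p * p) / ((1 - conj (conj p) * conj w) * (1 - conj p * z)) := by
    rw [mobius, mobius, map_div₀, map_sub, map_sub, map_mul, map_one, div_mul_div_comm,
      one_sub_div (mul_ne_zero hwp' hpz)]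
    congr 1
    simp only [Complex.conj_conj]
    ring
  rw [pseudoHyperbolicDist, e1, e2, pseudoHyperbolicDist]
  simp only [norm_div, norm_mul]
  rw [norm_one_sub_conj_mul_comm (conj w) (conj p), Complex.conj_conj, mul_comm w,
    norm_one_sub_conj_mul_comm w p] 
  have h1 := norm_ne_zero_iff.2 hpz
  have h2 := norm_ne_zero_iff.2 hpw
  have h3 := norm_ne_zero_iff.2 hpp
  have h4 := norm_ne_zero_iff.2 hwz
  generalize ‖1 - conj p * z‖ = A at *
  generalize ‖1 - conj p * w‖ = B at *
  generalize ‖1 - conj p * p‖ = C at *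
  generalize ‖1 - conj w * z‖ = D at *
  field_simp

lemma norm_mobius_lt_one {p z : ℂ} (hp : ‖p‖ < 1) (hz : ‖z‖ < 1) : ‖mobius p z‖ < 1 :=
  pseudoHyperbolicDist_lt_one hz hp

/-- Moving u to 0 turns the two distances on the right into norms, and then the formula for 1 - ρ²
together with |1 - b̄a| ≤ 1 + |a||b| gives the bound. The right side is the addition formula of
tanh, so this is what makes the hyperbolic distance satisfy the triangle inequality. -/
lemma pseudoHyperbolicDist_le_add_div {z u w : ℂ} (hz : ‖z‖ < 1) (hu : ‖u‖ < 1) (hw : ‖w‖ < 1) :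
    pseudoHyperbolicDist z w ≤ (pseudoHyperbolicDist z u + pseudoHyperbolicDist u w) /
      (1 + pseudoHyperbolicDist z u * pseudoHyperbolicDist u w) := by
  rw [← pseudoHyperbolicDist_mobius hu hz hw, pseudoHyperbolicDist_comm u w,
    pseudoHyperbolicDist_eq_norm_mobius z u, pseudoHyperbolicDist_eq_norm_mobius w u]
  have ha := norm_mobius_lt_one hu hz
  have hb := norm_mobius_lt_one hu hw
  set a := mobius u z
  set b := mobius u w
  have h1 := one_sub_pseudoHyperbolicDist_sq ha hb
  have h0 : 0 < ‖1 - conj b * a‖ := norm_pos_iff.2 (one_sub_conj_mul_ne_zero ha hb)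
  have h2 : ‖1 - conj b * a‖ ≤ 1 + ‖a‖ * ‖b‖ := by
    have h1 : ‖1 - conj b * a‖ ≤ ‖(1 : ℂ)‖ + ‖conj b * a‖ := norm_sub_le _ _
    rw [norm_one, norm_mul, RCLike.norm_conj] at h1
    linarith
  have hna := norm_nonneg a
  have hnb := norm_nonneg b
  have h3 : (1 - ‖a‖ ^ 2) * (1 - ‖b‖ ^ 2) / (1 + ‖a‖ * ‖b‖) ^ 2
      ≤ (1 - ‖a‖ ^ 2) * (1 - ‖b‖ ^ 2) / ‖1 - conj b * a‖ ^ 2 := by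
    have := mul_pos (one_sub_norm_sq_pos ha) (one_sub_norm_sq_pos hb)
    gcongr
  have h4 : (1 - ‖a‖ ^ 2) * (1 - ‖b‖ ^ 2) / (1 + ‖a‖ * ‖b‖) ^ 2
      = 1 - ((‖a‖ + ‖b‖) / (1 + ‖a‖ * ‖b‖)) ^ 2 := by
    have : 1 + ‖a‖ * ‖b‖ ≠ 0 := by positivity
    field_simp
    ring
  have h5 : pseudoHyperbolicDist a b ^ 2 ≤ ((‖a‖ + ‖b‖) / (1 + ‖a‖ * ‖b‖)) ^ 2 := by linarith
  exact le_of_sq_le_sq h5 (by positivity)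

lemma pseudoHyperbolicDist_triangle {z u w : ℂ} (hz : ‖z‖ < 1) (hu : ‖u‖ < 1) (hw : ‖w‖ < 1) :
    pseudoHyperbolicDist z w ≤ pseudoHyperbolicDist z u + pseudoHyperbolicDist u w := by
  refine (pseudoHyperbolicDist_le_add_div hz hu hw).trans ?_
  have h1 := pseudoHyperbolicDist_nonneg z u
  have h2 := pseudoHyperbolicDist_nonneg u w
  apply div_le_self (by positivity)
  nlinarith [mul_nonneg h1 h2]

lemma hyperbolicDist_comm (z w : ℂ) : hyperbolicDist z w = hyperbolicDist w z := by
  rw [hyperbolicDist, hyperbolicDist, pseudoHyperbolicDist_comm]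

lemma hyperbolicDist_eq {z w : ℂ} (hz : ‖z‖ < 1) (hw : ‖w‖ < 1) :
    hyperbolicDist z w = (Real.log (1 + pseudoHyperbolicDist z w)
      - Real.log (1 - pseudoHyperbolicDist z w)) / 2 := by
  have h1 := pseudoHyperbolicDist_nonneg z w
  have h2 := pseudoHyperbolicDist_lt_one hz hw
  rw [hyperbolicDist, Real.log_div (by linarith) (by linarith)]
  ring

lemma hyperbolicDist_le_neg_log {z w : ℂ} (hz : ‖z‖ < 1) (hw : ‖w‖ < 1) :
    hyperbolicDist z w ≤ -Real.log (1 - pseudoHyperbolicDist z w) := by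
  have h1 := pseudoHyperbolicDist_nonneg z w
  have h2 := pseudoHyperbolicDist_lt_one hz hw
  rw [hyperbolicDist_eq hz hw]
  have h3 := Real.log_le_sub_one_of_pos (show 0 < 1 + pseudoHyperbolicDist z w by linarith)
  have h4 := Real.log_le_sub_one_of_pos (show 0 < 1 - pseudoHyperbolicDist z w by linarith)
  linarith

lemma neg_log_le_two_mul_hyperbolicDist {z w : ℂ} (hz : ‖z‖ < 1) (hw : ‖w‖ < 1) :
    -Real.log (1 - pseudoHyperbolicDist z w) ≤ 2 * hyperbolicDist z w := by
  have h1 := pseudoHyperbolicDist_nonneg z w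
  rw [hyperbolicDist_eq hz hw]
  have h3 := Real.log_nonneg (show 1 ≤ 1 + pseudoHyperbolicDist z w by linarith)
  linarith

/-- The power series of artanh has nonnegative terms on [0, 1), and its first term is ρ. -/
lemma pseudoHyperbolicDist_le_hyperbolicDist {z w : ℂ} (hz : ‖z‖ < 1) (hw : ‖w‖ < 1) :
    pseudoHyperbolicDist z w ≤ hyperbolicDist z w := by
  have h1 := pseudoHyperbolicDist_nonneg z w
  have h2 := pseudoHyperbolicDist_lt_one hz hw
  set ρ := pseudoHyperbolicDist z w with hρ
  have hs := Real.hasSum_log_sub_log_of_abs_lt_one (abs_lt.2 ⟨by linarith, h2⟩)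
  have key := le_hasSum hs 0 (fun k _ => by positivity)
  rw [hyperbolicDist_eq hz hw, ← hρ]
  norm_num at key
  linarith

lemma hyperbolicDist_nonneg {z w : ℂ} (hz : ‖z‖ < 1) (hw : ‖w‖ < 1) : 0 ≤ hyperbolicDist z w :=
  (pseudoHyperbolicDist_nonneg z w).trans (pseudoHyperbolicDist_le_hyperbolicDist hz hw)

lemma hyperbolicDist_triangle {z u w : ℂ} (hz : ‖z‖ < 1) (hu : ‖u‖ < 1) (hw : ‖w‖ < 1) :
    hyperbolicDist z w ≤ hyperbolicDist z u + hyperbolicDist u w := by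
  have h := pseudoHyperbolicDist_le_add_div hz hu hw
  have hx := pseudoHyperbolicDist_nonneg z u
  have hx1 := pseudoHyperbolicDist_lt_one hz hu
  have hy := pseudoHyperbolicDist_nonneg u w
  have hy1 := pseudoHyperbolicDist_lt_one hu hw
  have hr := pseudoHyperbolicDist_nonneg z w
  have hr1 := pseudoHyperbolicDist_lt_one hz hw
  unfold hyperbolicDist
  set x := pseudoHyperbolicDist z u
  set y := pseudoHyperbolicDist u w
  set r := pseudoHyperbolicDist z w
  have hxy : 0 < 1 + x * y := by positivity
  rw [le_div_iff₀ hxy] at h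
  rw [← mul_add, ← Real.log_mul (div_pos (by linarith) (by linarith)).ne'
    (div_pos (by linarith) (by linarith)).ne']
  have : (1 + r) / (1 - r) ≤ (1 + x) / (1 - x) * ((1 + y) / (1 - y)) := by
    rw [div_mul_div_comm, div_le_div_iff₀ (by linarith) (mul_pos (by linarith) (by linarith))]
    nlinarith
  have h0 : 0 < (1 + r) / (1 - r) := div_pos (by linarith) (by linarith)
  gcongr

/-! ### Disc automorphisms as holomorphic maps -/

lemma hasDerivAt_mobius {p z : ℂ} (hp : ‖p‖ < 1) (hz : ‖z‖ < 1) :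
    HasDerivAt (mobius p) ((1 - conj p * p) / (1 - conj p * z) ^ 2) z := by
  have h0 := one_sub_conj_mul_ne_zero hz hp
  have h1 : HasDerivAt (fun z : ℂ => z - p) 1 z := (hasDerivAt_id z).sub_const p
  have h2 : HasDerivAt (fun z : ℂ => 1 - conj p * z) (-(conj p)) z := by
    simpa using ((hasDerivAt_id z).const_mul (conj p)).const_sub 1
  exact (h1.div h2 h0).congr_deriv (by ring)

lemma norm_deriv_mobius {p z : ℂ} (hp : ‖p‖ < 1) (hz : ‖z‖ < 1) :
    (1 - ‖z‖ ^ 2) * ‖deriv (mobius p) z‖ = 1 - ‖mobius p z‖ ^ 2 := by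
  rw [(hasDerivAt_mobius hp hz).deriv, ← pseudoHyperbolicDist_eq_norm_mobius,
    one_sub_pseudoHyperbolicDist_sq hz hp, norm_div, norm_pow]
  have : ‖1 - conj p * p‖ = 1 - ‖p‖ ^ 2 := by
    rw [mul_comm, Complex.mul_conj, Complex.normSq_eq_norm_sq]
    have : (1 : ℂ) - ((‖p‖ ^ 2 : ℝ) : ℂ) = ((1 - ‖p‖ ^ 2 : ℝ) : ℂ) := by push_cast; ring
    rw [this, Complex.norm_real, Real.norm_of_nonneg (one_sub_norm_sq_pos hp).le]
  rw [this]
  ring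

lemma mobius_self (p : ℂ) : mobius p p = 0 := by simp [mobius]

lemma mobius_neg_mobius {p z : ℂ} (hp : ‖p‖ < 1) (hz : ‖z‖ < 1) :
    mobius (-p) (mobius p z) = z := by
  have h0 := one_sub_conj_mul_ne_zero hz hp
  have h1 := one_sub_conj_mul_ne_zero hp hp
  rw [mobius, mobius, map_neg, neg_mul, sub_neg_eq_add, sub_neg_eq_add, mul_div_assoc',
    div_add' _ _ _ h0, one_add_div h0, div_div_div_cancel_right₀ h0]
  have e : 1 - conj p * z + conj p * (z - p) = 1 - conj p * p := by ring
  rw [e, div_eq_iff h1]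
  ring

lemma mapsTo_mobius {p : ℂ} (hp : ‖p‖ < 1) :
    Set.MapsTo (mobius p) (Metric.ball 0 1) (Metric.ball 0 1) := fun z hz => by
  rw [mem_ball_zero_iff] at hz ⊢
  exact norm_mobius_lt_one hp hz

lemma differentiableOn_mobius {p : ℂ} (hp : ‖p‖ < 1) :
    DifferentiableOn ℂ (mobius p) (Metric.ball 0 1) := fun _ hz =>
  (hasDerivAt_mobius hp (mem_ball_zero_iff.1 hz)).differentiableAt.differentiableWithinAt

lemma DifferentiableOn.differentiableAt_of_norm_lt_one {f : ℂ → ℂ}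
    (hf : DifferentiableOn ℂ f (Metric.ball 0 1)) {z : ℂ} (hz : ‖z‖ < 1) :
    DifferentiableAt ℂ f z :=
  hf.differentiableAt (Metric.isOpen_ball.mem_nhds (mem_ball_zero_iff.2 hz))

/-- The quantity `(1 - ‖z‖²) ‖f' z‖` is invariant under disc automorphisms. -/
lemma bloch_comp_mobius {f : ℂ → ℂ} (hf : DifferentiableOn ℂ f (Metric.ball 0 1)) {p z : ℂ}
    (hp : ‖p‖ < 1) (hz : ‖z‖ < 1) :
    (1 - ‖z‖ ^ 2) * ‖deriv (fun w => f (mobius p w)) z‖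
      = (1 - ‖mobius p z‖ ^ 2) * ‖deriv f (mobius p z)‖ := by
  have h1 := (hasDerivAt_mobius hp hz).differentiableAt
  have h2 := hf.differentiableAt_of_norm_lt_one (norm_mobius_lt_one hp hz)
  have h3 : deriv (fun w => f (mobius p w)) z = deriv f (mobius p z) * deriv (mobius p) z :=
    deriv_comp z h2 h1
  rw [h3, norm_mul, mul_comm ‖deriv f _‖, ← mul_assoc, norm_deriv_mobius hp hz]

/-! ### Obstructions to Bloch interpolation -/

/-- The numbers ‖w‖ / w are the conjugate directions of the two sides at the vertex 0. Splitting w₁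
- w₂ into a radial part of length ‖w₁‖ - ‖w₂‖ and an angular part shows that the third side can be
nearly as long as the longer of the two only if the directions differ by almost 1. -/
lemma one_sub_sq_le_norm_sub_of_norm_div {w₁ w₂ : ℂ} (h₁ : w₁ ≠ 0) (h₂ : w₂ ≠ 0)
    (hle : ‖w₂‖ ≤ ‖w₁‖) (h : ‖w₁‖ * (1 - ‖w₁‖ * ‖w₂‖) ≤ ‖w₁ - w₂‖) :
    1 - ‖w₁‖ ^ 2 ≤ ‖(‖w₁‖ : ℂ) / w₁ - (‖w₂‖ : ℂ) / w₂‖ := by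
  have ha : 0 < ‖w₁‖ := norm_pos_iff.2 h₁
  have hb : 0 < ‖w₂‖ := norm_pos_iff.2 h₂
  set X := ‖(‖w₁‖ : ℂ) / w₁ - (‖w₂‖ : ℂ) / w₂‖ with hX
  have ha' : (‖w₁‖ : ℂ) ≠ 0 := by exact_mod_cast ha.ne'
  have e : w₁ - w₂ = (((‖w₁‖ - ‖w₂‖ : ℝ) : ℂ) * (w₁ / ‖w₁‖))
      - ((‖w₁‖ : ℂ) / w₁ - (‖w₂‖ : ℂ) / w₂) * (w₁ * w₂ / ‖w₁‖) := by
    push_cast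
    field_simp
    ring
  have e2 : ‖w₁ - w₂‖ ≤ (‖w₁‖ - ‖w₂‖) + X * ‖w₂‖ := by
    rw [e]
    refine (norm_sub_le _ _).trans (le_of_eq ?_)
    rw [norm_mul, norm_mul, ← hX, norm_div, norm_div, norm_mul, Complex.norm_real,
      Complex.norm_real, Real.norm_of_nonneg (by linarith), norm_norm, div_self ha.ne']
    field_simp
  have : ‖w₂‖ * (1 - ‖w₁‖ ^ 2) ≤ ‖w₂‖ * X := by nlinarith
  exact le_of_mul_le_mul_left this hb

/-- A Bloch function has bounded invariant second differences. -/
lemma one_sub_sq_le_of_bloch_eq_pseudoHyperbolicDist {f : ℂ → ℂ} {M ε : ℝ} {p q s : ℂ}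
    (hf : DifferentiableOn ℂ f (Metric.ball 0 1))
    (hM : ∀ z : ℂ, ‖z‖ < 1 → (1 - ‖z‖ ^ 2) * ‖deriv f z‖ ≤ M)
    (hp : ‖p‖ < 1) (hq : ‖q‖ < 1) (hs : ‖s‖ < 1) (hpq : p ≠ q) (hsq : s ≠ q)
    (hε : ε ≤ 1 / 4) (hpε : pseudoHyperbolicDist p q ≤ ε) (hsε : pseudoHyperbolicDist s q ≤ ε)
    (hp_le : pseudoHyperbolicDist p q ≤ pseudoHyperbolicDist p s)
    (hs_le : pseudoHyperbolicDist s q ≤ pseudoHyperbolicDist p s)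
    (fq : f q = 0) (fp : f p = pseudoHyperbolicDist p q) (fs : f s = pseudoHyperbolicDist s q) :
    1 - ε ^ 2 ≤ 16 * M * ε := by
  -- Work in the coordinate in which q is 0; the Bloch seminorm does not change.
  set w₁ := mobius q p with hw₁
  set w₂ := mobius q s with hw₂
  have n₁ : ‖w₁‖ = pseudoHyperbolicDist p q := rfl
  have n₂ : ‖w₂‖ = pseudoHyperbolicDist s q := rfl
  have p₁ := pseudoHyperbolicDist_pos hp hq hpq
  have p₂ := pseudoHyperbolicDist_pos hs hq hsq
  have z₁ : w₁ ≠ 0 := norm_pos_iff.1 (n₁ ▸ p₁)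
  have z₂ : w₂ ≠ 0 := norm_pos_iff.1 (n₂ ▸ p₂)
  have hq' : ‖-q‖ < 1 := by rwa [norm_neg]
  set g : ℂ → ℂ := fun w => f (mobius (-q) w) with hg
  have hgd : DifferentiableOn ℂ g (Metric.ball 0 1) :=
    hf.comp (differentiableOn_mobius hq') (mapsTo_mobius hq')
  have hg0 : g 0 = 0 := by simp [hg, mobius, fq]
  have hg₁ : g w₁ = ‖w₁‖ := by simp only [hg, hw₁]; rw [mobius_neg_mobius hq hp, fp, ← n₁]
  have hg₂ : g w₂ = ‖w₂‖ := by simp only [hg, hw₂]; rw [mobius_neg_mobius hq hs, fs, ← n₂]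
  have hgM : ∀ w : ℂ, ‖w‖ < 1 → (1 - ‖w‖ ^ 2) * ‖deriv g w‖ ≤ M := fun w hw => by
    rw [hg, bloch_comp_mobius hf hq' hw]
    exact hM _ (norm_mobius_lt_one hq' hw)
  have hM0 : 0 ≤ M := (by positivity : 0 ≤ ‖deriv g 0‖).trans (by simpa using hgM 0 (by simp))
  have hgM' : ∀ w ∈ Metric.ball (0 : ℂ) (1 / 2), ‖deriv g w‖ ≤ 2 * M := fun w hw => by
    rw [mem_ball_zero_iff] at hw
    have h1 := hgM w (by linarith)
    have h2 := norm_nonneg w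
    have h3 := norm_nonneg (deriv g w)
    have h4 : 1 / 2 ≤ 1 - ‖w‖ ^ 2 := by nlinarith
    nlinarith [mul_le_mul_of_nonneg_right h4 h3]
  have hsub : Metric.ball (0 : ℂ) (1 / 2) ⊆ Metric.ball 0 1 := Metric.ball_subset_ball (by norm_num)
  -- G(w) = g(w)/w is holomorphic across 0, bounded by 2M on the half disc, and hence 8M-Lipschitz
  -- from 0 by the Schwarz lemma.
  set G := dslope g 0 with hG
  have hGd : DifferentiableOn ℂ G (Metric.ball 0 (1 / 2)) :=
    (Complex.differentiableOn_dslope (Metric.ball_mem_nhds _ (by norm_num))).2 (hgd.mono hsub)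
  have hGb : ∀ w ∈ Metric.ball (0 : ℂ) (1 / 2), ‖G w‖ ≤ 2 * M := by
    intro w hw
    have := Complex.norm_dslope_le_div_of_mapsTo_ball (hgd.mono hsub) (R₂ := M) (fun w hw => by
      have := (convex_ball (0 : ℂ) (1 / 2)).norm_image_sub_le_of_norm_deriv_le
        (fun x hx => hgd.differentiableAt_of_norm_lt_one (mem_ball_zero_iff.1 (hsub hx))) hgM'
        (Metric.mem_ball_self (by norm_num)) hw
      rw [mem_closedBall_iff_norm]
      refine this.trans ?_
      rw [mem_ball_zero_iff] at hw
      rw [sub_zero]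
      nlinarith) hw
    convert this using 1
    ring
  have hGl : ∀ w : ℂ, ‖w‖ ≤ ε → ‖G w - G 0‖ ≤ 8 * M * ε := by
    intro w hw
    have hw' : w ∈ Metric.ball (0 : ℂ) (1 / 2) := mem_ball_zero_iff.2 (by linarith)
    have := Complex.dist_le_div_mul_dist_of_mapsTo_ball hGd (R₂ := 4 * M) (fun w hw => by
      rw [mem_closedBall_iff_norm]
      refine (norm_sub_le _ _).trans ?_
      linarith [hGb w hw, hGb 0 (Metric.mem_ball_self (by norm_num))]) hw'
    rw [dist_eq_norm, dist_eq_norm, sub_zero] at this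
    refine this.trans ?_
    have := norm_nonneg w
    nlinarith
  have hGw : ∀ w : ℂ, w ≠ 0 → g w = ‖w‖ → G w = (‖w‖ : ℂ) / w := fun w hw h => by
    rw [hG, dslope_of_ne _ hw, slope_def_field, h, hg0, sub_zero, sub_zero]
  have hX : ‖(‖w₁‖ : ℂ) / w₁ - (‖w₂‖ : ℂ) / w₂‖ ≤ 16 * M * ε := by
    rw [← hGw w₁ z₁ hg₁, ← hGw w₂ z₂ hg₂]
    have h1 := hGl w₁ (by linarith)
    have h2 := hGl w₂ (by linarith)
    have e : G w₁ - G w₂ = (G w₁ - G 0) - (G w₂ - G 0) := by ring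
    rw [e]
    refine (norm_sub_le _ _).trans ?_
    linarith
  have l₁ : ‖w₁‖ < 1 := by linarith
  have l₂ : ‖w₂‖ < 1 := by linarith
  have hdist : pseudoHyperbolicDist p s * (1 - ‖w₁‖ * ‖w₂‖) ≤ ‖w₁ - w₂‖ := by
    rw [norm_sub_eq_pseudoHyperbolicDist_mul l₁ l₂, hw₁, hw₂, pseudoHyperbolicDist_mobius hq hp hs]
    gcongr
    · exact pseudoHyperbolicDist_nonneg _ _
    · have h1 : ‖(1 : ℂ)‖ - ‖conj (mobius q s) * mobius q p‖
        ≤ ‖1 - conj (mobius q s) * mobius q p‖ := norm_sub_norm_le _ _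
      rw [norm_one, norm_mul, RCLike.norm_conj] at h1
      linarith
  have hpos : 0 ≤ 1 - ‖w₁‖ * ‖w₂‖ := by nlinarith [norm_nonneg w₁, norm_nonneg w₂]
  rcases le_total ‖w₂‖ ‖w₁‖ with h | h
  · have h3 := one_sub_sq_le_norm_sub_of_norm_div z₁ z₂ h
      ((mul_le_mul_of_nonneg_right (by linarith) hpos).trans hdist)
    nlinarith [norm_nonneg w₁]
  · have h3 := one_sub_sq_le_norm_sub_of_norm_div z₂ z₁ h (by
      rw [mul_comm ‖w₂‖ ‖w₁‖, norm_sub_rev]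
      exact (mul_le_mul_of_nonneg_right (by linarith) hpos).trans hdist)
    rw [norm_sub_rev] at h3
    nlinarith [norm_nonneg w₂]

/-- Only the moduli enter, so the centres of successive triples can be separated merely by choosing
each triple much closer to the circle than the previous centre. -/
lemma half_le_pseudoHyperbolicDist {z w : ℂ} (hz : ‖z‖ < 1) (hw : ‖w‖ < 1)
    (h : 1 - ‖z‖ ≤ (1 - ‖w‖) / 16) : 1 / 2 ≤ pseudoHyperbolicDist z w := by
  have h1 := one_sub_pseudoHyperbolicDist_sq hz hw
  have h2 : 1 - ‖w‖ ≤ ‖1 - conj w * z‖ := by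
    rw [norm_one_sub_conj_mul_comm]
    exact one_sub_norm_le_norm_one_sub_conj_mul hz.le
  have h3 : (1 - ‖z‖ ^ 2) * (1 - ‖w‖ ^ 2) / ‖1 - conj w * z‖ ^ 2 ≤ 1 / 4 := by
    have h0 : 0 < ‖1 - conj w * z‖ := by linarith
    rw [div_le_iff₀ (by positivity)]
    have a1 : 1 - ‖z‖ ^ 2 ≤ (1 - ‖w‖) / 8 := by nlinarith [norm_nonneg z]
    have a2 : 1 - ‖w‖ ^ 2 ≤ 2 * (1 - ‖w‖) := by nlinarith [norm_nonneg w]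
    have a3 := one_sub_norm_sq_pos hz
    have a4 := one_sub_norm_sq_pos hw
    calc (1 - ‖z‖ ^ 2) * (1 - ‖w‖ ^ 2) ≤ (1 - ‖w‖) / 8 * (2 * (1 - ‖w‖)) := by
          gcongr
      _ = 1 / 4 * (1 - ‖w‖) ^ 2 := by ring
      _ ≤ _ := by
        have : 0 ≤ 1 - ‖w‖ := by linarith
        gcongr
  nlinarith [pseudoHyperbolicDist_nonneg z w]

/-- A sequence containing arbitrarily tight triples of distinct points arbitrarily close to the
unit circle is not interpolating. -/
theorem not_isBlochInterpolating_of_tight_triples {z : ℕ → ℂ} (hz : ∀ n, ‖z n‖ < 1)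
    (H : ∀ ε > 0, ∀ R < 1, ∃ i j k, z i ≠ z j ∧ z j ≠ z k ∧ z i ≠ z k ∧ R ≤ ‖z i‖ ∧ R ≤ ‖z j‖ ∧
      R ≤ ‖z k‖ ∧ pseudoHyperbolicDist (z i) (z j) ≤ ε ∧ pseudoHyperbolicDist (z j) (z k) ≤ ε ∧
      pseudoHyperbolicDist (z i) (z k) ≤ ε) : ¬ IsBlochInterpolating z := by
  have H' : ∀ (m : ℕ) (n : ℕ), ∃ i j k, z i ≠ z j ∧ z k ≠ z j ∧
      1 - ‖z j‖ ≤ (1 - ‖z n‖) / 16 ∧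
      pseudoHyperbolicDist (z i) (z j) ≤ 1 / ((m : ℝ) + 4) ∧
      pseudoHyperbolicDist (z k) (z j) ≤ 1 / ((m : ℝ) + 4) ∧
      pseudoHyperbolicDist (z i) (z j) ≤ pseudoHyperbolicDist (z i) (z k) ∧
      pseudoHyperbolicDist (z k) (z j) ≤ pseudoHyperbolicDist (z i) (z k) := by
    intro m n
    obtain ⟨i, j, k, h1, h2, h3, r1, r2, r3, d1, d2, d3⟩ := H (1 / ((m : ℝ) + 4)) (by positivity)
      (1 - (1 - ‖z n‖) / 16) (by linarith [hz n])
    have c1 := pseudoHyperbolicDist_comm (z j) (z i)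
    have c2 := pseudoHyperbolicDist_comm (z k) (z j)
    have c3 := pseudoHyperbolicDist_comm (z k) (z i)
    rcases le_total (pseudoHyperbolicDist (z i) (z j)) (pseudoHyperbolicDist (z i) (z k)) with a | a
    · rcases le_total (pseudoHyperbolicDist (z j) (z k)) (pseudoHyperbolicDist (z i) (z k))
        with b | b
      · exact ⟨i, j, k, h1, h2.symm, by linarith, d1, by linarith, a, by linarith⟩
      · exact ⟨j, i, k, h1.symm, h3.symm, by linarith, by linarith, by linarith, by linarith,
          by linarith⟩
    · rcases le_total (pseudoHyperbolicDist (z i) (z j)) (pseudoHyperbolicDist (z j) (z k))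
        with b | b
      · exact ⟨j, i, k, h1.symm, h3.symm, by linarith, by linarith, by linarith, by linarith,
          by linarith⟩
      · exact ⟨i, k, j, h3, h2, by linarith, by linarith, by linarith, by linarith, by linarith⟩
  choose P Q S hPQ hSQ hR hPε hSε hP hS using H'
  -- σ m indexes the centre of the m-th triple, chosen 16 times closer to the circle than the centre
  -- before it. τ m is the reference index used in that choice: the previous centre, or the
  -- arbitrary index 0 at the start.
  let σ : ℕ → ℕ := fun m => Nat.rec (Q 0 0) (fun m n => Q (m + 1) n) m
  let τ : ℕ → ℕ := fun m => Nat.casesOn m 0 σ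
  have hσ : ∀ m, σ m = Q m (τ m) := fun m => by cases m <;> rfl
  have hlt : ∀ i j, i < j → 1 - ‖z (σ j)‖ ≤ (1 - ‖z (σ i)‖) / 16 := by
    intro i j hij
    induction j, hij using Nat.le_induction with
    | base => exact hR (i + 1) (σ i)
    | succ j _ ih =>
      have := hR (j + 1) (σ j)
      have e : σ (j + 1) = Q (j + 1) (σ j) := rfl
      rw [e]
      linarith [hz (σ j)]
  have hsep : ∀ i j, i ≠ j → 1 / 2 ≤ pseudoHyperbolicDist (z (σ i)) (z (σ j)) := by
    intro i j hij
    rcases lt_or_gt_of_ne hij with h | h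
    · rw [pseudoHyperbolicDist_comm]
      exact half_le_pseudoHyperbolicDist (hz _) (hz _) (hlt i j h)
    · exact half_le_pseudoHyperbolicDist (hz _) (hz _) (hlt j i h)
  -- The distance to the set of all centres is 1-Lipschitz. Since centres are 1/2 apart, within 1/4
  -- of a centre it equals the distance to that centre, so one choice of data serves all triples at
  -- once.
  let u : ℂ → ℝ := fun w => ⨅ k, pseudoHyperbolicDist w (z (σ k))
  have hbdd : ∀ w, BddBelow (Set.range fun k => pseudoHyperbolicDist w (z (σ k))) := fun w =>
    ⟨0, by rintro _ ⟨k, rfl⟩; exact pseudoHyperbolicDist_nonneg _ _⟩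
  have hu1 : ∀ w w', ‖w‖ < 1 → ‖w'‖ < 1 → u w - u w' ≤ pseudoHyperbolicDist w w' := by
    intro w w' hw hw'
    rw [sub_le_iff_le_add, add_comm, ← sub_le_iff_le_add]
    refine le_ciInf fun k => ?_
    rw [sub_le_iff_le_add]
    refine (ciInf_le (hbdd w) k).trans ?_
    have := pseudoHyperbolicDist_triangle hw hw' (hz (σ k))
    linarith
  have hu : ∀ m w, ‖w‖ < 1 → pseudoHyperbolicDist w (z (σ m)) ≤ 1 / 4 →
      u w = pseudoHyperbolicDist w (z (σ m)) := by
    intro m w hw h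
    refine le_antisymm (ciInf_le (hbdd w) m) (le_ciInf fun k => ?_)
    by_cases hk : m = k
    · rw [hk]
    · have h1 := pseudoHyperbolicDist_triangle (hz (σ m)) hw (hz (σ k))
      have h2 := hsep m k hk
      rw [pseudoHyperbolicDist_comm _ w] at h1
      linarith
  intro hint
  obtain ⟨f, hf, hfz⟩ := hint (fun n => (u (z n) : ℂ)) ⟨1, fun n m => by
    rw [one_mul, ← Complex.ofReal_sub, Complex.norm_real, Real.norm_eq_abs]
    refine (abs_le.2 ⟨?_, ?_⟩).trans (pseudoHyperbolicDist_le_hyperbolicDist (hz n) (hz m))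
    · have := hu1 _ _ (hz m) (hz n)
      rw [pseudoHyperbolicDist_comm] at this
      linarith
    · exact hu1 _ _ (hz n) (hz m)⟩
  obtain ⟨M, hM⟩ := hf.bounded
  have hM' : ∀ w : ℂ, ‖w‖ < 1 → (1 - ‖w‖ ^ 2) * ‖deriv f w‖ ≤ M := fun w hw =>
    hM ⟨w, mem_ball_zero_iff.2 hw, rfl⟩
  -- The m-th triple has ε = 1/(m + 4) ≤ 1/4, so 1 - ε² ≥ 15/16 while the right side tends to 0.
  have key : ∀ m : ℕ, (15 / 16 : ℝ) ≤ 16 * M * (1 / ((m : ℝ) + 4)) := by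
    intro m
    have hε : 1 / ((m : ℝ) + 4) ≤ 1 / 4 := by
      apply one_div_le_one_div_of_le (by norm_num)
      have : (0 : ℝ) ≤ m := Nat.cast_nonneg m
      linarith
    have h1 := hPε m (τ m)
    have h2 := hSε m (τ m)
    have h3 := hP m (τ m)
    have h4 := hS m (τ m)
    have h5 := hPQ m (τ m)
    have h6 := hSQ m (τ m)
    rw [← hσ] at h1 h2 h3 h4 h5 h6
    have := one_sub_sq_le_of_bloch_eq_pseudoHyperbolicDist hf.holomorphic hM' (hz _) (hz _) (hz _)
      h5 h6 hε h1 h2 h3 h4 (by rw [hfz, hu m _ (hz _) (by simp [pseudoHyperbolicDist_self]),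
        pseudoHyperbolicDist_self, Complex.ofReal_zero])
      (by rw [hfz, hu m _ (hz _) (h1.trans hε)]) (by rw [hfz, hu m _ (hz _) (h2.trans hε)])
    have h0 : 0 ≤ 1 / ((m : ℝ) + 4) := by positivity
    nlinarith
  have hlim : Filter.Tendsto (fun m : ℕ => 16 * M * (1 / ((m : ℝ) + 4))) Filter.atTop
      (nhds (16 * M * 0)) := by
    refine Filter.Tendsto.const_mul _ ?_
    have := (tendsto_one_div_add_atTop_nhds_zero_nat (𝕜 := ℝ)).comp (Filter.tendsto_add_atTop_nat 3)
    refine this.congr fun m => ?_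
    simp only [Function.comp_apply]
    push_cast
    congr 1
    ring
  have := ge_of_tendsto' hlim key
  norm_num at this

/-- A sequence with infinitely many distinct values in a compact subdisc is not interpolating. -/
theorem not_isBlochInterpolating_of_infinite {z : ℕ → ℂ} (hz : ∀ n, ‖z n‖ < 1) {R : ℝ} (hR : R < 1)
    (H : (Set.range z ∩ Metric.closedBall 0 R).Infinite) : ¬ IsBlochInterpolating z := by
  intro hint
  obtain ⟨p, hpR, hp⟩ := H.exists_accPt_of_subset_isCompact (isCompact_closedBall 0 R)
    Set.inter_subset_right
  have hp1 : ‖p‖ < 1 := (mem_closedBall_zero_iff.1 hpR).trans_lt hR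
  obtain ⟨_, ⟨⟨n₀, rfl⟩, -⟩, hn₀⟩ := (H.sdiff (Set.finite_singleton p)).nonempty
  rw [Set.mem_singleton_iff] at hn₀
  have hpos : 0 < ‖z n₀ - p‖ := norm_pos_iff.2 (sub_ne_zero.2 hn₀)
  set ε := ‖z n₀ - p‖ / 2 with hε
  -- These Lipschitz data vanish at all points near the accumulation point p but not at z n₀, which
  -- the identity theorem forbids for a holomorphic function.
  obtain ⟨f, hf, hfz⟩ := hint (fun n => ((max 0 (‖z n - p‖ - ε) : ℝ) : ℂ)) ⟨2, fun n m => by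
    rw [← Complex.ofReal_sub, Complex.norm_real, Real.norm_eq_abs]
    refine (abs_max_sub_max_le_max _ _ _ _).trans ?_
    have h1 := norm_sub_le_two_mul_pseudoHyperbolicDist (hz n) (hz m)
    have h2 := pseudoHyperbolicDist_le_hyperbolicDist (hz n) (hz m)
    have h3 := abs_norm_sub_norm_le (z n - p) (z m - p)
    rw [sub_sub_sub_cancel_right] at h3
    rw [sub_self, abs_zero, sub_sub_sub_cancel_right]
    exact max_le (by linarith [norm_nonneg (z n - z m)]) (by linarith)⟩
  have han : AnalyticOnNhd ℂ f (Metric.ball 0 1) :=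
    hf.holomorphic.analyticOnNhd Metric.isOpen_ball
  have hfreq : ∃ᶠ w in nhdsWithin p {p}ᶜ, f w = 0 := by
    have h1 := accPt_iff_frequently_nhdsNE.1 hp
    have h2 : ∀ᶠ w in nhdsWithin p {p}ᶜ, w ∈ Metric.ball p ε :=
      nhdsWithin_le_nhds (Metric.ball_mem_nhds p (by positivity))
    refine (h1.and_eventually h2).mono ?_
    rintro _ ⟨⟨⟨n, rfl⟩, -⟩, hn⟩
    rw [mem_ball_iff_norm] at hn
    rw [hfz, max_eq_left (by linarith), Complex.ofReal_zero]
  have h0 := han.eqOn_zero_of_preconnected_of_frequently_eq_zero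
    (convex_ball (0 : ℂ) 1).isPreconnected (mem_ball_zero_iff.2 hp1) hfreq
    (mem_ball_zero_iff.2 (hz n₀))
  rw [hfz, Pi.zero_apply, Complex.ofReal_eq_zero] at h0
  have : ε ≤ max 0 (‖z n₀ - p‖ - ε) := le_max_of_le_right (by linarith)
  linarith

/-! ### Logarithmic bump functions attached to a point -/

/-- All scales below are powers of `2 ^ (-1 / 400)`. -/
def scaleBase : ℝ := (2 : ℝ) ^ (-(1 / 400 : ℝ))

lemma scaleBase_pos : 0 < scaleBase := Real.rpow_pos_of_pos two_pos _

lemma scaleBase_lt_one : scaleBase < 1 :=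
  Real.rpow_lt_one_of_one_lt_of_neg one_lt_two (by norm_num)

lemma scaleBase_pow_400 : scaleBase ^ 400 = 1 / 2 := by
  rw [scaleBase, ← Real.rpow_natCast, ← Real.rpow_mul two_pos.le]
  norm_num

lemma scaleBase_pow_400_mul (m : ℕ) : scaleBase ^ (400 * m) = (1 / 2) ^ m := by
  rw [pow_mul, scaleBase_pow_400]

lemma scaleBase_pow_pos (k : ℕ) : 0 < scaleBase ^ k := pow_pos scaleBase_pos k

lemma scaleBase_pow_le {i j : ℕ} (h : i ≤ j) : scaleBase ^ j ≤ scaleBase ^ i :=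
  pow_le_pow_of_le_one scaleBase_pos.le scaleBase_lt_one.le h

lemma scaleBase_pow_le_one (k : ℕ) : scaleBase ^ k ≤ 1 :=
  pow_le_one₀ scaleBase_pos.le scaleBase_lt_one.le

lemma lt_of_scaleBase_pow_lt {i j : ℕ} (h : scaleBase ^ i < scaleBase ^ j) : j < i :=
  (pow_lt_pow_iff_right_of_lt_one₀ scaleBase_pos scaleBase_lt_one).1 h

/-- The horizontal weight of a point of level `m` in direction `ζ`. -/
def sideWeight (m : ℕ) (ζ z : ℂ) : ℝ := min 1 (scaleBase ^ (399 * m) / ‖ζ - z‖)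

/-- The vertical weight of a point of level `m`. -/
def depthWeight (m : ℕ) (z : ℂ) : ℝ := min 1 ((1 - ‖z‖) / scaleBase ^ (440 * m))

lemma sideWeight_nonneg (m : ℕ) (ζ z : ℂ) : 0 ≤ sideWeight m ζ z :=
  le_min zero_le_one (div_nonneg (scaleBase_pow_pos _).le (norm_nonneg _))

lemma sideWeight_le_one (m : ℕ) (ζ z : ℂ) : sideWeight m ζ z ≤ 1 := min_le_left _ _

lemma depthWeight_nonneg (m : ℕ) {z : ℂ} (hz : ‖z‖ < 1) : 0 ≤ depthWeight m z :=
  le_min zero_le_one (div_nonneg (by linarith) (scaleBase_pow_pos _).le)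

lemma depthWeight_le_one (m : ℕ) (z : ℂ) : depthWeight m z ≤ 1 := min_le_left _ _

lemma norm_one_sub_exp_neg_le {w : ℂ} (hw : 0 ≤ w.re) : ‖1 - Complex.exp (-w)‖ ≤ ‖w‖ := by
  have hs : Convex ℝ {w : ℂ | 0 ≤ w.re} := convex_halfSpace_re_ge 0
  have := hs.norm_image_sub_le_of_norm_deriv_le (f := fun w : ℂ => Complex.exp (-w)) (C := 1)
    (fun x _ => by fun_prop) (fun x hx => by
      have : HasDerivAt (fun w : ℂ => Complex.exp (-w)) (Complex.exp (-x) * (-1)) x :=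
        (hasDerivAt_neg x).cexp
      rw [this.deriv, norm_mul, Complex.norm_exp]
      simpa using hx) hw (by simp : (0 : ℂ) ∈ {w : ℂ | 0 ≤ w.re})
  simpa using this

lemma le_norm_add_ofReal {X : ℂ} (hX : 0 ≤ X.re) {t : ℝ} (ht : 0 ≤ t) :
    ‖X‖ ≤ ‖X + t‖ ∧ t ≤ ‖X + t‖ := by
  constructor
  · rw [← sq_le_sq₀ (norm_nonneg _) (norm_nonneg _), ← Complex.normSq_eq_norm_sq,
      ← Complex.normSq_eq_norm_sq, Complex.normSq_apply, Complex.normSq_apply]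
    simp
    nlinarith
  · calc t ≤ (X + t).re := by simp [hX]
      _ ≤ _ := Complex.re_le_norm _

lemma norm_log_add_sub_log_add_le {X : ℂ} (hX : 0 < X.re) {σ τ : ℝ} (hτ : 0 ≤ τ) (hσ : τ ≤ σ) :
    ‖Complex.log (X + σ) - Complex.log (X + τ)‖ ≤ σ / ‖X‖ := by
  have hX0 : 0 < ‖X‖ := hX.trans_le (Complex.re_le_norm _)
  have h := (convex_Icc (0 : ℝ) σ).norm_image_sub_le_of_norm_hasDerivWithin_le
    (f := fun t : ℝ => Complex.log (X + t)) (f' := fun t : ℝ => 1 / (X + t)) (C := 1 / ‖X‖)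
    (x := τ) (y := σ) (fun t ht => by
      have h1 : HasDerivAt (fun t : ℝ => X + (t : ℂ)) 1 t :=
        (Complex.ofRealCLM.hasDerivAt).const_add X
      refine (h1.clog_real ?_).hasDerivWithinAt
      left
      simp
      linarith [ht.1])
    (fun t ht => by
      rw [norm_div, norm_one]
      exact one_div_le_one_div_of_le hX0 (le_norm_add_ofReal hX.le ht.1).1)
    ⟨hτ, hσ⟩ ⟨hτ.trans hσ, le_rfl⟩
  refine h.trans ?_
  rw [Real.norm_of_nonneg (by linarith), div_mul_eq_mul_div, one_mul]
  gcongr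
  linarith

/-- With X = 1 - ζ̄z, which lies in the right half plane, take S = ((X + τ)/(X + σ))^α. It is close
to 1 where |X| is much larger than σ, and its logarithmic derivative has modulus α(σ - τ)/|(X + σ)(X
+ τ)|. The factor 1/(X + σ) gives the horizontal decay and the factor (1 - |z|)/(X + τ) the vertical
one. -/
lemma exists_half_plane_bump {ζ : ℂ} (hζ : ‖ζ‖ = 1) {σ τ α : ℝ} (hτ : 0 < τ) (hσ : τ ≤ σ)
    (hα : 0 ≤ α) (hα1 : α ≤ 1) : ∃ S : ℂ → ℂ, DifferentiableOn ℂ S (Metric.ball 0 1) ∧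
      (∀ r : ℝ, r < 1 → S (r * ζ) = ((((1 - r) + τ) / ((1 - r) + σ)) ^ α : ℝ)) ∧
      ∀ z : ℂ, ‖z‖ < 1 → ‖S z‖ ≤ 1 ∧ ‖1 - S z‖ ≤ 2 * min 1 (σ / ‖ζ - z‖) ∧
        (1 - ‖z‖ ^ 2) * ‖deriv S z‖ ≤
          2 * α * (min 1 (σ / ‖ζ - z‖) * min 1 ((1 - ‖z‖) / τ)) := by
  have hσ0 : 0 < σ := hτ.trans_le hσ
  have hζζ : conj ζ * ζ = 1 := by
    rw [mul_comm, Complex.mul_conj, Complex.normSq_eq_norm_sq, hζ]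
    norm_num
  have hXn : ∀ z, ‖1 - conj ζ * z‖ = ‖ζ - z‖ := fun z => by
    rw [← hζζ, ← mul_sub, norm_mul, RCLike.norm_conj, hζ, one_mul]
  have hXre : ∀ z : ℂ, ‖z‖ < 1 → 0 < (1 - conj ζ * z).re := fun z hz => by
    have := Complex.re_le_norm (conj ζ * z)
    rw [norm_mul, RCLike.norm_conj, hζ, one_mul] at this
    simp only [Complex.sub_re, Complex.one_re]
    linarith
  have hslit : ∀ z : ℂ, ‖z‖ < 1 → ∀ t : ℝ, 0 ≤ t → 1 - conj ζ * z + t ∈ Complex.slitPlane :=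
    fun z hz t ht => Or.inl (by
      have := hXre z hz
      rw [Complex.add_re, Complex.ofReal_re]
      linarith)
  let W : ℂ → ℂ := fun z => Complex.log (1 - conj ζ * z + σ) - Complex.log (1 - conj ζ * z + τ)
  let S : ℂ → ℂ := fun z => Complex.exp (-(α * W z))
  have hd : ∀ z : ℂ, ‖z‖ < 1 → HasDerivAt S (Complex.exp (-(α * W z)) *
      (-(α * ((-conj ζ) / (1 - conj ζ * z + σ) - (-conj ζ) / (1 - conj ζ * z + τ))))) z := by
    intro z hz
    have h2 : HasDerivAt (fun z : ℂ => 1 - conj ζ * z) (-(conj ζ)) z := by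
      simpa using ((hasDerivAt_id z).const_mul (conj ζ)).const_sub 1
    exact ((((h2.add_const (σ : ℂ)).clog (hslit z hz σ hσ0.le)).sub
      ((h2.add_const (τ : ℂ)).clog (hslit z hz τ hτ.le))).const_mul (α : ℂ)).neg.cexp
  have hWre : ∀ z : ℂ, ‖z‖ < 1 → 0 ≤ (W z).re := fun z hz => by
    simp only [W, Complex.sub_re, Complex.log_re]
    rw [sub_nonneg]
    have h1 := le_norm_add_ofReal (hXre z hz).le hτ.le
    have h2 := le_norm_add_ofReal (X := 1 - conj ζ * z + τ) (by
      have := hXre z hz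
      rw [Complex.add_re, Complex.ofReal_re]
      linarith) (t := σ - τ) (by linarith)
    have e : 1 - conj ζ * z + τ + ((σ - τ : ℝ) : ℂ) = 1 - conj ζ * z + σ := by push_cast; ring
    rw [e] at h2
    exact Real.log_le_log (hτ.trans_le h1.2) h2.1
  have hre : ∀ z : ℂ, ‖z‖ < 1 → 0 ≤ ((α : ℂ) * W z).re := fun z hz => by
    rw [Complex.re_ofReal_mul]
    exact mul_nonneg hα (hWre z hz)
  have hS1 : ∀ z : ℂ, ‖z‖ < 1 → ‖S z‖ ≤ 1 := fun z hz => by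
    simp only [S]
    rw [Complex.norm_exp, Complex.neg_re, Real.exp_le_one_iff]
    linarith [hre z hz]
  refine ⟨S, fun z hz => (hd z (mem_ball_zero_iff.1 hz)).differentiableAt.differentiableWithinAt,
    fun r hr => ?_, fun z hz => ⟨hS1 z hz, ?_, ?_⟩⟩
  · have e : conj ζ * (r * ζ) = r := by rw [mul_left_comm, hζζ, mul_one]
    have e1 : ∀ t : ℝ, 0 < t →
        Complex.log (1 - conj ζ * (r * ζ) + t) = (Real.log ((1 - r) + t) : ℝ) := fun t ht => by
      rw [e, Complex.ofReal_log (by linarith)]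
      push_cast
      rfl
    simp only [S, W]
    rw [e1 σ hσ0, e1 τ hτ, Real.rpow_def_of_pos (div_pos (by linarith) (by linarith)),
      Real.log_div (by linarith) (by linarith)]
    push_cast
    congr 1
    ring
  · rw [mul_min_of_nonneg _ _ zero_le_two]
    refine le_min ?_ ?_
    · have := norm_sub_le 1 (S z)
      rw [norm_one] at this
      linarith [hS1 z hz]
    · have h1 := norm_one_sub_exp_neg_le (hre z hz)
      have h2 := norm_log_add_sub_log_add_le (hXre z hz) hτ.le hσ
      rw [hXn] at h2
      rw [norm_mul, Complex.norm_real, Real.norm_of_nonneg hα] at h1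
      have h3 : 0 ≤ σ / ‖ζ - z‖ := by positivity
      have h4 : α * ‖W z‖ ≤ 1 * (σ / ‖ζ - z‖) := by
        gcongr
      simp only [S]
      linarith
  · have hX0 : 0 < ‖ζ - z‖ := by
      rw [← hXn]
      exact (hXre z hz).trans_le (Complex.re_le_norm _)
    have a1 := le_norm_add_ofReal (hXre z hz).le hτ.le
    have a2 := le_norm_add_ofReal (hXre z hz).le hσ0.le
    rw [hXn] at a1 a2
    have hz1 : 1 - ‖z‖ ≤ ‖ζ - z‖ := by
      rw [← hζ]
      exact norm_sub_norm_le _ _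
    rw [(hd z hz).deriv, norm_mul]
    have n1 : (1 - conj ζ * z + σ) ≠ 0 := norm_pos_iff.1 (hσ0.trans_le a2.2)
    have n2 : (1 - conj ζ * z + τ) ≠ 0 := norm_pos_iff.1 (hτ.trans_le a1.2)
    have e : (-(α * ((-conj ζ) / (1 - conj ζ * z + σ) - (-conj ζ) / (1 - conj ζ * z + τ))))
        = -((α : ℂ) * (conj ζ * (((σ - τ : ℝ) : ℂ) / ((1 - conj ζ * z + σ) * (1 - conj ζ * z + τ))))) := by
      rw [div_sub_div _ _ n1 n2]
      push_cast
      ring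
    rw [e, norm_neg, norm_mul, norm_mul, RCLike.norm_conj, hζ, one_mul, norm_div, norm_mul,
      Complex.norm_real, Complex.norm_real, Real.norm_of_nonneg hα,
      Real.norm_of_nonneg (show 0 ≤ σ - τ by linarith)]
    set A := ‖1 - conj ζ * z + σ‖
    set B := ‖1 - conj ζ * z + τ‖
    have hA : 0 < A := hσ0.trans_le a2.2
    have hB : 0 < B := hτ.trans_le a1.2
    have b1 : σ / A ≤ min 1 (σ / ‖ζ - z‖) :=
      le_min ((div_le_one hA).2 a2.2) (by gcongr; exact a2.1)
    have b2 : (1 - ‖z‖) / B ≤ min 1 ((1 - ‖z‖) / τ) :=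
      le_min ((div_le_one hB).2 (hz1.trans a1.1))
        (div_le_div_of_nonneg_left (by linarith) hτ a1.2)
    have h2 : 1 - ‖z‖ ^ 2 ≤ 2 * (1 - ‖z‖) := by nlinarith [norm_nonneg z]
    have h0 : 0 ≤ 1 - ‖z‖ := by linarith
    calc (1 - ‖z‖ ^ 2) * (‖Complex.exp (-(α * W z))‖ * (α * ((σ - τ) / (A * B))))
        ≤ (2 * (1 - ‖z‖)) * (1 * (α * (σ / (A * B)))) := by
          have : 0 ≤ σ - τ := by linarith
          gcongr
          · exact hS1 z hz
          · linarith
      _ = 2 * α * ((σ / A) * ((1 - ‖z‖) / B)) := by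
          field_simp
      _ ≤ _ := by gcongr

/-- A holomorphic function which vanishes at `r ζ`, is close to `1` away from the direction `ζ`, and
has small invariant derivative. -/
theorem exists_log_bump {m : ℕ} (hm : 800 ≤ m) {ζ : ℂ} (hζ : ‖ζ‖ = 1) {r : ℝ} (hr : r < 1)
    (hrm : 1 - r ≤ scaleBase ^ (400 * m)) : ∃ E : ℂ → ℂ, DifferentiableOn ℂ E (Metric.ball 0 1) ∧
      E (r * ζ) = 0 ∧ ∀ z : ℂ, ‖z‖ < 1 → ‖E z‖ ≤ 1 ∧ ‖1 - E z‖ ≤ 6 * sideWeight m ζ z ∧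
        (1 - ‖z‖ ^ 2) * ‖deriv E z‖ ≤ 6400 / m * (sideWeight m ζ z * depthWeight m z) := by
  have hm0 : (0 : ℝ) < m := by exact_mod_cast (by omega : 0 < m)
  have hτ := scaleBase_pow_pos (400 * m)
  have hστ : scaleBase ^ (400 * m) ≤ scaleBase ^ (399 * m) := scaleBase_pow_le (by omega)
  have hα1 : (800 : ℝ) / m ≤ 1 := (div_le_one hm0).2 (by exact_mod_cast hm)
  obtain ⟨S, hSd, hSr, hS⟩ := exists_half_plane_bump hζ hτ hστ (by positivity) hα1
  have hσ := scaleBase_pow_pos (399 * m)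
  set τ := scaleBase ^ (400 * m) with hτdef
  set σ := scaleBase ^ (399 * m) with hσdef
  set s : ℝ := (((1 - r) + τ) / ((1 - r) + σ)) ^ ((800 : ℝ) / m) with hs
  have hs0 : 0 ≤ s := Real.rpow_nonneg (div_nonneg (by linarith) (by linarith)) _
  -- The ratio τ/σ is 2^(-m/400), and the term 1 - r ≤ τ at most doubles the numerator. Since m ≥
  -- 800, the quotient is at most 2^(-m/800), and the exponent 800/m turns this into 1/2.
  have hs1 : s ≤ 1 / 2 := by
    have h1 : ((1 - r) + τ) / ((1 - r) + σ) ≤ 2 * scaleBase ^ m := by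
      rw [div_le_iff₀ (by linarith)]
      have : τ = scaleBase ^ m * σ := by rw [hτdef, hσdef, ← pow_add]; congr 1; omega
      have h3 : 0 ≤ scaleBase ^ m * (1 - r) := mul_nonneg (scaleBase_pow_pos _).le (by linarith)
      nlinarith
    have h2 : 2 * scaleBase ^ m ≤ (2 : ℝ) ^ (-(m / 800 : ℝ)) := by
      rw [scaleBase, ← Real.rpow_natCast, ← Real.rpow_mul two_pos.le]
      nth_rw 1 [← Real.rpow_one 2]
      rw [← Real.rpow_add two_pos]
      apply Real.rpow_le_rpow_of_exponent_le one_le_two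
      have : (800 : ℝ) ≤ m := by exact_mod_cast hm
      linarith
    calc s ≤ ((2 : ℝ) ^ (-(m / 800 : ℝ))) ^ ((800 : ℝ) / m) := by
          apply Real.rpow_le_rpow (div_nonneg (by linarith) (by linarith)) (h1.trans h2)
          positivity
      _ = 1 / 2 := by
          rw [← Real.rpow_mul two_pos.le]
          have : -(m / 800 : ℝ) * (800 / m) = -1 := by field_simp
          rw [this, Real.rpow_neg_one]
          norm_num
  have hden : ∀ z : ℂ, ‖z‖ < 1 → 1 / 2 ≤ ‖1 - (s : ℂ) * S z‖ := fun z hz => by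
    have h1 := norm_sub_norm_le 1 ((s : ℂ) * S z)
    rw [norm_one, norm_mul, Complex.norm_real, Real.norm_of_nonneg hs0] at h1
    have := (hS z hz).1
    nlinarith [norm_nonneg (S z)]
  have hden0 : ∀ z : ℂ, ‖z‖ < 1 → 1 - (s : ℂ) * S z ≠ 0 := fun z hz =>
    norm_pos_iff.1 (by linarith [hden z hz])
  have hder : ∀ z : ℂ, ‖z‖ < 1 → HasDerivAt (fun z => (S z - s) / (1 - (s : ℂ) * S z))
      (((1 - (s : ℂ) ^ 2) / (1 - (s : ℂ) * S z) ^ 2) * deriv S z) z := fun z hz => by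
    have h1 := (hSd.differentiableAt_of_norm_lt_one hz).hasDerivAt
    exact ((h1.sub_const (s : ℂ)).div ((h1.const_mul (s : ℂ)).const_sub 1) (hden0 z hz)).congr_deriv
      (by ring)
  -- Composition with the automorphism taking s = S(rζ) to 0 makes the zero exact; as s ≤ 1/2 it
  -- distorts derivatives by at most a factor 4.
  refine ⟨fun z => (S z - s) / (1 - s * S z), fun z hz =>
    (hder z (mem_ball_zero_iff.1 hz)).differentiableAt.differentiableWithinAt, ?_,
    fun z hz => ⟨?_, ?_, ?_⟩⟩
  · simp only
    rw [hSr r hr, sub_self, zero_div]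
  · rw [norm_div]
    apply div_le_one_of_le₀ _ (norm_nonneg _)
    have e := norm_one_sub_conj_mul_sq (S z) s
    rw [Complex.conj_ofReal] at e
    have h1 := (hS z hz).1
    have h2 : ‖(s : ℂ)‖ ≤ 1 := by rw [Complex.norm_real, Real.norm_of_nonneg hs0]; linarith
    have h3 : 0 ≤ (1 - ‖S z‖ ^ 2) * (1 - ‖(s : ℂ)‖ ^ 2) :=
      mul_nonneg (by nlinarith [norm_nonneg (S z)]) (by nlinarith [norm_nonneg (s : ℂ)])
    exact le_of_sq_le_sq (by linarith) (norm_nonneg _)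
  · have e : 1 - (S z - s) / (1 - s * S z) = ((1 + s : ℝ) : ℂ) * (1 - S z) / (1 - s * S z) := by
      rw [one_sub_div (hden0 z hz)]
      congr 1
      push_cast
      ring
    rw [e, norm_div, norm_mul, Complex.norm_real, Real.norm_of_nonneg (by linarith),
      div_le_iff₀ (by linarith [hden z hz])]
    have h1 := (hS z hz).2.1
    have h2 := sideWeight_nonneg m ζ z
    change ‖1 - S z‖ ≤ 2 * sideWeight m ζ z at h1
    have h3 := hden z hz
    have h4 := norm_nonneg (1 - S z)
    calc (1 + s) * ‖1 - S z‖ ≤ (3 / 2) * (2 * sideWeight m ζ z) := by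
          gcongr
          linarith
      _ = 6 * sideWeight m ζ z * (1 / 2) := by ring
      _ ≤ _ := by gcongr
  · have h1 := (hS z hz).2.2
    change _ ≤ 2 * (800 / m : ℝ) * (sideWeight m ζ z * _) at h1
    have h2 := sideWeight_nonneg m ζ z
    have h3 := hden z hz
    rw [(hder z hz).deriv, norm_mul, norm_div, norm_pow]
    have hn : ‖1 - (s : ℂ) ^ 2‖ ≤ 1 := by
      have : 1 - (s : ℂ) ^ 2 = ((1 - s ^ 2 : ℝ) : ℂ) := by push_cast; ring
      rw [this, Complex.norm_real, Real.norm_of_nonneg (by nlinarith)]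
      nlinarith
    have hq : ‖1 - (s : ℂ) ^ 2‖ / ‖1 - (s : ℂ) * S z‖ ^ 2 ≤ 4 := by
      rw [div_le_iff₀ (by positivity)]
      nlinarith
    have hp := one_sub_norm_sq_pos hz
    -- The exponent 400m is relaxed to 440m, so that one weight also dominates the gradient of the
    -- cluster interpolants.
    have hw : min 1 ((1 - ‖z‖) / τ) ≤ depthWeight m z := by
      apply min_le_min le_rfl
      apply div_le_div_of_nonneg_left (by linarith) (scaleBase_pow_pos _)
      exact scaleBase_pow_le (by omega)
    have hw0 : 0 ≤ min 1 ((1 - ‖z‖) / τ) := le_min zero_le_one (div_nonneg (by linarith) hτ.le)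
    calc (1 - ‖z‖ ^ 2) * (‖1 - (s : ℂ) ^ 2‖ / ‖1 - (s : ℂ) * S z‖ ^ 2 * ‖deriv S z‖)
        = (‖1 - (s : ℂ) ^ 2‖ / ‖1 - (s : ℂ) * S z‖ ^ 2) * ((1 - ‖z‖ ^ 2) * ‖deriv S z‖) := by ring
      _ ≤ 4 * (2 * (800 / m : ℝ) * (sideWeight m ζ z * min 1 ((1 - ‖z‖) / τ))) := by
          gcongr
      _ ≤ 4 * (2 * (800 / m : ℝ) * (sideWeight m ζ z * depthWeight m z)) := by gcongr
      _ = _ := by ring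

/-! ### Bloch interpolation at up to three points -/

lemma norm_log_one_sub_le {u : ℂ} (hu : ‖u‖ < 1) :
    ‖Complex.log (1 - u)‖ ≤ -Real.log (1 - ‖u‖) := by
  have h1 := Complex.hasSum_taylorSeries_neg_log hu
  have h2 := Real.hasSum_pow_div_log_of_abs_lt_one (x := ‖u‖) (by rwa [abs_norm])
  rw [← hasSum_nat_add_iff' 1] at h1
  simp only [Finset.range_one, Finset.sum_singleton, pow_zero, Nat.cast_zero, div_zero,
    sub_zero] at h1
  rw [← norm_neg, ← h1.tsum_eq, ← h2.tsum_eq]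
  refine tsum_of_norm_bounded h2.summable.hasSum fun n => ?_
  rw [norm_div, norm_pow, Complex.norm_natCast]
  push_cast
  rfl

/-- A Bloch function of logarithmic type vanishing at `p`, with size comparable to the hyperbolic
distance at `q`. -/
lemma exists_log_separator {p q : ℂ} (hp : ‖p‖ < 1) (hq : ‖q‖ < 1) :
    ∃ (v : ℂ → ℂ) (V : ℝ), DifferentiableOn ℂ v (Metric.ball 0 1) ∧ v p = 0 ∧ v q = V ∧
      -Real.log (1 - pseudoHyperbolicDist q p) ≤ 2 * V ∧
      ∀ z : ℂ, ‖z‖ < 1 → ‖v z‖ ≤ -Real.log (1 - pseudoHyperbolicDist z p) ∧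
        ‖v z‖ ≤ Real.log (2 / (1 - pseudoHyperbolicDist q p)) ∧
        (1 - ‖z‖ ^ 2) * ‖deriv v z‖ ≤
          2 * min 1 ((1 - ‖mobius p z‖ ^ 2) / (1 - pseudoHyperbolicDist q p)) := by
  set ρ := pseudoHyperbolicDist q p with hρ
  have hρ0 : 0 ≤ ρ := pseudoHyperbolicDist_nonneg q p
  have hρ1 : ρ < 1 := pseudoHyperbolicDist_lt_one hq hp
  -- A rotation that makes the value at q real and as large as possible; any unimodular number works
  -- when p = q.
  obtain ⟨w, hw1, hwq⟩ : ∃ w : ℂ, ‖w‖ = 1 ∧ w * mobius p q = ρ := by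
    by_cases h : mobius p q = 0
    · refine ⟨1, norm_one, ?_⟩
      rw [hρ, pseudoHyperbolicDist_eq_norm_mobius, h]
      simp
    · refine ⟨ρ / mobius p q, ?_, div_mul_cancel₀ _ h⟩
      rw [norm_div, Complex.norm_real, Real.norm_of_nonneg hρ0, hρ,
        pseudoHyperbolicDist_eq_norm_mobius]
      exact div_self (norm_ne_zero_iff.2 h)
  -- Halfway between ρ and 1: c < 1 bounds v by log(2/(1 - ρ)) and makes its gradient decay near the
  -- circle, while 1 - cρ = (1 - ρ)(1 + ρ/2) keeps v(q) comparable to -log(1 - ρ).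
  set c : ℝ := (1 + ρ) / 2 with hc
  have hc0 : 0 ≤ c := by linarith
  have hc1 : c < 1 := by linarith
  set b : ℂ := c * w with hb
  have hbn : ‖b‖ = c := by
    rw [hb, norm_mul, hw1, mul_one, Complex.norm_real, Real.norm_of_nonneg hc0]
  have hφ : ∀ z : ℂ, ‖z‖ < 1 → ‖mobius p z‖ < 1 := fun z hz => norm_mobius_lt_one hp hz
  have hbφn : ∀ z : ℂ, ‖b * mobius p z‖ = c * ‖mobius p z‖ := fun z => by rw [norm_mul, hbn]
  have hbφ : ∀ z : ℂ, ‖z‖ < 1 → ‖b * mobius p z‖ < 1 := fun z hz => by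
    rw [hbφn]
    nlinarith [hφ z hz, norm_nonneg (mobius p z)]
  have hd : ∀ z : ℂ, ‖z‖ < 1 → HasDerivAt (fun z => -Complex.log (1 - b * mobius p z))
      (-(-(b * deriv (mobius p) z) / (1 - b * mobius p z))) z := fun z hz => by
    refine ((((hasDerivAt_mobius hp hz).differentiableAt.hasDerivAt.const_mul b).const_sub
      1).clog ?_).neg
    left
    have := Complex.re_le_norm (b * mobius p z)
    rw [Complex.sub_re, Complex.one_re]
    linarith [hbφ z hz]
  refine ⟨fun z => -Complex.log (1 - b * mobius p z), -Real.log (1 - c * ρ),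
    fun z hz => (hd z (mem_ball_zero_iff.1 hz)).differentiableAt.differentiableWithinAt,
    by simp [mobius_self], ?_, ?_, fun z hz => ?_⟩
  · have : b * mobius p q = ((c * ρ : ℝ) : ℂ) := by rw [hb, mul_assoc, hwq]; push_cast; rfl
    simp only [this]
    rw [← Complex.ofReal_one, ← Complex.ofReal_sub, ← Complex.ofReal_log (by nlinarith),
      ← Complex.ofReal_neg]
  · have e : 1 - c * ρ = (1 - ρ) * (1 + ρ / 2) := by rw [hc]; ring
    rw [e, Real.log_mul (by linarith) (by linarith)]
    have h3 := Real.log_le_sub_one_of_pos (show 0 < 1 + ρ / 2 by linarith)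
    have h4 := Real.log_le_sub_one_of_pos (show 0 < 1 - ρ by linarith)
    linarith
  · have hn := norm_nonneg (mobius p z)
    have h1 := norm_log_one_sub_le (hbφ z hz)
    rw [hbφn] at h1
    have hz1 := hφ z hz
    refine ⟨?_, ?_, ?_⟩
    · rw [norm_neg, pseudoHyperbolicDist_eq_norm_mobius]
      refine h1.trans (neg_le_neg (Real.log_le_log (by linarith) ?_))
      nlinarith
    · rw [norm_neg]
      refine h1.trans ?_
      rw [← Real.log_inv]
      apply Real.log_le_log (inv_pos.2 (by nlinarith))
      rw [inv_eq_one_div, div_le_div_iff₀ (by nlinarith) (by linarith)]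
      nlinarith
    · have hden : 1 - c * ‖mobius p z‖ ≤ ‖1 - b * mobius p z‖ := by
        have := norm_sub_norm_le 1 (b * mobius p z)
        rwa [norm_one, hbφn] at this
      have hden0 : 0 < 1 - c * ‖mobius p z‖ := by nlinarith
      rw [(hd z hz).deriv, neg_div, neg_neg, norm_div, norm_mul, hbn]
      have e : (1 - ‖z‖ ^ 2) * (c * ‖deriv (mobius p) z‖ / ‖1 - b * mobius p z‖)
          = c * (1 - ‖mobius p z‖ ^ 2) / ‖1 - b * mobius p z‖ := by
        rw [← norm_deriv_mobius hp hz]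
        ring
      rw [e, div_le_iff₀ (by linarith)]
      have hnum : 0 ≤ 1 - ‖mobius p z‖ ^ 2 := by nlinarith
      have hm0 : 0 ≤ min 1 ((1 - ‖mobius p z‖ ^ 2) / (1 - ρ)) :=
        le_min zero_le_one (div_nonneg hnum (by linarith))
      refine le_trans ?_ (mul_le_mul_of_nonneg_left hden (by positivity))
      rcases min_choice 1 ((1 - ‖mobius p z‖ ^ 2) / (1 - ρ)) with h | h
      · rw [h]
        nlinarith
      · rw [h]
        have e : 2 * ((1 - ‖mobius p z‖ ^ 2) / (1 - ρ)) * (1 - c * ‖mobius p z‖)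
          = (1 - ‖mobius p z‖ ^ 2) * (2 * (1 - c * ‖mobius p z‖) / (1 - ρ)) := by ring
        rw [e, mul_comm c]
        gcongr
        rw [le_div_iff₀ (by linarith)]
        nlinarith

/-- The constant a plus the multiple (b - a)/V of the logarithmic separator; the coefficient is at
most 2C because the hyperbolic distance is at most -log(1 - ρ) ≤ 2V. -/
lemma exists_bloch_two_points {p q a b : ℂ} {C : ℝ} (hp : ‖p‖ < 1) (hq : ‖q‖ < 1) (hC : 0 ≤ C)
    (hab : ‖b - a‖ ≤ C * hyperbolicDist q p) :
    ∃ h : ℂ → ℂ, DifferentiableOn ℂ h (Metric.ball 0 1) ∧ h p = a ∧ h q = b ∧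
      ∀ z : ℂ, ‖z‖ < 1 → ‖h z - a‖ ≤ 2 * C * -Real.log (1 - pseudoHyperbolicDist z p) ∧
        ‖h z - a‖ ≤ 2 * C * Real.log (2 / (1 - pseudoHyperbolicDist q p)) ∧
        (1 - ‖z‖ ^ 2) * ‖deriv h z‖ ≤
          4 * C * min 1 ((1 - ‖mobius p z‖ ^ 2) / (1 - pseudoHyperbolicDist q p)) := by
  obtain ⟨v, V, hv, vp, vq, hV, H⟩ := exists_log_separator hp hq
  have hβ := hyperbolicDist_le_neg_log hq hp
  have hβ0 := hyperbolicDist_nonneg hq hp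
  have hV0 : 0 ≤ V := by linarith
  have hA : ‖(b - a) / V‖ ≤ 2 * C := by
    rw [norm_div, Complex.norm_real, Real.norm_of_nonneg hV0]
    apply div_le_of_le_mul₀ hV0 (by positivity)
    nlinarith
  have hder : ∀ z, ‖z‖ < 1 → HasDerivAt (fun z => a + (b - a) / V * v z)
      ((b - a) / V * deriv v z) z := fun z hz =>
    (((hv.differentiableAt_of_norm_lt_one hz).hasDerivAt).const_mul _).const_add _
  refine ⟨fun z => a + (b - a) / V * v z, (hv.const_mul _).const_add _, by simp [vp], ?_,
    fun z hz => ?_⟩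
  · simp only [vq]
    -- If V = 0 the distance bound forces b = a, so the division by zero in the coefficient does no
    -- harm.
    rcases hV0.eq_or_lt with h | h
    · have : ‖b - a‖ ≤ 0 := hab.trans (by rw [← h] at hV; nlinarith)
      rw [norm_le_zero_iff] at this
      simp [this, ← h]
      linear_combination -this
    · have : (V : ℂ) ≠ 0 := by exact_mod_cast h.ne'
      rw [div_mul_cancel₀ _ this]
      ring
  · obtain ⟨h1, h2, h3⟩ := H z hz
    simp only [add_sub_cancel_left]
    refine ⟨?_, ?_, ?_⟩
    · rw [norm_mul]; gcongr
    · rw [norm_mul]; gcongr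
    · rw [(hder z hz).deriv, norm_mul, mul_left_comm]
      have : 0 ≤ (1 - ‖z‖ ^ 2) * ‖deriv v z‖ :=
        mul_nonneg (one_sub_norm_sq_pos hz).le (norm_nonneg _)
      calc _ ≤ 2 * C * (2 * min 1 ((1 - ‖mobius p z‖ ^ 2) / (1 - pseudoHyperbolicDist q p))) := by
            gcongr
        _ = _ := by ring

set_option maxHeartbeats 1000000 in
-- Newton interpolation: the two-point solution is corrected at s by a multiple of vw, with v a
-- separator of s from p and w one of s from q. The coefficient is B/(VW) for a defect B = O(C Lp),
-- and the gradient of the correction is controlled by B/V and B/W. Both are O(C), because V and W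
-- are comparable to Lp and Lq and Lp ≤ 4Lq. The lower bounds 1/9 keep V and W away from 0, so that
-- |v| ≤ 20V and |w| ≤ 20W; no lower bound is needed between p and q.
lemma exists_bloch_three_points {p q s a b d : ℂ} {C κ : ℝ} (hp : ‖p‖ < 1) (hq : ‖q‖ < 1)
    (hs : ‖s‖ < 1) (hC : 0 ≤ C) (hab : ‖b - a‖ ≤ C * hyperbolicDist q p)
    (had : ‖d - a‖ ≤ C * hyperbolicDist s p)
    (hpq : pseudoHyperbolicDist q p ≤ pseudoHyperbolicDist s q)
    (hsp : 1 / 9 ≤ pseudoHyperbolicDist s p) (hsq : 1 / 9 ≤ pseudoHyperbolicDist s q)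
    (hκ : 0 < κ) (κqp : κ ≤ 1 - pseudoHyperbolicDist q p) (κsp : κ ≤ 1 - pseudoHyperbolicDist s p)
    (κsq : κ ≤ 1 - pseudoHyperbolicDist s q) :
    ∃ h : ℂ → ℂ, DifferentiableOn ℂ h (Metric.ball 0 1) ∧ h p = a ∧ h q = b ∧ h s = d ∧
      ∀ z : ℂ, ‖z‖ < 1 → ‖h z - a‖ ≤ 1300 * C * Real.log (2 / κ) ∧
        ∀ g, 1 - ‖mobius p z‖ ^ 2 ≤ g → 1 - ‖mobius q z‖ ^ 2 ≤ g →
          (1 - ‖z‖ ^ 2) * ‖deriv h z‖ ≤ 1300 * C * min 1 (g / κ) := by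
  obtain ⟨h, hh, hhp, hhq, H⟩ := exists_bloch_two_points hp hq hC hab
  obtain ⟨v, V, hv, vp, vs, hV, Hv⟩ := exists_log_separator hp hs
  obtain ⟨w, W, hw, wq, ws, hW, Hw⟩ := exists_log_separator hq hs
  have ρ1 := pseudoHyperbolicDist_lt_one hs hp
  have ρ2 := pseudoHyperbolicDist_lt_one hs hq
  have ρ3 := pseudoHyperbolicDist_lt_one hq hp
  have lV := Real.log_le_sub_one_of_pos (show 0 < 1 - pseudoHyperbolicDist s p by linarith)
  have lW := Real.log_le_sub_one_of_pos (show 0 < 1 - pseudoHyperbolicDist s q by linarith)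
  set Lp := -Real.log (1 - pseudoHyperbolicDist s p) with hLp
  set Lq := -Real.log (1 - pseudoHyperbolicDist s q) with hLq
  have hLp0 : 1 / 9 ≤ Lp := by linarith
  have hLq0 : 1 / 9 ≤ Lq := by linarith
  have hV0 : 1 / 18 ≤ V := by linarith
  have hW0 : 1 / 18 ≤ W := by linarith
  -- This is where the pair (p, q) being no farther apart than (s, q) enters: β(s, p) ≤ β(s, q) +
  -- β(q, p) ≤ 2β(s, q).
  have hLpq : Lp ≤ 4 * Lq := by
    have h1 := neg_log_le_two_mul_hyperbolicDist hs hp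
    have h2 := hyperbolicDist_triangle hs hq hp
    have h3 := hyperbolicDist_le_neg_log hs hq
    have h4 : hyperbolicDist q p ≤ -Real.log (1 - pseudoHyperbolicDist q p) :=
      hyperbolicDist_le_neg_log hq hp
    have h5 : hyperbolicDist q p ≤ hyperbolicDist s q := by
      rw [hyperbolicDist_eq hq hp, hyperbolicDist_eq hs hq]
      have l1 := Real.log_le_log (by linarith [pseudoHyperbolicDist_nonneg q p])
        (show 1 + pseudoHyperbolicDist q p ≤ 1 + pseudoHyperbolicDist s q by linarith)
      have l2 := Real.log_le_log (by linarith)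
        (show 1 - pseudoHyperbolicDist s q ≤ 1 - pseudoHyperbolicDist q p by linarith)
      linarith
    linarith
  set B := d - h s with hB
  have hBL : ‖B‖ ≤ 3 * C * Lp := by
    have e : B = (d - a) - (h s - a) := by rw [hB]; ring
    rw [e]
    refine (norm_sub_le _ _).trans ?_
    have h1 := (H s hs).1
    have h2 := hyperbolicDist_le_neg_log hs hp
    have h3 : C * hyperbolicDist s p ≤ C * Lp := by gcongr
    linarith
  set D := B / (V * W) with hD
  have hDn : ‖D‖ = ‖B‖ / (V * W) := by
    rw [hD, norm_div, norm_mul, Complex.norm_real, Complex.norm_real,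
      Real.norm_of_nonneg (by linarith), Real.norm_of_nonneg (by linarith)]
  have l2 : Real.log 2 ≤ 1 := by linarith [Real.log_two_lt_d9]
  have l20 : 0 ≤ Real.log 2 := Real.log_nonneg one_le_two
  have hvb : ∀ z : ℂ, ‖z‖ < 1 → ‖v z‖ ≤ 20 * V := fun z hz => by
    refine (Hv z hz).2.1.trans ?_
    rw [Real.log_div two_ne_zero (by linarith)]
    linarith
  have hwb : ∀ z : ℂ, ‖z‖ < 1 → ‖w z‖ ≤ 20 * W := fun z hz => by
    refine (Hw z hz).2.1.trans ?_
    rw [Real.log_div two_ne_zero (by linarith)]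
    linarith
  have hVp : 0 < V := by linarith
  have hWp : 0 < W := by linarith
  have hder : ∀ z, ‖z‖ < 1 → HasDerivAt (fun z => h z + D * (v z * w z))
      (deriv h z + D * (deriv v z * w z + v z * deriv w z)) z := fun z hz =>
    (hh.differentiableAt_of_norm_lt_one hz).hasDerivAt.add
      (((hv.differentiableAt_of_norm_lt_one hz).hasDerivAt.mul
        (hw.differentiableAt_of_norm_lt_one hz).hasDerivAt).const_mul _)
  have hLκ : Lp ≤ Real.log (2 / κ) := by
    rw [hLp, ← Real.log_inv]
    apply Real.log_le_log (inv_pos.2 (by linarith))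
    rw [inv_eq_one_div]
    apply div_le_div₀ <;> linarith
  refine ⟨fun z => h z + D * (v z * w z), hh.add ((hv.mul hw).const_mul _), by simp [vp, hhp],
    by simp [wq, hhq], ?_, fun z hz => ⟨?_, fun g gp gq => ?_⟩⟩
  · simp only [vs, ws, hD, hB]
    have : (V : ℂ) ≠ 0 := by exact_mod_cast hVp.ne'
    have : (W : ℂ) ≠ 0 := by exact_mod_cast hWp.ne'
    field_simp
    ring
  · have e : h z + D * (v z * w z) - a = (h z - a) + D * (v z * w z) := by ring
    simp only [e]
    refine (norm_add_le _ _).trans ?_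
    have h1 := (H z hz).2.1
    have h2 : Real.log (2 / (1 - pseudoHyperbolicDist q p)) ≤ Real.log (2 / κ) := by
      apply Real.log_le_log (div_pos two_pos (by linarith))
      gcongr
    have h3 : ‖D * (v z * w z)‖ ≤ 400 * ‖B‖ := by
      rw [norm_mul, norm_mul, hDn]
      calc ‖B‖ / (V * W) * (‖v z‖ * ‖w z‖) ≤ ‖B‖ / (V * W) * ((20 * V) * (20 * W)) := by
            gcongr
            · exact hvb z hz
            · exact hwb z hz
        _ = _ := by field_simp; ring
    have h4 : C * Lp ≤ C * Real.log (2 / κ) := by gcongr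
    have h5 : C * Real.log (2 / (1 - pseudoHyperbolicDist q p)) ≤ C * Real.log (2 / κ) := by
      gcongr
    have h6 : 0 ≤ C * Real.log (2 / κ) := mul_nonneg hC (by linarith)
    linarith
  · rw [(hder z hz).deriv]
    have hp0 := (one_sub_norm_sq_pos hz).le
    have hgp : 0 ≤ 1 - ‖mobius p z‖ ^ 2 := (one_sub_norm_sq_pos (norm_mobius_lt_one hp hz)).le
    have hg : 0 ≤ g := hgp.trans gp
    set μ := min 1 (g / κ) with hμ
    have hμ0 : 0 ≤ μ := le_min zero_le_one (by positivity)
    have m1 : min 1 ((1 - ‖mobius p z‖ ^ 2) / (1 - pseudoHyperbolicDist q p)) ≤ μ :=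
      min_le_min le_rfl (div_le_div₀ hg gp hκ κqp)
    have m2 : min 1 ((1 - ‖mobius p z‖ ^ 2) / (1 - pseudoHyperbolicDist s p)) ≤ μ :=
      min_le_min le_rfl (div_le_div₀ hg gp hκ κsp)
    have m3 : min 1 ((1 - ‖mobius q z‖ ^ 2) / (1 - pseudoHyperbolicDist s q)) ≤ μ :=
      min_le_min le_rfl (div_le_div₀ hg gq hκ κsq)
    have t1 : (1 - ‖z‖ ^ 2) * ‖deriv h z‖ ≤ 4 * C * μ := (H z hz).2.2.trans (by gcongr)
    have t2 : (1 - ‖z‖ ^ 2) * ‖deriv v z‖ ≤ 2 * μ := (Hv z hz).2.2.trans (by gcongr)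
    have t3 : (1 - ‖z‖ ^ 2) * ‖deriv w z‖ ≤ 2 * μ := (Hw z hz).2.2.trans (by gcongr)
    have n1 : ‖deriv h z + D * (deriv v z * w z + v z * deriv w z)‖ ≤
        ‖deriv h z‖ + ‖D‖ * (‖deriv v z‖ * ‖w z‖ + ‖v z‖ * ‖deriv w z‖) := by
      refine (norm_add_le _ _).trans ?_
      rw [norm_mul]
      gcongr
      refine (norm_add_le _ _).trans ?_
      rw [norm_mul, norm_mul]
    have b1 : ‖B‖ / V ≤ 6 * C := by
      rw [div_le_iff₀ hVp]
      nlinarith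
    have b2 : ‖B‖ / W ≤ 24 * C := by
      rw [div_le_iff₀ hWp]
      nlinarith
    calc _ ≤ (1 - ‖z‖ ^ 2) *
          (‖deriv h z‖ + ‖D‖ * (‖deriv v z‖ * ‖w z‖ + ‖v z‖ * ‖deriv w z‖)) := by gcongr
      _ = (1 - ‖z‖ ^ 2) * ‖deriv h z‖ + ‖D‖ * (((1 - ‖z‖ ^ 2) * ‖deriv v z‖) * ‖w z‖
          + ‖v z‖ * ((1 - ‖z‖ ^ 2) * ‖deriv w z‖)) := by ring
      _ ≤ 4 * C * μ + ‖D‖ * ((2 * μ) * (20 * W) + (20 * V) * (2 * μ)) := by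
          gcongr
          · exact hwb z hz
          · exact hvb z hz
      _ = 4 * C * μ + 40 * μ * (‖B‖ / V + ‖B‖ / W) := by
          rw [hDn]
          field_simp
          ring
      _ ≤ 4 * C * μ + 40 * μ * (6 * C + 24 * C) := by gcongr
      _ ≤ 1300 * C * μ := by nlinarith [mul_nonneg hC hμ0]

/-- Lipschitz data on at most three points, without a triple of points close to one of them, are
interpolated by a Bloch function with uniform bounds. -/
theorem exists_bloch_cluster {ι : Type*} (s : Finset ι) (hne : s.Nonempty) (hcard : s.card ≤ 3)
    {z a : ι → ℂ} {C κ B : ℝ} (hz : ∀ i ∈ s, ‖z i‖ < 1) (hC : 0 ≤ C)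
    (ha : ∀ i ∈ s, ∀ j ∈ s, ‖a i - a j‖ ≤ C * hyperbolicDist (z i) (z j))
    (hB : ∀ i ∈ s, ‖a i‖ ≤ B) (hκ : 0 < κ)
    (hκs : ∀ i ∈ s, ∀ j ∈ s, κ ≤ 1 - pseudoHyperbolicDist (z i) (z j))
    (htriple : ∀ i ∈ s, ∀ j ∈ s, ∀ k ∈ s, i ≠ j → j ≠ k → i ≠ k →
      pseudoHyperbolicDist (z i) (z j) < 1 / 9 → ¬ pseudoHyperbolicDist (z i) (z k) < 1 / 9) :
    ∃ h : ℂ → ℂ, DifferentiableOn ℂ h (Metric.ball 0 1) ∧ (∀ i ∈ s, h (z i) = a i) ∧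
      ∀ w : ℂ, ‖w‖ < 1 → ‖h w‖ ≤ B + 1300 * C * Real.log (2 / κ) ∧
        ∀ g, (∀ i ∈ s, 1 - ‖mobius (z i) w‖ ^ 2 ≤ g) →
          (1 - ‖w‖ ^ 2) * ‖deriv h w‖ ≤ 1300 * C * min 1 (g / κ) := by
  classical
  have hκ1 : κ ≤ 1 := by
    obtain ⟨i, hi⟩ := hne
    simpa [pseudoHyperbolicDist_self] using hκs i hi i hi
  have hlog : 0 ≤ Real.log (2 / κ) := Real.log_nonneg (by rw [le_div_iff₀ hκ]; linarith)
  have hCl : 0 ≤ C * Real.log (2 / κ) := mul_nonneg hC hlog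
  have hμ : ∀ i ∈ s, ∀ w : ℂ, ‖w‖ < 1 → ∀ g, 1 - ‖mobius (z i) w‖ ^ 2 ≤ g → 0 ≤ min 1 (g / κ) :=
    fun i hi w hw g hg => le_min zero_le_one (div_nonneg
      ((one_sub_norm_sq_pos (norm_mobius_lt_one (hz i hi) hw)).le.trans hg) hκ.le)
  -- Label the points so that (i, j) is a closest pair. If k were within 1/9 of i or of j, that
  -- point would have two close neighbours, against `htriple`.
  have three : ∀ i j k, i ≠ j → i ≠ k → j ≠ k → s = {i, j, k} →
      pseudoHyperbolicDist (z j) (z i) ≤ pseudoHyperbolicDist (z k) (z i) →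
      pseudoHyperbolicDist (z j) (z i) ≤ pseudoHyperbolicDist (z k) (z j) →
      ∃ h : ℂ → ℂ, DifferentiableOn ℂ h (Metric.ball 0 1) ∧ (∀ i ∈ s, h (z i) = a i) ∧
        ∀ w : ℂ, ‖w‖ < 1 → ‖h w‖ ≤ B + 1300 * C * Real.log (2 / κ) ∧
          ∀ g, (∀ i ∈ s, 1 - ‖mobius (z i) w‖ ^ 2 ≤ g) →
            (1 - ‖w‖ ^ 2) * ‖deriv h w‖ ≤ 1300 * C * min 1 (g / κ) := by
    intro i j k hij hik hjk hs h1 h2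
    have mi : i ∈ s := by simp [hs]
    have mj : j ∈ s := by simp [hs]
    have mk : k ∈ s := by simp [hs]
    have c1 := pseudoHyperbolicDist_comm (z i) (z j)
    have c2 := pseudoHyperbolicDist_comm (z i) (z k)
    have c3 := pseudoHyperbolicDist_comm (z j) (z k)
    obtain ⟨h, hd, hi, hj, hk, H⟩ := exists_bloch_three_points (hz i mi) (hz j mj) (hz k mk) hC
      (ha j mj i mi) (ha k mk i mi) h2
      (by
        by_contra hcon
        rw [not_le] at hcon
        exact htriple i mi j mj k mk hij hjk hik (by linarith) (by linarith))
      (by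
        by_contra hcon
        rw [not_le] at hcon
        exact htriple j mj i mi k mk hij.symm hik hjk (by linarith) (by linarith))
      hκ (hκs j mj i mi) (hκs k mk i mi) (hκs k mk j mj)
    refine ⟨h, hd, fun l hl => ?_, fun w hw => ⟨?_, fun g hg => ?_⟩⟩
    · rw [hs] at hl
      simp only [Finset.mem_insert, Finset.mem_singleton] at hl
      rcases hl with rfl | rfl | rfl <;> assumption
    · have h3 := (H w hw).1
      have h4 := norm_sub_norm_le (h w) (a i)
      linarith [hB i mi]
    · exact (H w hw).2 g (hg i mi) (hg j mj)
  obtain hc | hc | hc : s.card = 1 ∨ s.card = 2 ∨ s.card = 3 := by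
    have := hne.card_pos
    omega
  · obtain ⟨i, hi⟩ := Finset.card_eq_one.1 hc
    have mi : i ∈ s := by simp [hi]
    refine ⟨fun _ => a i, differentiableOn_const _, fun j hj => ?_, fun w hw => ⟨?_, fun g hg => ?_⟩⟩
    · rw [hi, Finset.mem_singleton] at hj
      rw [hj]
    · linarith [hB i mi]
    · rw [deriv_const, norm_zero, mul_zero]
      have := hμ i mi w hw g (hg i mi)
      positivity
  · obtain ⟨i, j, hij, hs⟩ := Finset.card_eq_two.1 hc
    have mi : i ∈ s := by simp [hs]
    have mj : j ∈ s := by simp [hs]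
    obtain ⟨h, hd, hi, hj, H⟩ := exists_bloch_two_points (hz i mi) (hz j mj) hC (ha j mj i mi)
    refine ⟨h, hd, fun l hl => ?_, fun w hw => ⟨?_, fun g hg => ?_⟩⟩
    · rw [hs] at hl
      simp only [Finset.mem_insert, Finset.mem_singleton] at hl
      rcases hl with rfl | rfl <;> assumption
    · have h3 := (H w hw).2.1
      have h4 := norm_sub_norm_le (h w) (a i)
      have h2 : Real.log (2 / (1 - pseudoHyperbolicDist (z j) (z i))) ≤ Real.log (2 / κ) := by
        have := hκs j mj i mi
        apply Real.log_le_log (div_pos two_pos (by linarith))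
        gcongr
      have h5 : C * Real.log (2 / (1 - pseudoHyperbolicDist (z j) (z i))) ≤ C * Real.log (2 / κ) := by
        gcongr
      linarith [hB i mi]
    · have h3 := (H w hw).2.2
      have h0 := (one_sub_norm_sq_pos (norm_mobius_lt_one (hz i mi) hw)).le
      have m1 : min 1 ((1 - ‖mobius (z i) w‖ ^ 2) / (1 - pseudoHyperbolicDist (z j) (z i)))
          ≤ min 1 (g / κ) :=
        min_le_min le_rfl (div_le_div₀ (h0.trans (hg i mi)) (hg i mi) hκ (hκs j mj i mi))
      have h6 := hμ i mi w hw g (hg i mi)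
      refine h3.trans ?_
      calc _ ≤ 4 * C * min 1 (g / κ) := by gcongr
        _ ≤ _ := by nlinarith [mul_nonneg hC h6]
  · obtain ⟨i, j, k, hij, hik, hjk, hs⟩ := Finset.card_eq_three.1 hc
    have c1 := pseudoHyperbolicDist_comm (z i) (z j)
    have c2 := pseudoHyperbolicDist_comm (z i) (z k)
    have c3 := pseudoHyperbolicDist_comm (z j) (z k)
    rcases le_total (pseudoHyperbolicDist (z i) (z j)) (pseudoHyperbolicDist (z i) (z k)) with u | u
    · rcases le_total (pseudoHyperbolicDist (z i) (z j)) (pseudoHyperbolicDist (z j) (z k))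
        with v | v
      · exact three i j k hij hik hjk hs (by linarith) (by linarith)
      · exact three j k i hjk hij.symm hik.symm (by rw [hs]; ext; simp; tauto) (by linarith)
          (by linarith)
    · rcases le_total (pseudoHyperbolicDist (z i) (z k)) (pseudoHyperbolicDist (z j) (z k))
        with v | v
      · exact three i k j hik hij hjk.symm (by rw [hs]; ext; simp; tauto) (by linarith)
          (by linarith)
      · exact three j k i hjk hij.symm hik.symm (by rw [hs]; ext; simp; tauto) (by linarith)
          (by linarith)

/-! ### Packing of points on the unit circle -/

/-- On this arc the imaginary part is a coordinate with distortion at most 2, which reduces counting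
on the circle to counting on a line. Since 7/10 < 1/√2, the arc and its rotations by powers of i
cover the circle. -/
lemma norm_sub_le_two_mul_abs_im_sub {u v : ℂ} (hu : ‖u‖ = 1) (hv : ‖v‖ = 1) (hur : 7 / 10 ≤ u.re)
    (hvr : 7 / 10 ≤ v.re) : ‖u - v‖ ≤ 2 * |u.im - v.im| := by
  have h1 : u.re ^ 2 + u.im ^ 2 = 1 := by
    have := Complex.normSq_eq_norm_sq u
    rw [Complex.normSq_apply, hu] at this
    nlinarith
  have h2 : v.re ^ 2 + v.im ^ 2 = 1 := by
    have := Complex.normSq_eq_norm_sq v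
    rw [Complex.normSq_apply, hv] at this
    nlinarith
  rw [← abs_of_nonneg (norm_nonneg (u - v)), ← abs_two, ← abs_mul, ← sq_le_sq,
    ← Complex.normSq_eq_norm_sq, Complex.normSq_apply, Complex.sub_re, Complex.sub_im]
  have h3 : (u.re - v.re) * (u.re + v.re) = -((u.im - v.im) * (u.im + v.im)) := by nlinarith
  have h4 : ((u.re - v.re) * (u.re + v.re)) ^ 2 = ((u.im - v.im) * (u.im + v.im)) ^ 2 := by
    rw [h3]
    ring
  have h5 : (7 / 5) ^ 2 ≤ (u.re + v.re) ^ 2 := by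
    apply pow_le_pow_left₀ <;> linarith
  have h6 : (u.im + v.im) ^ 2 ≤ 51 / 25 := by nlinarith [sq_nonneg (u.im - v.im)]
  rw [mul_pow, mul_pow] at h4
  have h7 := mul_le_mul_of_nonneg_left h5 (sq_nonneg (u.re - v.re))
  have h8 := mul_le_mul_of_nonneg_left h6 (sq_nonneg (u.im - v.im))
  nlinarith [sq_nonneg (u.im - v.im)]

lemma card_le_of_fiber_le_three {ι : Type*} {T : Finset ι} {y : ι → ℝ} {t s c : ℝ} (ht : 0 < t)
    (hs : 0 ≤ s) (h3 : ∀ S ⊆ T, (∀ i ∈ S, ∀ j ∈ S, |y i - y j| ≤ t) → S.card ≤ 3)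
    (hy : ∀ i ∈ T, |y i - c| ≤ s) : (T.card : ℝ) ≤ 6 * s / t + 6 := by
  classical
  have hmaps : ∀ i ∈ T, ⌊y i / t⌋ ∈ Finset.Icc ⌊(c - s) / t⌋ ⌊(c + s) / t⌋ := fun i hi => by
    have := abs_le.1 (hy i hi)
    rw [Finset.mem_Icc]
    exact ⟨Int.floor_mono (by gcongr; linarith), Int.floor_mono (by gcongr; linarith)⟩
  have hcard := Finset.card_le_mul_card_image_of_maps_to hmaps 3 (fun b _ => by
    apply h3 _ (Finset.filter_subset _ _)
    intro i hi j hj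
    rw [Finset.mem_filter] at hi hj
    have e : ⌊y i / t⌋ = ⌊y j / t⌋ := hi.2.trans hj.2.symm
    have := (Int.abs_sub_lt_one_of_floor_eq_floor e).le
    rwa [← sub_div, abs_div, abs_of_pos ht, div_le_one ht] at this)
  rw [Int.card_Icc] at hcard
  have h1 : (T.card : ℝ) ≤ 3 * ((⌊(c + s) / t⌋ + 1 - ⌊(c - s) / t⌋).toNat : ℝ) := by
    exact_mod_cast hcard
  have h2 : ((⌊(c + s) / t⌋ + 1 - ⌊(c - s) / t⌋).toNat : ℝ) ≤ 2 * s / t + 2 := by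
    have h5 : (((⌊(c + s) / t⌋ + 1 - ⌊(c - s) / t⌋).toNat : ℤ) : ℝ)
        = ((max (⌊(c + s) / t⌋ + 1 - ⌊(c - s) / t⌋) 0 : ℤ) : ℝ) := by rw [Int.ofNat_toNat]
    rw [Int.cast_natCast] at h5
    rw [h5, Int.cast_max]
    apply max_le
    · push_cast
      have h3 := Int.floor_le ((c + s) / t)
      have h4 := (Int.sub_one_lt_floor ((c - s) / t)).le
      have e : 2 * s / t = (c + s) / t - (c - s) / t := by ring
      rw [e]
      linarith
    · push_cast
      positivity
  calc (T.card : ℝ) ≤ 3 * (2 * s / t + 2) := h1.trans (by gcongr)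
    _ = _ := by ring

/-- A finite family on the unit circle, at most three members of which lie in any set of diameter
`t`, has `O(1 + s / t)` members within distance `s` of a given point. -/
lemma card_le_of_separated_on_circle {ι : Type*} {T : Finset ι} {u : ι → ℂ} {t s : ℝ} {w : ℂ}
    (hu : ∀ i ∈ T, ‖u i‖ = 1) (ht : 0 < t) (hs : 0 ≤ s)
    (h3 : ∀ S ⊆ T, (∀ i ∈ S, ∀ j ∈ S, ‖u i - u j‖ ≤ t) → S.card ≤ 3)
    (hw : ∀ i ∈ T, ‖u i - w‖ ≤ s) : (T.card : ℝ) ≤ 48 * s / t + 24 := by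
  classical
  have hI : ∀ k : ℕ, ‖Complex.I ^ k‖ = 1 := fun k => by simp
  let A : ℕ → Finset ι := fun k => T.filter fun i => 7 / 10 ≤ (Complex.I ^ k * u i).re
  have hA : ∀ k, ((A k).card : ℝ) ≤ 12 * s / t + 6 := by
    intro k
    have := card_le_of_fiber_le_three (T := A k) (y := fun i => (Complex.I ^ k * u i).im)
      (t := t / 2) (s := s) (c := (Complex.I ^ k * w).im) (by positivity) hs
      (fun S hS hS' => h3 S (hS.trans (Finset.filter_subset _ _)) fun i hi j hj => by
        have hi' := Finset.mem_filter.1 (hS hi)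
        have hj' := Finset.mem_filter.1 (hS hj)
        have h1 := norm_sub_le_two_mul_abs_im_sub (u := Complex.I ^ k * u i)
          (v := Complex.I ^ k * u j) (by rw [norm_mul, hI, hu i hi'.1, one_mul])
          (by rw [norm_mul, hI, hu j hj'.1, one_mul]) hi'.2 hj'.2
        rw [← mul_sub, norm_mul, hI, one_mul] at h1
        have h2 := hS' i hi j hj
        linarith)
      (fun i hi => by
        have h1 := Complex.abs_im_le_norm (Complex.I ^ k * u i - Complex.I ^ k * w)
        rw [← mul_sub, norm_mul, hI, one_mul, mul_sub, Complex.sub_im] at h1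
        exact h1.trans (hw i (Finset.mem_filter.1 hi).1))
    convert this using 2
    field_simp
    ring
  have hcov : T ⊆ (Finset.range 4).biUnion A := by
    intro i hi
    rw [Finset.mem_biUnion]
    by_contra hcon
    push Not at hcon
    have h1 : (u i).re * (u i).re + (u i).im * (u i).im = 1 := by
      have := Complex.normSq_eq_norm_sq (u i)
      rw [Complex.normSq_apply, hu i hi] at this
      linarith
    have key : ∀ k < 4, (Complex.I ^ k * u i).re < 7 / 10 := fun k hk => by
      have := hcon k (Finset.mem_range.2 hk)
      simp only [A, Finset.mem_filter, not_and, not_le] at this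
      exact this hi
    have k0 := key 0 (by norm_num)
    have k1 := key 1 (by norm_num)
    have k2 := key 2 (by norm_num)
    have k3 := key 3 (by norm_num)
    rw [pow_zero, one_mul] at k0
    rw [pow_one] at k1
    rw [Complex.I_sq] at k2
    rw [Complex.I_pow_three] at k3
    simp at k1 k2 k3
    nlinarith
  calc (T.card : ℝ) ≤ (((Finset.range 4).biUnion A).card : ℝ) := by
        exact_mod_cast Finset.card_le_card hcov
    _ ≤ ∑ k ∈ Finset.range 4, ((A k).card : ℝ) := by exact_mod_cast Finset.card_biUnion_le
    _ ≤ ∑ k ∈ Finset.range 4, (12 * s / t + 6) := Finset.sum_le_sum fun k _ => hA k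
    _ = _ := by
      rw [Finset.sum_const, Finset.card_range]
      simp only [nsmul_eq_mul]
      push_cast
      ring

lemma sum_le_tsum_of_fiber {ι : Type*} {T : Finset ι} {lev : ι → ℕ} {g : ι → ℝ} {b : ℕ → ℝ}
    (hb : Summable b) (hb0 : ∀ m, 0 ≤ b m)
    (h : ∀ m, ∑ i ∈ T.filter (fun i => lev i = m), g i ≤ b m) : ∑ i ∈ T, g i ≤ ∑' m, b m := by
  classical
  rw [← Finset.sum_fiberwise_of_maps_to (g := lev) (t := T.image lev)
    fun i hi => Finset.mem_image_of_mem _ hi]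
  exact (Finset.sum_le_sum fun m _ => h m).trans (hb.sum_le_tsum _ fun m _ => hb0 m)

/-! ### Sparse families of points in the disc -/

/-- A family of points `r i * ζ i` of the disc with levels: `1 - r i` is comparable to
`2 ^ (-lev i)`. -/
structure DiscFamily (ι : Type*) where
  r : ι → ℝ
  ζ : ι → ℂ
  lev : ι → ℕ
  r_nonneg : ∀ i, 0 ≤ r i
  norm_ζ : ∀ i, ‖ζ i‖ = 1
  le_one_sub : ∀ i, scaleBase ^ (400 * lev i) / 2 ≤ 1 - r i
  one_sub_le : ∀ i, 1 - r i ≤ scaleBase ^ (400 * lev i)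
  finite_lev : ∀ m, {i | lev i = m}.Finite

namespace DiscFamily

variable {ι : Type*} (F : DiscFamily ι)

/-- The points of the family. -/
def pt (i : ι) : ℂ := F.r i * F.ζ i

/-- Two indices are wide neighbours if their levels are comparable and their directions are
close. -/
def Wide (i j : ι) : Prop :=
  F.lev i * 1000 ≤ 1045 * F.lev j ∧ F.lev j * 1000 ≤ 1045 * F.lev i ∧
    ‖F.ζ i - F.ζ j‖ ≤ scaleBase ^ (372 * F.lev i) ∧ ‖F.ζ i - F.ζ j‖ ≤ scaleBase ^ (372 * F.lev j)

/-- A family is sparse beyond level `m₀` if there are no four mutual wide neighbours and no point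
with two others at small hyperbolic distance from it. -/
structure Sparse (m₀ : ℕ) : Prop where
  le_lev : ∀ i, m₀ ≤ F.lev i
  card_le : ∀ s : Finset ι, (∀ i ∈ s, ∀ j ∈ s, F.Wide i j) → s.card ≤ 3
  no_triple : ∀ i j k, i ≠ j → j ≠ k → i ≠ k → ‖F.pt j - F.pt i‖ < (1 - F.r i) / 4 →
    ¬ ‖F.pt k - F.pt i‖ < (1 - F.r i) / 4

variable {F}

lemma r_lt_one (i : ι) : F.r i < 1 := by
  have := F.le_one_sub i
  have := scaleBase_pow_pos (400 * F.lev i)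
  linarith

lemma norm_pt (i : ι) : ‖F.pt i‖ = F.r i := by
  rw [pt, norm_mul, F.norm_ζ, mul_one, Complex.norm_real, Real.norm_of_nonneg (F.r_nonneg i)]

lemma norm_pt_lt_one (i : ι) : ‖F.pt i‖ < 1 := by
  rw [norm_pt]
  exact r_lt_one i

lemma norm_ζ_sub_pt (i : ι) : ‖F.ζ i - F.pt i‖ = 1 - F.r i := by
  have e : F.ζ i - F.pt i = ((1 - F.r i : ℝ) : ℂ) * F.ζ i := by rw [pt]; push_cast; ring
  rw [e, norm_mul, F.norm_ζ, mul_one, Complex.norm_real,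
    Real.norm_of_nonneg (by linarith [F.r_lt_one i])]

lemma one_sub_norm_le (i : ι) (z : ℂ) : 1 - ‖z‖ ≤ ‖F.ζ i - z‖ := by
  rw [← F.norm_ζ i]
  exact norm_sub_norm_le _ _

lemma scaleBase_pow_800 : scaleBase ^ 800 = 1 / 4 := by
  rw [show 800 = 400 * 2 by norm_num, pow_mul, scaleBase_pow_400]
  norm_num

lemma four_mul_scaleBase_pow_le {a b : ℕ} (h : a + 800 ≤ b) :
    4 * scaleBase ^ b ≤ scaleBase ^ a := by
  have h1 := scaleBase_pow_le h
  rw [pow_add, scaleBase_pow_800] at h1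
  linarith

/-- The gap between the exponents 398 and 372 absorbs a level spread of 4.5 percent, since 372 ·
1.045 < 389, and for l ≥ 800 what remains exceeds the 800 steps of the scale that pay for the factor
4. -/
lemma wide_of_norm_le {i j : ι} {l : ℕ} (hl : 800 ≤ l) (hi : F.lev i * 1000 ≤ 1045 * l)
    (hj : F.lev j * 1000 ≤ 1045 * l) (hij : F.lev i * 1000 ≤ 1045 * F.lev j)
    (hji : F.lev j * 1000 ≤ 1045 * F.lev i)
    (h : ‖F.ζ i - F.ζ j‖ ≤ 4 * scaleBase ^ (398 * l)) : F.Wide i j :=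
  ⟨hij, hji, h.trans (four_mul_scaleBase_pow_le (by omega)),
    h.trans (four_mul_scaleBase_pow_le (by omega))⟩

variable (F) in
/-- The index `i` is near `z` if `z` is close to the direction of `i`. -/
def Near (z : ℂ) (i : ι) : Prop := ‖F.ζ i - z‖ < scaleBase ^ (398 * F.lev i) / 4

lemma Near.norm_ζ_sub_le {z : ℂ} {i j : ι} (hi : F.Near z i) (hj : F.Near z j) {l : ℕ}
    (hli : l ≤ F.lev i) (hlj : l ≤ F.lev j) :
    ‖F.ζ i - F.ζ j‖ ≤ scaleBase ^ (398 * l) / 2 := by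
  have e : F.ζ i - F.ζ j = (F.ζ i - z) - (F.ζ j - z) := by ring
  have h1 := scaleBase_pow_le (show 398 * l ≤ 398 * F.lev i by omega)
  have h2 := scaleBase_pow_le (show 398 * l ≤ 398 * F.lev j by omega)
  rw [e]
  refine (norm_sub_le _ _).trans ?_
  unfold Near at hi hj
  linarith

variable {m₀ : ℕ}

lemma Sparse.card_near_le (hF : F.Sparse m₀) (hm₀ : 800 ≤ m₀) {z : ℂ} {T : Finset ι}
    (hT : ∀ i ∈ T, F.Near z i) (hlev : ∀ i ∈ T, ∀ j ∈ T, F.lev i * 1000 ≤ 1045 * F.lev j) :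
    T.card ≤ 3 := by
  refine hF.card_le T fun i hi j hj => ?_
  have h1 := hF.le_lev i
  have h2 := hF.le_lev j
  have h3 := hlev i hi j hj
  have h4 := hlev j hj i hi
  obtain ⟨l, l1, l2, l3⟩ : ∃ l, l ≤ F.lev i ∧ l ≤ F.lev j ∧ (l = F.lev i ∨ l = F.lev j) :=
    ⟨_, min_le_left _ _, min_le_right _ _, min_choice _ _⟩
  refine wide_of_norm_le (l := l) (by omega) (by rcases l3 with rfl | rfl <;> linarith)
    (by rcases l3 with rfl | rfl <;> linarith) h3 h4 (((hT i hi).norm_ζ_sub_le (hT j hj) l1 l2).trans ?_)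
  have := scaleBase_pow_pos (398 * l)
  linarith

/-- A geometric series over level windows of ratio 1.045: the top window contains at most three
indices near z, contributing at most 3m, all others have level below m/1.045, and 3 + 100/1.045 <
100. -/
lemma Sparse.sum_lev_near_le (hF : F.Sparse m₀) (hm₀ : 800 ≤ m₀) {z : ℂ} (m : ℕ) {T : Finset ι}
    (hT : ∀ i ∈ T, F.Near z i) (hlev : ∀ i ∈ T, F.lev i ≤ m) : ∑ i ∈ T, F.lev i ≤ 100 * m := by
  classical
  induction m using Nat.strong_induction_on generalizing T with
  | _ m ih =>
    rw [← Finset.sum_filter_add_sum_filter_not T (fun i => m * 1000 ≤ 1045 * F.lev i)]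
    have h1 : ∑ i ∈ T.filter (fun i => m * 1000 ≤ 1045 * F.lev i), F.lev i ≤ 3 * m := by
      have hc : (T.filter (fun i => m * 1000 ≤ 1045 * F.lev i)).card ≤ 3 := by
        refine hF.card_near_le hm₀ (z := z) (fun i hi => hT i (Finset.mem_filter.1 hi).1)
          fun i hi j hj => ?_
        have a1 := hlev i (Finset.mem_filter.1 hi).1
        have a2 := (Finset.mem_filter.1 hj).2
        linarith
      refine (Finset.sum_le_card_nsmul _ _ m fun i hi => hlev i (Finset.mem_filter.1 hi).1).trans ?_
      rw [smul_eq_mul]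
      gcongr
    by_cases hm : m = 0
    · have h2 : ∑ i ∈ T.filter (fun i => ¬ m * 1000 ≤ 1045 * F.lev i), F.lev i ≤ 0 := by
        refine (Finset.sum_le_card_nsmul _ _ 0 fun i hi => ?_).trans (by simp)
        exact (hlev i (Finset.mem_filter.1 hi).1).trans hm.le
      omega
    · have h2 : ∑ i ∈ T.filter (fun i => ¬ m * 1000 ≤ 1045 * F.lev i), F.lev i
          ≤ 100 * (m * 1000 / 1045) := by
        refine ih (m * 1000 / 1045) (by omega) (fun i hi => hT i (Finset.mem_filter.1 hi).1)
          fun i hi => ?_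
        have := (Finset.mem_filter.1 hi).2
        omega
      omega

lemma Sparse.card_level_le (hF : F.Sparse m₀) (hm₀ : 800 ≤ m₀) {m : ℕ} {T : Finset ι}
    (hT : ∀ i ∈ T, F.lev i = m) {s : ℝ} (hs : 0 ≤ s) {z : ℂ} (hz : ∀ i ∈ T, ‖F.ζ i - z‖ ≤ s) :
    (T.card : ℝ) ≤ 48 * s / scaleBase ^ (398 * m) + 24 := by
  refine card_le_of_separated_on_circle (fun i _ => F.norm_ζ i) (scaleBase_pow_pos _) hs ?_ hz
  refine fun S hS h => hF.card_le S fun i hi j hj => ?_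
  have h1 := hF.le_lev i
  have ei := hT i (hS hi)
  have ej := hT j (hS hj)
  refine wide_of_norm_le (l := m) (by omega) (by omega) (by omega) (by omega) (by omega)
    ((h i hi j hj).trans ?_)
  have := scaleBase_pow_pos (398 * m)
  linarith

lemma sideWeight_le (i : ι) (z : ℂ) :
    sideWeight (F.lev i) (F.ζ i) z ≤ scaleBase ^ (399 * F.lev i) / ‖F.ζ i - z‖ := min_le_right _ _

/-- The contribution of the indices of one level which are not near `z`. -/
lemma Sparse.sum_far_level_le (hF : F.Sparse m₀) (hm₀ : 800 ≤ m₀) {m : ℕ} {T : Finset ι}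
    (hT : ∀ i ∈ T, F.lev i = m) {z : ℂ} (hz : ‖z‖ < 1) (hfar : ∀ i ∈ T, ¬ F.Near z i) :
    ∑ i ∈ T, sideWeight (F.lev i) (F.ζ i) z ≤ 240 * (m + 4) * scaleBase ^ m := by
  classical
  set t := scaleBase ^ (398 * m) with ht
  have ht0 : 0 < t := scaleBase_pow_pos _
  let x : ι → ℝ := fun i => ‖F.ζ i - z‖
  have hx : ∀ i ∈ T, t / 4 ≤ x i := fun i hi => by
    have := hfar i hi
    rw [Near, hT i hi, not_lt] at this
    exact this
  have hx2 : ∀ i, x i < 2 := fun i => by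
    have := norm_sub_le (F.ζ i) z
    rw [F.norm_ζ] at this
    change ‖F.ζ i - z‖ < 2
    linarith
  -- The dyadic shell of i around z: the distance x i lies between 2^l t/4 and 2^l t/2. Distances
  -- below 2 leave at most m + 4 shells.
  let l : ι → ℕ := fun i => Nat.log 2 ⌊4 * x i / t⌋₊
  have hl1 : ∀ i ∈ T, (2 : ℝ) ^ l i * (t / 4) ≤ x i := fun i hi => by
    have h1 : (1 : ℝ) ≤ 4 * x i / t := by rw [le_div_iff₀ ht0]; linarith [hx i hi]
    have h2 : ⌊4 * x i / t⌋₊ ≠ 0 := (Nat.floor_pos.2 h1).ne'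
    have h3 : ((2 ^ l i : ℕ) : ℝ) ≤ 4 * x i / t :=
      (Nat.cast_le.2 (Nat.pow_log_le_self 2 h2)).trans (Nat.floor_le (by linarith))
    rw [le_div_iff₀ ht0] at h3
    push_cast at h3
    linarith
  have hl2 : ∀ i, x i ≤ (2 : ℝ) ^ l i * (t / 2) := fun i => by
    have h2 : ⌊4 * x i / t⌋₊ < 2 ^ (l i + 1) := Nat.lt_pow_succ_log_self one_lt_two _
    have h3 := (Nat.floor_lt' (by positivity)).1 h2
    rw [div_lt_iff₀ ht0] at h3
    push_cast at h3
    rw [pow_succ] at h3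
    linarith
  have hmaps : ∀ i ∈ T, l i ∈ Finset.range (m + 4) := fun i hi => by
    rw [Finset.mem_range]
    have h1 := hl1 i hi
    have h2 := hx2 i
    have h3 : (1 / 2 : ℝ) ^ m ≤ t := by
      rw [← scaleBase_pow_400_mul]
      exact scaleBase_pow_le (by omega)
    have h4 : (2 : ℝ) ^ l i < 2 ^ (m + 3) := by
      have h5 : (2 : ℝ) ^ l i * ((1 / 2 : ℝ) ^ m) < 8 := by
        have : (2 : ℝ) ^ l i * (1 / 2 : ℝ) ^ m ≤ 2 ^ l i * t := by gcongr
        linarith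
      have h6 : (2 : ℝ) ^ m * (1 / 2 : ℝ) ^ m = 1 := by rw [← mul_pow]; norm_num
      have h7 : (0 : ℝ) < 2 ^ m := by positivity
      calc (2 : ℝ) ^ l i = (2 ^ l i * (1 / 2 : ℝ) ^ m) * 2 ^ m := by
            rw [mul_assoc, mul_comm ((1 / 2 : ℝ) ^ m), h6, mul_one]
        _ < 8 * 2 ^ m := by gcongr
        _ = _ := by ring
    have := (pow_lt_pow_iff_right₀ (one_lt_two : (1 : ℝ) < 2)).1 h4
    omega
  rw [← Finset.sum_fiberwise_of_maps_to hmaps]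
  -- The k-th shell holds O(2^k) indices, each of weight O(2^(-k)) times `scaleBase ^ m`, the last
  -- factor being the gap between the exponents 399 and 398.
  have hshell : ∀ k ∈ Finset.range (m + 4),
      ∑ i ∈ T.filter (fun i => l i = k), sideWeight (F.lev i) (F.ζ i) z ≤ 240 * scaleBase ^ m := by
    intro k _
    have hk0 : (1 : ℝ) ≤ 2 ^ k := one_le_pow₀ one_le_two
    have hcard := hF.card_level_le hm₀ (T := T.filter (fun i => l i = k)) (m := m)
      (fun i hi => hT i (Finset.mem_filter.1 hi).1) (s := 2 ^ k * (t / 2)) (by positivity) (z := z)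
      (fun i hi => by
        have := hl2 i
        rwa [(Finset.mem_filter.1 hi).2] at this)
    rw [← ht] at hcard
    have e : 48 * (2 ^ k * (t / 2)) / t = 24 * (2 : ℝ) ^ k := by field_simp; norm_num
    rw [e] at hcard
    have hterm : ∀ i ∈ T.filter (fun i => l i = k),
        sideWeight (F.lev i) (F.ζ i) z ≤ 4 * scaleBase ^ m / 2 ^ k := fun i hi => by
      obtain ⟨hi, hik⟩ := Finset.mem_filter.1 hi
      refine (sideWeight_le i z).trans ?_
      have h1 := hl1 i hi
      rw [hik] at h1
      rw [hT i hi, show 399 * m = m + 398 * m by ring, pow_add, ← ht]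
      have hxp : 0 < x i := lt_of_lt_of_le (by positivity) h1
      change scaleBase ^ m * t / x i ≤ _
      rw [div_le_div_iff₀ hxp (by positivity)]
      have := scaleBase_pow_pos m
      nlinarith
    refine (Finset.sum_le_card_nsmul _ _ _ hterm).trans ?_
    rw [nsmul_eq_mul]
    calc _ ≤ (24 * (2 : ℝ) ^ k + 24) * (4 * scaleBase ^ m / 2 ^ k) := by
          have := scaleBase_pow_pos m
          gcongr
      _ ≤ (60 * (2 : ℝ) ^ k) * (4 * scaleBase ^ m / 2 ^ k) := by
          have := scaleBase_pow_pos m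
          gcongr
          linarith
      _ = _ := by field_simp; ring
  refine (Finset.sum_le_card_nsmul _ _ _ hshell).trans (le_of_eq ?_)
  rw [Finset.card_range, nsmul_eq_mul]
  push_cast
  ring

end DiscFamily

namespace DiscFamily

variable {ι : Type*} {F : DiscFamily ι} {m₀ : ℕ}

/-- The contribution of level `m` to sums over indices which are not near a point. -/
def farTerm (m : ℕ) : ℝ := m * (240 * (m + 4) * scaleBase ^ m)

lemma farTerm_nonneg (m : ℕ) : 0 ≤ farTerm m := by
  have := scaleBase_pow_pos m
  unfold farTerm
  positivity

lemma summable_pow_mul_scaleBase (k : ℕ) : Summable fun m : ℕ => (m : ℝ) ^ k * scaleBase ^ m :=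
  summable_pow_mul_geometric_of_norm_lt_one k
    (by rw [Real.norm_of_nonneg scaleBase_pos.le]; exact scaleBase_lt_one)

lemma summable_farTerm : Summable farTerm := by
  refine (((summable_pow_mul_scaleBase 2).mul_left 240).add
    ((summable_pow_mul_scaleBase 1).mul_left 960)).congr fun m => ?_
  rw [farTerm]
  ring

/-- The total contribution of the levels at least `m₀`. -/
def farTail (m₀ : ℕ) : ℝ := ∑' m, farTerm (m + m₀)

lemma tendsto_farTail : Filter.Tendsto farTail Filter.atTop (nhds 0) :=
  tendsto_sum_nat_add farTerm

lemma farTail_le (m₀ : ℕ) : farTail m₀ ≤ farTail 0 := by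
  have h := summable_farTerm.sum_add_tsum_nat_add m₀
  have h0 : 0 ≤ ∑ i ∈ Finset.range m₀, farTerm i := Finset.sum_nonneg fun i _ => farTerm_nonneg i
  rw [farTail, farTail]
  simp only [add_zero]
  linarith

lemma farTail_nonneg (m₀ : ℕ) : 0 ≤ farTail m₀ := tsum_nonneg fun _ => farTerm_nonneg _

lemma Sparse.sum_far_le (hF : F.Sparse m₀) (hm₀ : 800 ≤ m₀) {T : Finset ι} {z : ℂ} (hz : ‖z‖ < 1)
    (hfar : ∀ i ∈ T, ¬ F.Near z i) :
    ∑ i ∈ T, F.lev i * sideWeight (F.lev i) (F.ζ i) z ≤ farTail m₀ := by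
  refine sum_le_tsum_of_fiber (lev := fun i => F.lev i - m₀) (b := fun m => farTerm (m + m₀))
    ((summable_nat_add_iff m₀).2 summable_farTerm) (fun _ => farTerm_nonneg _) fun m => ?_
  have hlev : ∀ i ∈ T.filter (fun i => F.lev i - m₀ = m), F.lev i = m + m₀ := fun i hi => by
    have h1 := (Finset.mem_filter.1 hi).2
    have h2 := hF.le_lev i
    omega
  have h := hF.sum_far_level_le hm₀ hlev hz fun i hi => hfar i (Finset.mem_filter.1 hi).1
  rw [farTerm]
  calc _ = ((m + m₀ : ℕ) : ℝ) * ∑ i ∈ T.filter (fun i => F.lev i - m₀ = m),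
        sideWeight (F.lev i) (F.ζ i) z := by
        rw [Finset.mul_sum]
        exact Finset.sum_congr rfl fun i hi => by rw [hlev i hi]
    _ ≤ _ := by gcongr

/-- Near indices contribute at most their levels, which sum geometrically, and far ones a bounded
tail. The resulting linear bound in m is what limits the growth of the partial sums. -/
lemma Sparse.sum_lev_mul_sideWeight_le (hF : F.Sparse m₀) (hm₀ : 800 ≤ m₀) {T : Finset ι} {z : ℂ}
    (hz : ‖z‖ < 1) (m : ℕ) (hT : ∀ i ∈ T, F.lev i ≤ m) :
    ∑ i ∈ T, F.lev i * sideWeight (F.lev i) (F.ζ i) z ≤ 100 * m + farTail 0 := by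
  classical
  rw [← Finset.sum_filter_add_sum_filter_not T (fun i => F.Near z i)]
  have h1 := hF.sum_far_le hm₀ (T := T.filter fun i => ¬ F.Near z i) hz
    fun i hi => (Finset.mem_filter.1 hi).2
  have h2 : ∑ i ∈ T.filter (fun i => F.Near z i), (F.lev i : ℝ) * sideWeight (F.lev i) (F.ζ i) z
      ≤ ∑ i ∈ T.filter (fun i => F.Near z i), (F.lev i : ℝ) := by
    refine Finset.sum_le_sum fun i _ => ?_
    exact mul_le_of_le_one_right (Nat.cast_nonneg _) (sideWeight_le_one _ _ _)
  have h3 := hF.sum_lev_near_le hm₀ (z := z) m (T := T.filter fun i => F.Near z i)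
    (fun i hi => (Finset.mem_filter.1 hi).2) fun i hi => hT i (Finset.mem_filter.1 hi).1
  have h4 : ∑ i ∈ T.filter (fun i => F.Near z i), (F.lev i : ℝ) ≤ 100 * m := by exact_mod_cast h3
  linarith [farTail_le m₀]

/-- A bound for the sum of the weights of a sparse family. -/
def weightBound : ℝ := farTail 0 + ∑' m : ℕ, 3 * scaleBase ^ (10 * m) + 200

lemma summable_scaleBase_ten : Summable fun m : ℕ => 3 * scaleBase ^ (10 * m) := by
  refine Summable.mul_left 3 ?_
  simp_rw [pow_mul]
  exact summable_geometric_of_lt_one (scaleBase_pow_pos _).le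
    (pow_lt_one₀ scaleBase_pos.le scaleBase_lt_one (by norm_num))

/-- Far indices are summable by their horizontal weight. Near indices too shallow for the depth of z
have geometrically small vertical weight, with at most three per level. For each remaining index 1 -
|z| lies between the powers 450 and 398 of its scale, so all their levels agree up to a factor 2,
and the bound on the sum of levels of near indices limits their number. -/
lemma Sparse.sum_sideWeight_mul_depthWeight_le (hF : F.Sparse m₀) (hm₀ : 800 ≤ m₀) (T : Finset ι)
    {z : ℂ} (hz : ‖z‖ < 1) :
    ∑ i ∈ T, sideWeight (F.lev i) (F.ζ i) z * depthWeight (F.lev i) z ≤ weightBound := by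
  classical
  rw [← Finset.sum_filter_add_sum_filter_not T (fun i => F.Near z i)]
  have h1 : ∑ i ∈ T.filter (fun i => ¬ F.Near z i),
      sideWeight (F.lev i) (F.ζ i) z * depthWeight (F.lev i) z ≤ farTail 0 := by
    refine le_trans (Finset.sum_le_sum fun i _ => ?_) ((hF.sum_far_le hm₀
      (T := T.filter fun i => ¬ F.Near z i) hz
      fun i hi => (Finset.mem_filter.1 hi).2).trans (farTail_le m₀))
    have a1 : (1 : ℝ) ≤ F.lev i := by exact_mod_cast (by have := hF.le_lev i; omega : 1 ≤ F.lev i)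
    have a2 := sideWeight_nonneg (F.lev i) (F.ζ i) z
    have a3 := depthWeight_le_one (F.lev i) z
    nlinarith
  rw [← Finset.sum_filter_add_sum_filter_not (T.filter fun i => F.Near z i)
    (fun i => 1 - ‖z‖ ≤ scaleBase ^ (450 * F.lev i))]
  set A := (T.filter fun i => F.Near z i).filter
    (fun i => 1 - ‖z‖ ≤ scaleBase ^ (450 * F.lev i)) with hA
  set B := (T.filter fun i => F.Near z i).filter
    (fun i => ¬ 1 - ‖z‖ ≤ scaleBase ^ (450 * F.lev i)) with hB
  have h2 : ∑ i ∈ A, sideWeight (F.lev i) (F.ζ i) z * depthWeight (F.lev i) z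
      ≤ ∑' m : ℕ, 3 * scaleBase ^ (10 * m) := by
    refine sum_le_tsum_of_fiber (lev := F.lev) summable_scaleBase_ten
      (fun m => by have := scaleBase_pow_pos (10 * m); positivity) fun m => ?_
    have hc : (A.filter fun i => F.lev i = m).card ≤ 3 := by
      refine hF.card_near_le hm₀ (z := z) (fun i hi => ?_) fun i hi j hj => ?_
      · simp only [hA, Finset.mem_filter] at hi
        exact hi.1.1.2
      · have a1 := (Finset.mem_filter.1 hi).2
        have a2 := (Finset.mem_filter.1 hj).2
        linarith
    have hterm : ∀ i ∈ A.filter fun i => F.lev i = m,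
        sideWeight (F.lev i) (F.ζ i) z * depthWeight (F.lev i) z ≤ scaleBase ^ (10 * m) := by
      intro i hi
      simp only [hA, Finset.mem_filter] at hi
      have a1 : depthWeight (F.lev i) z ≤ scaleBase ^ (10 * m) := by
        refine (min_le_right _ _).trans ?_
        rw [div_le_iff₀ (scaleBase_pow_pos _), ← pow_add, ← hi.2]
        refine hi.1.2.trans (le_of_eq ?_)
        congr 1
        ring
      have a2 := sideWeight_nonneg (F.lev i) (F.ζ i) z
      have a3 := sideWeight_le_one (F.lev i) (F.ζ i) z
      have a4 := depthWeight_nonneg (F.lev i) hz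
      nlinarith
    refine (Finset.sum_le_card_nsmul _ _ _ hterm).trans ?_
    rw [nsmul_eq_mul]
    have := scaleBase_pow_pos (10 * m)
    gcongr
    exact_mod_cast hc
  have h3 : ∑ i ∈ B, sideWeight (F.lev i) (F.ζ i) z * depthWeight (F.lev i) z ≤ 200 := by
    have hb : ∀ i ∈ B, F.Near z i ∧ scaleBase ^ (450 * F.lev i) < 1 - ‖z‖ := fun i hi => by
      simp only [hB, Finset.mem_filter, not_le] at hi
      exact ⟨hi.1.2, hi.2⟩
    have hcard : B.card ≤ 200 := by
      rcases B.eq_empty_or_nonempty with h | h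
      · simp [h]
      · obtain ⟨j, hj, hjmax⟩ := Finset.exists_max_image B F.lev h
        have hs := hF.sum_lev_near_le hm₀ (z := z) (F.lev j) (fun i hi => (hb i hi).1) hjmax
        have hlow : ∀ i ∈ B, F.lev j ≤ 2 * F.lev i := fun i hi => by
          have a1 := (hb i hi).2
          have a2 := (hb j hj).1
          unfold Near at a2
          have a3 := one_sub_norm_le (F := F) j z
          have a4 : scaleBase ^ (450 * F.lev i) < scaleBase ^ (398 * F.lev j) := by
            have := scaleBase_pow_pos (398 * F.lev j)
            linarith
          have := lt_of_scaleBase_pow_lt a4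
          omega
        have h5 : B.card * F.lev j ≤ 200 * F.lev j := by
          calc B.card * F.lev j = ∑ i ∈ B, F.lev j := by rw [Finset.sum_const, smul_eq_mul]
            _ ≤ ∑ i ∈ B, 2 * F.lev i := Finset.sum_le_sum hlow
            _ = 2 * ∑ i ∈ B, F.lev i := by rw [Finset.mul_sum]
            _ ≤ _ := by linarith
        exact Nat.le_of_mul_le_mul_right h5 (by have := hF.le_lev j; omega)
    refine (Finset.sum_le_card_nsmul _ _ 1 fun i _ => ?_).trans ?_
    · exact mul_le_one₀ (sideWeight_le_one _ _ _) (depthWeight_nonneg _ hz) (depthWeight_le_one _ _)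
    · rw [nsmul_eq_mul, mul_one]
      exact_mod_cast hcard
  rw [weightBound]
  linarith

/-- A bound for the sum of `lev i * scaleBase ^ (399 * lev i)`. -/
def massBound : ℝ := ∑' m : ℕ, m * (72 * scaleBase ^ m)

/-- Packing on the whole circle allows at most 72 / `scaleBase ^ (398 * m)` indices of level m. This
bound yields locally uniform convergence of the partial sums. -/
lemma Sparse.sum_lev_mul_le (hF : F.Sparse m₀) (hm₀ : 800 ≤ m₀) (T : Finset ι) :
    ∑ i ∈ T, F.lev i * scaleBase ^ (399 * F.lev i) ≤ massBound := by
  classical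
  refine sum_le_tsum_of_fiber (lev := F.lev) (((summable_pow_mul_scaleBase 1).mul_left 72).congr
    fun m => by ring) (fun m => by have := scaleBase_pow_pos m; positivity) fun m => ?_
  have hc := hF.card_level_le hm₀ (T := T.filter fun i => F.lev i = m) (m := m)
    (fun i hi => (Finset.mem_filter.1 hi).2) zero_le_one (z := 0)
    (fun i _ => by rw [sub_zero, F.norm_ζ])
  have ht := scaleBase_pow_pos (398 * m)
  have ht1 := scaleBase_pow_le_one (398 * m)
  have hc' : ((T.filter fun i => F.lev i = m).card : ℝ) ≤ 72 / scaleBase ^ (398 * m) := by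
    refine hc.trans ?_
    rw [le_div_iff₀ ht, add_mul, div_mul_cancel₀ _ ht.ne']
    linarith
  calc ∑ i ∈ T.filter (fun i => F.lev i = m), (F.lev i : ℝ) * scaleBase ^ (399 * F.lev i)
      = (T.filter fun i => F.lev i = m).card * (m * scaleBase ^ (399 * m)) := by
        rw [← nsmul_eq_mul, ← Finset.sum_const]
        exact Finset.sum_congr rfl fun i hi => by rw [(Finset.mem_filter.1 hi).2]
    _ ≤ 72 / scaleBase ^ (398 * m) * (m * scaleBase ^ (399 * m)) := by
        have := scaleBase_pow_pos (399 * m)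
        gcongr
    _ = _ := by
        rw [show 399 * m = m + 398 * m by ring, pow_add]
        field_simp

/-! ### Clusters -/

variable (F) in
/-- Direct neighbours. -/
def Adj (i j : ι) : Prop :=
  F.lev i * 100 ≤ 101 * F.lev j ∧ F.lev j * 100 ≤ 101 * F.lev i ∧
    ‖F.ζ i - F.ζ j‖ ≤ max (scaleBase ^ (398 * F.lev i)) (scaleBase ^ (398 * F.lev j))

lemma Adj.refl (i : ι) : F.Adj i i := by
  refine ⟨by omega, by omega, ?_⟩
  rw [sub_self, norm_zero]
  exact le_max_of_le_left (scaleBase_pow_pos _).le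

lemma Adj.symm {i j : ι} (h : F.Adj i j) : F.Adj j i :=
  ⟨h.2.1, h.1, by rw [norm_sub_rev, max_comm]; exact h.2.2⟩

lemma Adj.norm_le {i j : ι} (h : F.Adj i j) {l : ℕ} (hi : l ≤ F.lev i) (hj : l ≤ F.lev j) :
    ‖F.ζ i - F.ζ j‖ ≤ scaleBase ^ (398 * l) :=
  h.2.2.trans (max_le (scaleBase_pow_le (by omega)) (scaleBase_pow_le (by omega)))

lemma norm_ζ_sub_triangle (i j k : ι) :
    ‖F.ζ i - F.ζ k‖ ≤ ‖F.ζ i - F.ζ j‖ + ‖F.ζ j - F.ζ k‖ := norm_sub_le_norm_sub_add_norm_sub _ _ _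

variable (F) in
/-- Two indices are in the same cluster if they have a common direct neighbour. -/
def SameCluster (i j : ι) : Prop := ∃ k, F.Adj i k ∧ F.Adj k j

lemma card_four {a b c d : ι} [DecidableEq ι] (hab : a ≠ b) (hac : a ≠ c) (had : a ≠ d)
    (hbc : b ≠ c) (hbd : b ≠ d) (hcd : c ≠ d) : ({a, b, c, d} : Finset ι).card = 4 := by
  rw [Finset.card_insert_of_notMem (by simp [hab, hac, had]),
    Finset.card_insert_of_notMem (by simp [hbc, hbd]), Finset.card_pair hcd]

/-- Four distinct indices with comparable levels and nearby directions cannot exist. -/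
lemma Sparse.false_of_four (hF : F.Sparse m₀) {v₀ v₁ v₂ v₃ : ι} (h01 : v₀ ≠ v₁) (h02 : v₀ ≠ v₂)
    (h03 : v₀ ≠ v₃) (h12 : v₁ ≠ v₂) (h13 : v₁ ≠ v₃) (h23 : v₂ ≠ v₃) {l : ℕ} (hl : 800 ≤ l)
    (hlev : ∀ x ∈ [v₀, v₁, v₂, v₃], l ≤ F.lev x ∧ F.lev x * 1000 ≤ 1045 * l)
    (n01 : ‖F.ζ v₀ - F.ζ v₁‖ ≤ 4 * scaleBase ^ (398 * l))
    (n02 : ‖F.ζ v₀ - F.ζ v₂‖ ≤ 4 * scaleBase ^ (398 * l))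
    (n03 : ‖F.ζ v₀ - F.ζ v₃‖ ≤ 4 * scaleBase ^ (398 * l))
    (n12 : ‖F.ζ v₁ - F.ζ v₂‖ ≤ 4 * scaleBase ^ (398 * l))
    (n13 : ‖F.ζ v₁ - F.ζ v₃‖ ≤ 4 * scaleBase ^ (398 * l))
    (n23 : ‖F.ζ v₂ - F.ζ v₃‖ ≤ 4 * scaleBase ^ (398 * l)) : False := by
  classical
  have hself : ∀ i, F.ζ i - F.ζ i = 0 := fun i => sub_self _
  have hp := scaleBase_pow_pos (398 * l)
  have n10 := n01
  have n20 := n02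
  have n30 := n03
  have n21 := n12
  have n31 := n13
  have n32 := n23
  rw [norm_sub_rev] at n10 n20 n30 n21 n31 n32
  have hnorm : ∀ i ∈ [v₀, v₁, v₂, v₃], ∀ j ∈ [v₀, v₁, v₂, v₃],
      ‖F.ζ i - F.ζ j‖ ≤ 4 * scaleBase ^ (398 * l) := by
    intro i hi j hj
    simp only [List.mem_cons, List.not_mem_nil, or_false] at hi hj
    rcases hi with rfl | rfl | rfl | rfl <;> rcases hj with rfl | rfl | rfl | rfl <;>
      first
      | assumption
      | (rw [hself, norm_zero]; positivity)
  have h := hF.card_le {v₀, v₁, v₂, v₃} fun i hi j hj => by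
    have hi' : i ∈ [v₀, v₁, v₂, v₃] := by simpa using hi
    have hj' : j ∈ [v₀, v₁, v₂, v₃] := by simpa using hj
    obtain ⟨a1, a3⟩ := hlev i hi'
    obtain ⟨a2, a4⟩ := hlev j hj'
    exact wide_of_norm_le hl a3 a4 (by linarith) (by linarith) (hnorm i hi' j hj')
  rw [card_four h01 h02 h03 h12 h13 h23] at h
  omega

lemma exists_min_four (a b c d : ℕ) : ∃ l, l ≤ a ∧ l ≤ b ∧ l ≤ c ∧ l ≤ d ∧
    (l = a ∨ l = b ∨ l = c ∨ l = d) := by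
  rcases le_total a b with h | h <;> rcases le_total c d with h' | h' <;>
    [rcases le_total a c with h'' | h''; rcases le_total a d with h'' | h'';
      rcases le_total b c with h'' | h''; rcases le_total b d with h'' | h'']
  · exact ⟨a, by omega⟩
  · exact ⟨c, by omega⟩
  · exact ⟨a, by omega⟩
  · exact ⟨d, by omega⟩
  · exact ⟨b, by omega⟩
  · exact ⟨c, by omega⟩
  · exact ⟨b, by omega⟩
  · exact ⟨d, by omega⟩

/-- A path through four distinct indices would make them mutual wide neighbours, since three steps
of 1 percent stay below 4.5 percent and three direction steps below the factor 4. So every path of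
length three shortens to length two, which gives transitivity of the cluster relation. -/
lemma Sparse.sameCluster_of_path (hF : F.Sparse m₀) (hm₀ : 800 ≤ m₀) {v₀ v₁ v₂ v₃ : ι}
    (h01 : F.Adj v₀ v₁) (h12 : F.Adj v₁ v₂) (h23 : F.Adj v₂ v₃) : F.SameCluster v₀ v₃ := by
  by_cases e01 : v₀ = v₁
  · exact ⟨v₂, e01 ▸ h12, h23⟩
  by_cases e02 : v₀ = v₂
  · exact ⟨v₃, e02 ▸ h23, Adj.refl _⟩
  by_cases e03 : v₀ = v₃
  · exact ⟨v₀, Adj.refl _, e03 ▸ Adj.refl _⟩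
  by_cases e12 : v₁ = v₂
  · exact ⟨v₂, e12 ▸ h01, h23⟩
  by_cases e13 : v₁ = v₃
  · exact ⟨v₁, h01, e13 ▸ Adj.refl _⟩
  by_cases e23 : v₂ = v₃
  · exact ⟨v₁, h01, e23 ▸ h12⟩
  exfalso
  obtain ⟨l, l0, l1, l2, l3, hl⟩ := exists_min_four (F.lev v₀) (F.lev v₁) (F.lev v₂) (F.lev v₃)
  have r0 := hF.le_lev v₀
  have r1 := hF.le_lev v₁
  have r2 := hF.le_lev v₂
  have r3 := hF.le_lev v₃
  have a1 := h01.1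
  have a2 := h01.2.1
  have a3 := h12.1
  have a4 := h12.2.1
  have a5 := h23.1
  have a6 := h23.2.1
  have n01 := h01.norm_le l0 l1
  have n12 := h12.norm_le l1 l2
  have n23 := h23.norm_le l2 l3
  have n02 := norm_ζ_sub_triangle (F := F) v₀ v₁ v₂
  have n13 := norm_ζ_sub_triangle (F := F) v₁ v₂ v₃
  have n03 := norm_ζ_sub_triangle (F := F) v₀ v₁ v₃
  have hp := scaleBase_pow_pos (398 * l)
  refine hF.false_of_four e01 e02 e03 e12 e13 e23 (l := l) (by omega) ?_ (by linarith)
    (by linarith) (by linarith) (by linarith) (by linarith) (by linarith)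
  intro x hx
  simp only [List.mem_cons, List.not_mem_nil, or_false] at hx
  rcases hx with rfl | rfl | rfl | rfl <;> rcases hl with rfl | rfl | rfl | rfl <;>
    constructor <;> linarith

lemma Adj.sameCluster {i j : ι} (h : F.Adj i j) : F.SameCluster i j := ⟨j, h, Adj.refl _⟩

/-- The cluster relation of a sparse family is an equivalence relation. -/
def Sparse.clusterSetoid (hF : F.Sparse m₀) (hm₀ : 800 ≤ m₀) : Setoid ι where
  r := F.SameCluster
  iseqv :=
    { refl := fun _ => (Adj.refl _).sameCluster
      symm := fun ⟨k, h1, h2⟩ => ⟨k, h2.symm, h1.symm⟩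
      trans := fun ⟨_, h1, h2⟩ ⟨_, h3, h4⟩ => by
        obtain ⟨_, h5, h6⟩ := hF.sameCluster_of_path hm₀ h1 h2 h3
        exact hF.sameCluster_of_path hm₀ h5 h6 h4 }

end DiscFamily

namespace DiscFamily

variable {ι : Type*} {F : DiscFamily ι} {m₀ : ℕ}

lemma SameCluster.lev_le {i j : ι} (h : F.SameCluster i j) :
    F.lev i * 10000 ≤ 10201 * F.lev j := by
  obtain ⟨k, h1, h2⟩ := h
  have := h1.1
  have := h2.1
  omega

lemma SameCluster.symm {i j : ι} (h : F.SameCluster i j) : F.SameCluster j i := by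
  obtain ⟨k, h1, h2⟩ := h
  exact ⟨k, h2.symm, h1.symm⟩

lemma three_eighths_mul_le {i : ι} {z : ℂ} (h : ‖z - F.pt i‖ < (1 - F.r i) / 4) :
    3 / 8 * scaleBase ^ (400 * F.lev i) < 1 - ‖z‖ := by
  have h1 := norm_sub_norm_le z (F.pt i)
  rw [norm_pt] at h1
  have := F.le_one_sub i
  linarith

/-- A partition of the index set of a sparse family into small clusters, well separated from one
another at the scale of the larger of two. -/
structure Clusters (F : DiscFamily ι) (K : Type*) where
  cl : K → Finset ι
  lev : K → ℕ
  index : ι → K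
  mem_cl : ∀ i q, i ∈ cl q ↔ index i = q
  nonempty : ∀ q, (cl q).Nonempty
  card_le : ∀ q, (cl q).card ≤ 3
  lev_le : ∀ q, ∀ i ∈ cl q, lev q ≤ F.lev i
  le_lev : ∀ q, ∀ i ∈ cl q, F.lev i * 10000 ≤ 10201 * lev q
  exists_eq_lev : ∀ q, ∃ i ∈ cl q, F.lev i = lev q
  norm_le : ∀ q, ∀ i ∈ cl q, ∀ j ∈ cl q, ‖F.ζ i - F.ζ j‖ ≤ 2 * scaleBase ^ (398 * lev q)
  not_near : ∀ q q' i i' z, q ≠ q' → lev q ≤ lev q' → i ∈ cl q → i' ∈ cl q' →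
    ‖z - F.pt i‖ < (1 - F.r i) / 4 → ¬ F.Near z i'

/-- If z were near i', then i and i' would have close directions and the level of i' could barely
exceed that of i. Either the levels are within 1 percent and i, i' are adjacent, or i lies more than
1 percent above i', hence above the lowest member n of its cluster. In the second case n reaches i
only through a further index k, and n, k, i, i' are four mutual wide neighbours. -/
lemma Sparse.not_near_of_not_sameCluster (hF : F.Sparse m₀) (hm₀ : 800 ≤ m₀) {i n i' : ι} {z : ℂ}
    (hin : F.SameCluster n i) (hi' : ∀ k, F.SameCluster i k → F.lev n ≤ F.lev k)
    (hni' : F.lev n ≤ F.lev i') (hne : ¬ F.SameCluster i i')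
    (hz : ‖z - F.pt i‖ < (1 - F.r i) / 4) : ¬ F.Near z i' := by
  intro hnear
  unfold Near at hnear
  have l1 := hF.le_lev i
  have l2 := hF.le_lev n
  have l3 := hF.le_lev i'
  have h1 := three_eighths_mul_le hz
  have h2 := one_sub_norm_le (F := F) i' z
  have h3 := scaleBase_pow_pos (398 * F.lev i')
  have h4 := scaleBase_pow_pos (398 * F.lev i)
  have h5 : 398 * F.lev i' < 400 * F.lev i :=
    lt_of_scaleBase_pow_lt (i := 400 * F.lev i) (j := 398 * F.lev i') (by linarith)
  have h6 : 4 * scaleBase ^ (400 * F.lev i) ≤ scaleBase ^ (398 * F.lev i) :=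
    four_mul_scaleBase_pow_le (by omega)
  have h7 : ‖F.ζ i - F.ζ i'‖ ≤ 5 / 4 * scaleBase ^ (400 * F.lev i)
      + scaleBase ^ (398 * F.lev i') / 4 := by
    have a1 := norm_ζ_sub_pt (F := F) i
    have a2 := F.one_sub_le i
    have a3 : F.ζ i - F.ζ i' = (F.ζ i - F.pt i) - (z - F.pt i) - (F.ζ i' - z) := by ring
    rw [a3]
    have a4 := norm_sub_le ((F.ζ i - F.pt i) - (z - F.pt i)) (F.ζ i' - z)
    have a5 := norm_sub_le (F.ζ i - F.pt i) (z - F.pt i)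
    linarith
  have h8 : ‖F.ζ i - F.ζ i'‖
      ≤ max (scaleBase ^ (398 * F.lev i)) (scaleBase ^ (398 * F.lev i')) := by
    have := le_max_left (scaleBase ^ (398 * F.lev i)) (scaleBase ^ (398 * F.lev i'))
    have := le_max_right (scaleBase ^ (398 * F.lev i)) (scaleBase ^ (398 * F.lev i'))
    linarith
  by_cases hlev : F.lev i * 100 ≤ 101 * F.lev i'
  · exact hne (Adj.sameCluster ⟨hlev, by omega, h8⟩)
  obtain ⟨k, hnk, hki⟩ := hin
  have hik : F.SameCluster i k := hki.symm.sameCluster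
  have hin' : F.SameCluster i n := ⟨k, hki.symm, hnk.symm⟩
  have hk := hi' k hik
  have hi := hi' i (Adj.refl i).sameCluster
  have hnot : ¬ F.Adj n i := fun h => by
    have := h.2.1
    omega
  have hlk := hnk.2.1
  have hli := hki.2.1
  have n01 := hnk.norm_le le_rfl hk
  have n12 := hki.norm_le hk hi
  have n23 : ‖F.ζ i - F.ζ i'‖ ≤ scaleBase ^ (398 * F.lev n) :=
    h8.trans (max_le (scaleBase_pow_le (by omega)) (scaleBase_pow_le (by omega)))
  have n02 := norm_ζ_sub_triangle (F := F) n k i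
  have n13 := norm_ζ_sub_triangle (F := F) k i i'
  have n03 := norm_ζ_sub_triangle (F := F) n k i'
  have hp := scaleBase_pow_pos (398 * F.lev n)
  refine hF.false_of_four (v₀ := n) (v₁ := k) (v₂ := i) (v₃ := i') (fun h => hnot (h ▸ hki))
    (fun h => by rw [h] at hni'; omega) (fun h => hne (h ▸ hin')) (fun h => hnot (h ▸ hnk))
    (fun h => hne (h ▸ hik)) (fun h => hne (h ▸ (Adj.refl i).sameCluster)) (l := F.lev n)
    (by omega) ?_ (by linarith) (by linarith) (by linarith) (by linarith) (by linarith)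
    (by linarith)
  intro x hx
  simp only [List.mem_cons, List.not_mem_nil, or_false] at hx
  rcases hx with rfl | rfl | rfl | rfl <;> constructor <;> linarith

lemma finite_sameCluster (i : ι) : {j | F.SameCluster i j}.Finite := by
  refine ((Set.finite_Iic (2 * F.lev i)).biUnion fun m _ => F.finite_lev m).subset fun j hj => ?_
  have := (SameCluster.symm hj).lev_le
  simp only [Set.mem_iUnion, Set.mem_Iic, Set.mem_ofPred_eq, exists_prop]
  exact ⟨_, by omega, rfl⟩

/-- The clusters of a sparse family. -/
theorem Sparse.exists_clusters (hF : F.Sparse m₀) (hm₀ : 800 ≤ m₀) :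
    Nonempty (F.Clusters (Quotient (hF.clusterSetoid hm₀))) := by
  classical
  let S := hF.clusterSetoid hm₀
  have hrel : ∀ i j, (Quotient.mk S i = Quotient.mk S j) ↔ F.SameCluster i j := fun i j =>
    ⟨fun h => Quotient.exact h, fun h => Quotient.sound h⟩
  have hfin : ∀ q : Quotient S, {i | Quotient.mk S i = q}.Finite := by
    intro q
    induction q using Quotient.inductionOn with
    | h i => exact (finite_sameCluster i).subset fun j hj => ((hrel j i).1 hj).symm
  have hmem : ∀ i q, i ∈ (hfin q).toFinset ↔ Quotient.mk S i = q := fun i q => by simp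
  have hne : ∀ q, (hfin q).toFinset.Nonempty := by
    intro q
    induction q using Quotient.inductionOn with
    | h i => exact ⟨i, (hmem _ _).2 rfl⟩
  choose n hn hmin using fun q => Finset.exists_min_image (hfin q).toFinset F.lev (hne q)
  have hrel' : ∀ {q i j}, i ∈ (hfin q).toFinset → j ∈ (hfin q).toFinset → F.SameCluster i j :=
    fun hi hj => (hrel _ _).1 (((hmem _ _).1 hi).trans ((hmem _ _).1 hj).symm)
  have hof : ∀ {q i j}, i ∈ (hfin q).toFinset → F.SameCluster i j → j ∈ (hfin q).toFinset :=
    fun hi hj => (hmem _ _).2 (((hrel _ _).2 hj.symm).trans ((hmem _ _).1 hi))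
  have hnorm : ∀ q, ∀ i ∈ (hfin q).toFinset, ∀ j ∈ (hfin q).toFinset,
      ‖F.ζ i - F.ζ j‖ ≤ 2 * scaleBase ^ (398 * F.lev (n q)) := by
    intro q i hi j hj
    obtain ⟨k, h1, h2⟩ := hrel' hi hj
    have hk := hof hi h1.sameCluster
    have a1 := h1.norm_le (hmin q i hi) (hmin q k hk)
    have a2 := h2.norm_le (hmin q k hk) (hmin q j hj)
    have a3 := norm_ζ_sub_triangle (F := F) i k j
    linarith
  refine ⟨⟨fun q => (hfin q).toFinset, fun q => F.lev (n q), Quotient.mk S, hmem, hne, ?_,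
    hmin, fun q i hi => (hrel' hi (hn q)).lev_le, fun q => ⟨n q, hn q, rfl⟩, hnorm, ?_⟩⟩
  · intro q
    refine hF.card_le _ fun i hi j hj => ?_
    have a1 := (hrel' hi (hn q)).lev_le
    have a2 := (hrel' hj (hn q)).lev_le
    have a3 := (hrel' hi hj).lev_le
    have a4 := (hrel' hj hi).lev_le
    have a5 := hF.le_lev (n q)
    have a6 := scaleBase_pow_pos (398 * F.lev (n q))
    refine wide_of_norm_le (l := F.lev (n q)) (by omega) (by linarith) (by linarith) (by linarith)
      (by linarith) ?_
    have := hnorm q i hi j hj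
    linarith
  · intro q q' i i' z hqq' hlev hi hi' hz
    refine hF.not_near_of_not_sameCluster hm₀ (hrel' (hn q) hi)
      (fun k hk => hmin q k (hof hi hk)) (hlev.trans (hmin q' i' hi')) (fun h => hqq' ?_) hz
    exact ((hmem _ _).1 (hof hi h)).symm.trans ((hmem _ _).1 hi') |>.trans rfl

end DiscFamily

/-! ### Products of bounded functions -/

lemma norm_prod_le_one {κ : Type*} {s : Finset κ} {x : κ → ℂ} (h : ∀ i ∈ s, ‖x i‖ ≤ 1) :
    ‖∏ i ∈ s, x i‖ ≤ 1 := by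
  rw [norm_prod]
  exact Finset.prod_le_one (fun _ _ => norm_nonneg _) h

lemma norm_one_sub_prod_le {κ : Type*} {s : Finset κ} {x : κ → ℂ} (h : ∀ i ∈ s, ‖x i‖ ≤ 1) :
    ‖1 - ∏ i ∈ s, x i‖ ≤ ∑ i ∈ s, ‖1 - x i‖ := by
  classical
  induction s using Finset.induction_on with
  | empty => simp
  | insert i s hi ih =>
    rw [Finset.prod_insert hi, Finset.sum_insert hi]
    have h1 := ih fun j hj => h j (Finset.mem_insert_of_mem hj)
    have h2 := h i (Finset.mem_insert_self i s)
    have e : 1 - x i * ∏ j ∈ s, x j = (1 - x i) + x i * (1 - ∏ j ∈ s, x j) := by ring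
    rw [e]
    refine (norm_add_le _ _).trans ?_
    rw [norm_mul]
    have := norm_nonneg (1 - ∏ j ∈ s, x j)
    nlinarith

lemma norm_deriv_prod_le {κ : Type*} {s : Finset κ} {E : κ → ℂ → ℂ} {z : ℂ}
    (hd : ∀ i ∈ s, DifferentiableAt ℂ (E i) z) (h : ∀ i ∈ s, ‖E i z‖ ≤ 1) :
    ‖deriv (fun w => ∏ i ∈ s, E i w) z‖ ≤ ∑ i ∈ s, ‖deriv (E i) z‖ := by
  classical
  induction s using Finset.induction_on with
  | empty => simp
  | insert i s hi ih =>
    have hd' : ∀ j ∈ s, DifferentiableAt ℂ (E j) z := fun j hj =>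
      hd j (Finset.mem_insert_of_mem hj)
    have h' : ∀ j ∈ s, ‖E j z‖ ≤ 1 := fun j hj => h j (Finset.mem_insert_of_mem hj)
    have e : (fun w => ∏ j ∈ insert i s, E j w) = fun w => E i w * ∏ j ∈ s, E j w := by
      ext w
      rw [Finset.prod_insert hi]
    have hdp : DifferentiableAt ℂ (fun w => ∏ j ∈ s, E j w) z :=
      DifferentiableAt.fun_finsetProd hd'
    rw [e, deriv_fun_mul (hd i (Finset.mem_insert_self i s)) hdp, Finset.sum_insert hi]
    refine (norm_add_le _ _).trans ?_
    rw [norm_mul, norm_mul]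
    have h1 := ih hd' h'
    have h2 := h i (Finset.mem_insert_self i s)
    have h3 := norm_prod_le_one h'
    have := norm_nonneg (deriv (E i) z)
    have := norm_nonneg (deriv (fun w => ∏ j ∈ s, E j w) z)
    nlinarith

lemma norm_one_sub_conj_mul_le {z p : ℂ} (hp : ‖p‖ < 1) :
    ‖1 - conj p * z‖ ≤ 2 * (1 - ‖p‖) + ‖z - p‖ := by
  have e : 1 - conj p * z = (1 - conj p * p) - conj p * (z - p) := by ring
  rw [e]
  refine (norm_sub_le _ _).trans ?_
  rw [norm_mul, RCLike.norm_conj, Complex.conj_mul']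
  have e2 : ‖(1 : ℂ) - (‖p‖ : ℂ) ^ 2‖ = 1 - ‖p‖ ^ 2 := by
    have : (1 : ℂ) - (‖p‖ : ℂ) ^ 2 = ((1 - ‖p‖ ^ 2 : ℝ) : ℂ) := by push_cast; ring
    rw [this, Complex.norm_real, Real.norm_of_nonneg (one_sub_norm_sq_pos hp).le]
  rw [e2]
  nlinarith [norm_nonneg p, norm_nonneg (z - p)]

/-- The constants correspond: from |z - p| = ρ|1 - p̄z| and |1 - p̄z| ≤ 2(1 - |p|) + |z - p|, the
bound ρ < 1/9 gives (8/9)|z - p| < (2/9)(1 - |p|). -/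
lemma norm_sub_lt_of_pseudoHyperbolicDist_lt {z p : ℂ} (hz : ‖z‖ < 1) (hp : ‖p‖ < 1)
    (h : pseudoHyperbolicDist z p < 1 / 9) : ‖z - p‖ < (1 - ‖p‖) / 4 := by
  have h1 := norm_sub_eq_pseudoHyperbolicDist_mul hz hp
  have h2 := norm_one_sub_conj_mul_le (z := z) hp
  have h3 := pseudoHyperbolicDist_nonneg z p
  have h4 := norm_nonneg (z - p)
  have h5 := norm_nonneg (1 - conj p * z)
  nlinarith

lemma norm_sub_le_of_norm_sub_lt {z p : ℂ} (hz : ‖z‖ < 1) (hp : ‖p‖ < 1)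
    (h : ‖z - p‖ < (1 - ‖p‖) / 4) :
    ‖z - p‖ ≤ 9 / 4 * (1 - ‖p‖) * pseudoHyperbolicDist z p := by
  have h1 := norm_sub_eq_pseudoHyperbolicDist_mul hz hp
  have h2 := norm_one_sub_conj_mul_le (z := z) hp
  have h3 := pseudoHyperbolicDist_nonneg z p
  rw [h1]
  nlinarith

/-! ### Interpolating and cut-off functions for one cluster -/

namespace DiscFamily

variable {ι : Type*} {F : DiscFamily ι} {m₀ : ℕ}

lemma one_sub_norm_mobius_sq_le {p z : ℂ} (hp : ‖p‖ < 1) (hz : ‖z‖ < 1) :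
    1 - ‖mobius p z‖ ^ 2 ≤ 4 * (1 - ‖z‖) / (1 - ‖p‖) := by
  have h1 := one_sub_pseudoHyperbolicDist_sq hz hp
  rw [pseudoHyperbolicDist_eq_norm_mobius] at h1
  have h2 : 1 - ‖p‖ ≤ ‖1 - conj p * z‖ := by
    rw [norm_one_sub_conj_mul_comm]
    exact one_sub_norm_le_norm_one_sub_conj_mul hz.le
  have h3 : 0 < 1 - ‖p‖ := by linarith
  rw [h1]
  calc (1 - ‖z‖ ^ 2) * (1 - ‖p‖ ^ 2) / ‖1 - conj p * z‖ ^ 2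
      ≤ (2 * (1 - ‖z‖)) * (2 * (1 - ‖p‖)) / (1 - ‖p‖) ^ 2 := by
        have := norm_nonneg z
        have := norm_nonneg p
        have := one_sub_norm_sq_pos hp
        have := one_sub_norm_sq_pos hz
        gcongr <;> nlinarith
    _ = _ := by field_simp; ring

variable {K : Type*}

namespace Clusters

variable (Q : F.Clusters K)

/-- Levels in a cluster spread by at most the factor 1.0201, and 400 · 1.0201 < 409. -/
lemma scaleBase_pow_le_one_sub {q : K} {i : ι} (hi : i ∈ Q.cl q) :
    scaleBase ^ (409 * Q.lev q) / 2 ≤ 1 - F.r i := by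
  have h1 := F.le_one_sub i
  have h2 := Q.le_lev q i hi
  have h3 : scaleBase ^ (409 * Q.lev q) ≤ scaleBase ^ (400 * F.lev i) :=
    scaleBase_pow_le (by omega)
  linarith

lemma norm_one_sub_conj_pt_mul_le (i j : ι) :
    ‖1 - conj (F.pt j) * F.pt i‖ ≤ (1 - F.r i) + (1 - F.r j) + ‖F.ζ i - F.ζ j‖ := by
  have e : ‖1 - conj (F.pt j) * F.pt i‖ ≤ (1 - F.r i) + ‖F.ζ i - F.pt j‖ := by
    have e1 : 1 - conj (F.pt j) * F.pt i
        = (1 - F.r i) + F.r i * (conj (F.ζ i - F.pt j) * F.ζ i) := by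
      have : conj (F.ζ i) * F.ζ i = 1 := by
        rw [Complex.conj_mul', F.norm_ζ]
        simp
      rw [map_sub, sub_mul, this, show F.pt i = F.r i * F.ζ i from rfl]
      ring
    rw [e1]
    refine (norm_add_le _ _).trans ?_
    have h1 : ‖(1 : ℂ) - (F.r i : ℂ)‖ = 1 - F.r i := by
      rw [show (1 : ℂ) - (F.r i : ℂ) = ((1 - F.r i : ℝ) : ℂ) by push_cast; ring, Complex.norm_real,
        Real.norm_of_nonneg (by linarith [F.r_lt_one i])]
    rw [h1, norm_mul, norm_mul, RCLike.norm_conj, F.norm_ζ, mul_one, Complex.norm_real,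
      Real.norm_of_nonneg (F.r_nonneg i)]
    have := mul_le_of_le_one_left (norm_nonneg (F.ζ i - F.pt j)) (F.r_lt_one i).le
    linarith
  have h2 := norm_sub_le_norm_sub_add_norm_sub (F.ζ i) (F.ζ j) (F.pt j)
  rw [norm_ζ_sub_pt] at h2
  linarith

/-- The identity for 1 - ρ² compares two depths of order at least the power 409 with the square of a
denominator of order at most the power 398. The loss is 2(409 - 398) = 22 powers, and one further
power absorbs the constants because its value is at most 1/128. -/
lemma scaleBase_pow_le_one_sub_dist {q : K} (hq : 2800 ≤ Q.lev q) {i j : ι} (hi : i ∈ Q.cl q)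
    (hj : j ∈ Q.cl q) :
    scaleBase ^ (23 * Q.lev q) ≤ 1 - pseudoHyperbolicDist (F.pt i) (F.pt j) := by
  have hp := norm_pt_lt_one (F := F) i
  have hp' := norm_pt_lt_one (F := F) j
  have h1 := one_sub_pseudoHyperbolicDist_sq hp hp'
  have h2 := norm_one_sub_conj_pt_mul_le (F := F) i j
  have h3 := Q.norm_le q i hi j hj
  have h4 := Q.scaleBase_pow_le_one_sub hi
  have h5 := Q.scaleBase_pow_le_one_sub hj
  have a1 := F.one_sub_le i
  have a2 := F.one_sub_le j
  have a3 : scaleBase ^ (400 * F.lev i) ≤ scaleBase ^ (398 * Q.lev q) :=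
    scaleBase_pow_le (by have := Q.lev_le q i hi; omega)
  have a4 : scaleBase ^ (400 * F.lev j) ≤ scaleBase ^ (398 * Q.lev q) :=
    scaleBase_pow_le (by have := Q.lev_le q j hj; omega)
  have h6 : ‖1 - conj (F.pt j) * F.pt i‖ ≤ 4 * scaleBase ^ (398 * Q.lev q) := by linarith
  have h7 := pseudoHyperbolicDist_nonneg (F.pt i) (F.pt j)
  have h8 := pseudoHyperbolicDist_lt_one hp hp'
  have h9 : scaleBase ^ Q.lev q ≤ 1 / 128 := by
    refine (scaleBase_pow_le hq).trans ?_
    rw [show 2800 = 400 * 7 by norm_num, scaleBase_pow_400_mul]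
    norm_num
  have hD : 0 < ‖1 - conj (F.pt j) * F.pt i‖ := norm_pos_iff.2 (one_sub_conj_mul_ne_zero hp hp')
  set c := Q.lev q with hc
  have b1 := scaleBase_pow_pos (23 * c)
  have b2 := scaleBase_pow_pos (398 * c)
  have b3 := scaleBase_pow_pos (409 * c)
  have b4 := scaleBase_pow_pos c
  have e1 : scaleBase ^ (409 * c) ^ 1 * scaleBase ^ (409 * c)
      * scaleBase ^ c = scaleBase ^ (23 * c) * (scaleBase ^ (398 * c)) ^ 2 := by
    rw [← pow_mul, pow_one, ← pow_add, ← pow_add, ← pow_add]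
    congr 1
    ring
  rw [pow_one] at e1
  have e2 : scaleBase ^ (23 * c) * ‖1 - conj (F.pt j) * F.pt i‖ ^ 2
      ≤ (1 - F.r i) * (1 - F.r j) / 2 := by
    calc scaleBase ^ (23 * c) * ‖1 - conj (F.pt j) * F.pt i‖ ^ 2
        ≤ scaleBase ^ (23 * c) * (4 * scaleBase ^ (398 * c)) ^ 2 := by gcongr
      _ = 16 * (scaleBase ^ (409 * c) * scaleBase ^ (409 * c) * scaleBase ^ c) := by
        rw [e1]; ring
      _ ≤ 16 * (scaleBase ^ (409 * c) * scaleBase ^ (409 * c) * (1 / 128)) := by gcongr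
      _ = (scaleBase ^ (409 * c) / 2) * (scaleBase ^ (409 * c) / 2) / 2 := by ring
      _ ≤ _ := by gcongr; linarith
  have e3 : (1 - F.r i) * (1 - F.r j) ≤ (1 - ‖F.pt i‖ ^ 2) * (1 - ‖F.pt j‖ ^ 2) := by
    rw [norm_pt, norm_pt]
    have := F.r_nonneg i
    have := F.r_nonneg j
    have := F.r_lt_one i
    have := F.r_lt_one j
    gcongr <;> nlinarith
  have e4 : 2 * scaleBase ^ (23 * c) ≤ 1 - pseudoHyperbolicDist (F.pt i) (F.pt j) ^ 2 := by
    rw [h1, le_div_iff₀ (by positivity)]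
    linarith
  nlinarith

lemma log_two_div_le {c : ℕ} (hc : 2800 ≤ c) : Real.log (2 / scaleBase ^ (23 * c)) ≤ c := by
  have h1 : scaleBase ^ (400 * c) ≤ scaleBase ^ (23 * c) := scaleBase_pow_le (by omega)
  rw [scaleBase_pow_400_mul] at h1
  have h2 : 2 / scaleBase ^ (23 * c) ≤ 2 ^ (c + 1) := by
    rw [div_le_iff₀ (scaleBase_pow_pos _)]
    calc (2 : ℝ) = 2 ^ (c + 1) * (1 / 2) ^ c := by
          rw [pow_succ, mul_right_comm, ← mul_pow]; norm_num
      _ ≤ _ := by gcongr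
  have h3 := Real.log_le_log (div_pos two_pos (scaleBase_pow_pos _)) h2
  rw [Real.log_pow] at h3
  have h4 := Real.log_two_lt_d9
  have h5 : (2800 : ℝ) ≤ c := by exact_mod_cast hc
  push_cast at h3
  nlinarith

/-- The building blocks of the interpolating function for one cluster. -/
structure Block (Q : F.Clusters K) (q : K) (a : ι → ℂ) (C : ℝ) (h E : ℂ → ℂ) : Prop where
  differentiableOn_h : DifferentiableOn ℂ h (Metric.ball 0 1)
  differentiableOn_E : DifferentiableOn ℂ E (Metric.ball 0 1)
  h_pt : ∀ i ∈ Q.cl q, h (F.pt i) = a i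
  E_pt : ∀ i ∈ Q.cl q, E (F.pt i) = 0
  norm_E : ∀ z, ‖z‖ < 1 → ‖E z‖ ≤ 1
  norm_one_sub_E : ∀ z, ‖z‖ < 1 → ‖1 - E z‖ ≤ 6 * ∑ i ∈ Q.cl q, sideWeight (F.lev i) (F.ζ i) z
  norm_deriv_E : ∀ z, ‖z‖ < 1 → (1 - ‖z‖ ^ 2) * ‖deriv E z‖ ≤
    6400 / Q.lev q * ∑ i ∈ Q.cl q, sideWeight (F.lev i) (F.ζ i) z * depthWeight (F.lev i) z
  norm_h : ∀ z, ‖z‖ < 1 → ‖h z‖ ≤ 1302 * C * Q.lev q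
  norm_deriv_h : ∀ z, ‖z‖ < 1 → ∀ i ∈ Q.cl q,
    (1 - ‖z‖ ^ 2) * ‖deriv h z‖ ≤ 1300 * C * depthWeight (F.lev i) z

theorem exists_block (hF : F.Sparse m₀) (hm₀ : 2800 ≤ m₀) (q : K) {a : ι → ℂ} {C : ℝ}
    (hC : 0 ≤ C) (ha : ∀ i j, ‖a i - a j‖ ≤ C * hyperbolicDist (F.pt i) (F.pt j))
    (haC : ∀ i, ‖a i‖ ≤ C * F.lev i) : ∃ h E, Q.Block q a C h E := by
  have hq : m₀ ≤ Q.lev q := by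
    obtain ⟨i, _, hi⟩ := Q.exists_eq_lev q
    exact hi ▸ hF.le_lev i
  have hq' : 2800 ≤ Q.lev q := hm₀.trans hq
  have hq0 : (0 : ℝ) < Q.lev q := by exact_mod_cast (by omega : 0 < Q.lev q)
  obtain ⟨h, hd, hpt, hh⟩ := exists_bloch_cluster (Q.cl q) (Q.nonempty q) (Q.card_le q) (z := F.pt)
    (a := a) (C := C) (κ := scaleBase ^ (23 * Q.lev q)) (B := C * (2 * Q.lev q))
    (fun i _ => norm_pt_lt_one i) hC (fun i _ j _ => ha i j)
    (fun i hi => (haC i).trans (mul_le_mul_of_nonneg_left (by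
      exact_mod_cast (by have := Q.le_lev q i hi; omega : F.lev i ≤ 2 * Q.lev q)) hC))
    (scaleBase_pow_pos _) (fun i hi j hj => Q.scaleBase_pow_le_one_sub_dist hq' hi hj)
    (fun i _ j _ k _ hij hjk hik h1 h2 => by
      rw [pseudoHyperbolicDist_comm] at h1 h2
      have b1 := norm_sub_lt_of_pseudoHyperbolicDist_lt (norm_pt_lt_one _) (norm_pt_lt_one _) h1
      have b2 := norm_sub_lt_of_pseudoHyperbolicDist_lt (norm_pt_lt_one _) (norm_pt_lt_one _) h2
      rw [norm_pt] at b1 b2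
      exact hF.no_triple i j k hij hjk hik b1 b2)
  have hE : ∀ i, ∃ E : ℂ → ℂ, DifferentiableOn ℂ E (Metric.ball 0 1) ∧ E (F.pt i) = 0 ∧
      ∀ z : ℂ, ‖z‖ < 1 → ‖E z‖ ≤ 1 ∧ ‖1 - E z‖ ≤ 6 * sideWeight (F.lev i) (F.ζ i) z ∧
        (1 - ‖z‖ ^ 2) * ‖deriv E z‖
          ≤ 6400 / F.lev i * (sideWeight (F.lev i) (F.ζ i) z * depthWeight (F.lev i) z) :=
    fun i => exists_log_bump (by have := hF.le_lev i; omega) (F.norm_ζ i) (F.r_lt_one i)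
      (F.one_sub_le i)
  choose E hEd hEpt hE using hE
  refine ⟨h, fun z => ∏ i ∈ Q.cl q, E i z, hd, ?_, hpt, ?_, ?_, ?_, ?_, ?_, ?_⟩
  · exact DifferentiableOn.fun_finsetProd fun i _ => hEd i
  · exact fun i hi => Finset.prod_eq_zero hi (hEpt i)
  · exact fun z hz => norm_prod_le_one fun i _ => (hE i z hz).1
  · intro z hz
    refine (norm_one_sub_prod_le fun i _ => (hE i z hz).1).trans ?_
    rw [Finset.mul_sum]
    exact Finset.sum_le_sum fun i _ => (hE i z hz).2.1
  · intro z hz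
    have h1 := norm_deriv_prod_le (s := Q.cl q) (E := E) (z := z)
      (fun i _ => (hEd i).differentiableAt_of_norm_lt_one hz) fun i _ => (hE i z hz).1
    refine (mul_le_mul_of_nonneg_left h1 (one_sub_norm_sq_pos hz).le).trans ?_
    rw [Finset.mul_sum, Finset.mul_sum]
    refine Finset.sum_le_sum fun i hi => (hE i z hz).2.2.trans ?_
    have h2 := Q.lev_le q i hi
    have := sideWeight_nonneg (F.lev i) (F.ζ i) z
    have := depthWeight_nonneg (F.lev i) hz
    gcongr
  · intro z hz
    have h1 := (hh z hz).1
    have h2 := mul_le_mul_of_nonneg_left (log_two_div_le hq') hC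
    linarith
  · intro z hz i hi
    have hz1 : 0 < 1 - ‖z‖ := by linarith
    refine ((hh z hz).2 (8 * (1 - ‖z‖) / scaleBase ^ (409 * Q.lev q)) fun j hj => ?_).trans ?_
    · refine (one_sub_norm_mobius_sq_le (norm_pt_lt_one j) hz).trans ?_
      have h1 := Q.scaleBase_pow_le_one_sub hj
      have h2 := scaleBase_pow_pos (409 * Q.lev q)
      rw [norm_pt]
      calc 4 * (1 - ‖z‖) / (1 - F.r j) ≤ 4 * (1 - ‖z‖) / (scaleBase ^ (409 * Q.lev q) / 2) := by
            gcongr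
        _ = _ := by field_simp; ring
    · unfold depthWeight
      refine mul_le_mul_of_nonneg_left (min_le_min_left _ ?_) (by positivity)
      have h3 : scaleBase ^ (440 * F.lev i) ≤ scaleBase ^ (440 * Q.lev q) :=
        scaleBase_pow_le (by have := Q.lev_le q i hi; omega)
      have h4 : scaleBase ^ (8 * Q.lev q) ≤ 1 / 8 := by
        refine (scaleBase_pow_le (show 400 * 3 ≤ 8 * Q.lev q by omega)).trans ?_
        rw [scaleBase_pow_400_mul]
        norm_num
      have h5 := scaleBase_pow_pos (440 * F.lev i)
      have h6 := scaleBase_pow_pos (409 * Q.lev q)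
      have h7 := scaleBase_pow_pos (23 * Q.lev q)
      rw [div_div, div_le_div_iff₀ (by positivity) h5, mul_assoc, mul_comm, mul_assoc]
      refine mul_le_mul_of_nonneg_left ?_ hz1.le
      -- The exponent 440 is 409 + 23 + 8: the depth of the cluster, the separation constant κ, and
      -- room for the factor 8.
      calc scaleBase ^ (440 * F.lev i) * 8 ≤ scaleBase ^ (440 * Q.lev q) * 8 := by gcongr
        _ = scaleBase ^ (409 * Q.lev q) * scaleBase ^ (23 * Q.lev q)
            * (8 * scaleBase ^ (8 * Q.lev q)) := by
          rw [show 440 * Q.lev q = 409 * Q.lev q + 23 * Q.lev q + 8 * Q.lev q by ring, pow_add,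
            pow_add]
          ring
        _ ≤ scaleBase ^ (409 * Q.lev q) * scaleBase ^ (23 * Q.lev q) * 1 := by
          gcongr
          linarith
        _ = _ := mul_one _

end Clusters

end DiscFamily

/-! ### Assembling the clusters level by level -/

open Filter Topology in
/-- A limit of holomorphic functions on the disc with summable increments and uniformly bounded
Bloch seminorm. -/
lemma exists_limit_of_summable_increments {S : ℕ → ℂ → ℂ} (hS0 : ∀ z, S 0 z = 0)
    (hd : ∀ k, DifferentiableOn ℂ (S k) (Metric.ball 0 1)) {v : ℕ → ℝ} (hv : Summable v)
    (hv0 : ∀ k, 0 ≤ v k)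
    (hinc : ∀ k z, ‖z‖ < 1 → ‖S (k + 1) z - S k z‖ ≤ v k / (1 - ‖z‖)) {B : ℝ}
    (hB : ∀ k z, ‖z‖ < 1 → (1 - ‖z‖ ^ 2) * ‖deriv (S k) z‖ ≤ B) :
    ∃ f : ℂ → ℂ, DifferentiableOn ℂ f (Metric.ball 0 1) ∧
      (∀ z, ‖z‖ < 1 → Tendsto (fun k => S k z) atTop (𝓝 (f z))) ∧
      ∀ z, ‖z‖ < 1 → (1 - ‖z‖ ^ 2) * ‖deriv f z‖ ≤ B := by
  -- The limit as a telescoping series, to which the M-test applies on every smaller disc;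
  -- derivatives then converge as well, and the gradient bound passes to the limit.
  let f : ℂ → ℂ := fun z => ∑' k, (S (k + 1) z - S k z)
  have hsum : ∀ k z, ∑ j ∈ Finset.range k, (S (j + 1) z - S j z) = S k z := fun k z => by
    rw [Finset.sum_range_sub (fun j => S j z), hS0, sub_zero]
  have hunif : ∀ R < 1, TendstoUniformlyOn S f atTop (Metric.ball 0 R) := by
    intro R hR
    have := tendstoUniformlyOn_tsum_nat (f := fun k z => S (k + 1) z - S k z)
      (u := fun k => v k / (1 - R)) (hv.div_const _) (s := Metric.ball 0 R) fun k z hz => by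
        rw [mem_ball_zero_iff] at hz
        refine (hinc k z (by linarith)).trans ?_
        have := hv0 k
        have : 0 < 1 - R := by linarith
        gcongr
    simpa only [hsum] using this
  have hloc : TendstoLocallyUniformlyOn S f atTop (Metric.ball 0 1) := by
    intro u hu x hx
    rw [mem_ball_zero_iff] at hx
    refine ⟨Metric.ball 0 ((1 + ‖x‖) / 2), mem_nhdsWithin_of_mem_nhds
      (Metric.isOpen_ball.mem_nhds (by rw [mem_ball_zero_iff]; linarith)), ?_⟩
    exact hunif _ (by linarith) u hu
  have hder := hloc.deriv (Eventually.of_forall hd) Metric.isOpen_ball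
  refine ⟨f, hloc.differentiableOn (Eventually.of_forall hd) Metric.isOpen_ball,
    fun z hz => hloc.tendsto_at (mem_ball_zero_iff.2 hz), fun z hz => ?_⟩
  have h1 := hder.tendsto_at (mem_ball_zero_iff.2 hz)
  exact le_of_tendsto ((h1.norm).const_mul _) (Eventually.of_forall fun k => hB k z hz)

namespace DiscFamily

variable {ι : Type*} {F : DiscFamily ι} {m₀ : ℕ} {K : Type*}

namespace Clusters

variable (Q : F.Clusters K)

lemma mem_cl_index (i : ι) : i ∈ Q.cl (Q.index i) := (Q.mem_cl _ _).2 rfl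

lemma finite_level (k : ℕ) : {q | Q.lev q = k}.Finite := by
  refine ((F.finite_lev k).image Q.index).subset fun q hq => ?_
  obtain ⟨i, hi, h⟩ := Q.exists_eq_lev q
  exact ⟨i, h.trans hq, (Q.mem_cl _ _).1 hi⟩

/-- The clusters of level `k`. -/
def level (k : ℕ) : Finset K := (Q.finite_level k).toFinset

lemma mem_level {k : ℕ} {q : K} : q ∈ Q.level k ↔ Q.lev q = k := by simp [level]

open Classical in
/-- The union of a finite set of clusters. -/
def union (s : Finset K) : Finset ι := s.biUnion Q.cl

lemma mem_union {s : Finset K} {i : ι} : i ∈ Q.union s ↔ Q.index i ∈ s := by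
  simp only [union, Finset.mem_biUnion, Q.mem_cl]
  exact ⟨fun ⟨q, h1, h2⟩ => h2 ▸ h1, fun h => ⟨_, h, rfl⟩⟩

open Classical in
lemma sum_union (s : Finset K) (g : ι → ℝ) :
    ∑ i ∈ Q.union s, g i = ∑ q ∈ s, ∑ i ∈ Q.cl q, g i := by
  refine Finset.sum_biUnion fun q _ q' _ h => ?_
  refine Finset.disjoint_left.2 fun i hi hi' => h ?_
  rw [Q.mem_cl] at hi hi'
  exact hi.symm.trans hi'

open Classical in
/-- The clusters with level in a finite set. -/
def levels (s : Finset ℕ) : Finset K := s.biUnion Q.level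

lemma mem_levels {s : Finset ℕ} {q : K} : q ∈ Q.levels s ↔ Q.lev q ∈ s := by
  simp [levels, mem_level]

open Classical in
lemma sum_levels (s : Finset ℕ) (g : K → ℝ) :
    ∑ q ∈ Q.levels s, g q = ∑ k ∈ s, ∑ q ∈ Q.level k, g q := by
  refine Finset.sum_biUnion fun k _ k' _ h => ?_
  refine Finset.disjoint_left.2 fun q hq hq' => h ?_
  rw [mem_level] at hq hq'
  exact hq.symm.trans hq'

/-- The partial sums of the interpolating function. -/
def partialSum (h E : K → ℂ → ℂ) : ℕ → ℂ → ℂ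
  | 0 => fun _ => 0
  | k + 1 => fun z => partialSum h E k z * ∏ q ∈ Q.level k, E q z
      + ∑ q ∈ Q.level k, h q z * (1 - E q z)

/-- The local mass of an index. -/
abbrev mass (F : DiscFamily ι) (z : ℂ) (i : ι) : ℝ := F.lev i * sideWeight (F.lev i) (F.ζ i) z

variable {Q} {a : ι → ℂ} {C : ℝ} {h E : K → ℂ → ℂ}

/-- The factor h has size O(C lev q) and 1 - E is bounded by the horizontal weights, so their
product is controlled by the mass, level times weight. -/
lemma Block.norm_term {q : K} {h E : ℂ → ℂ} (hB : Q.Block q a C h E) (hC : 0 ≤ C) {z : ℂ}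
    (hz : ‖z‖ < 1) : ‖h z * (1 - E z)‖ ≤ 7812 * C * ∑ i ∈ Q.cl q, mass F z i := by
  have h1 := hB.norm_h z hz
  have h2 := hB.norm_one_sub_E z hz
  have h3 : (Q.lev q : ℝ) * ∑ i ∈ Q.cl q, sideWeight (F.lev i) (F.ζ i) z
      ≤ ∑ i ∈ Q.cl q, mass F z i := by
    rw [Finset.mul_sum]
    refine Finset.sum_le_sum fun i hi => ?_
    exact mul_le_mul_of_nonneg_right (by exact_mod_cast Q.lev_le q i hi) (sideWeight_nonneg _ _ _)
  rw [norm_mul]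
  calc ‖h z‖ * ‖1 - E z‖
      ≤ (1302 * C * Q.lev q) * (6 * ∑ i ∈ Q.cl q, sideWeight (F.lev i) (F.ζ i) z) := by gcongr
    _ = 7812 * C * (Q.lev q * ∑ i ∈ Q.cl q, sideWeight (F.lev i) (F.ζ i) z) := by ring
    _ ≤ _ := by gcongr

lemma norm_sum_term_le (hB : ∀ q, Q.Block q a C (h q) (E q)) (hC : 0 ≤ C) (s : Finset K) {z : ℂ}
    (hz : ‖z‖ < 1) :
    ‖∑ q ∈ s, h q z * (1 - E q z)‖ ≤ 7812 * C * ∑ i ∈ Q.union s, mass F z i := by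
  rw [sum_union, Finset.mul_sum]
  exact norm_sum_le_of_le _ fun q _ => (hB q).norm_term hC hz

lemma norm_partialSum_le_sum (hB : ∀ q, Q.Block q a C (h q) (E q)) (hC : 0 ≤ C) (k : ℕ) {z : ℂ}
    (hz : ‖z‖ < 1) : ‖Q.partialSum h E k z‖
      ≤ 7812 * C * ∑ i ∈ Q.union (Q.levels (Finset.range k)), mass F z i := by
  induction k with
  | zero => simp [partialSum, levels, union]
  | succ k ih =>
    rw [sum_union, sum_levels, Finset.sum_range_succ, ← sum_levels, ← sum_union, ← sum_union,
      partialSum, mul_add]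
    refine (norm_add_le _ _).trans (add_le_add ?_ (norm_sum_term_le hB hC _ hz))
    rw [norm_mul]
    exact (mul_le_of_le_one_right (norm_nonneg _)
      (norm_prod_le_one fun q _ => (hB q).norm_E z hz)).trans ih

/-- The constant in the growth estimate. -/
def growthBound : ℝ := 7812 * (200 + farTail 0)

lemma growthBound_pos : 0 < growthBound := by
  have := farTail_nonneg 0
  unfold growthBound
  positivity

/-- Multiplication by the factors E never increases the modulus, so only the added terms count. The
linear growth is essential, since it is exactly compensated by the gradient O(1/k) of the factors E
of level k. -/
lemma norm_partialSum_le (hF : F.Sparse m₀) (hm₀ : 2800 ≤ m₀)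
    (hB : ∀ q, Q.Block q a C (h q) (E q)) (hC : 0 ≤ C) (k : ℕ) {z : ℂ} (hz : ‖z‖ < 1) :
    ‖Q.partialSum h E k z‖ ≤ growthBound * C * k := by
  rcases k.eq_zero_or_pos with rfl | hk
  · simp [partialSum]
  refine (norm_partialSum_le_sum hB hC k hz).trans ?_
  -- A cluster of level below k may contain indices of slightly larger level; 2k is a crude bound
  -- for them.
  have h1 := hF.sum_lev_mul_sideWeight_le (by omega) hz (2 * k)
    (T := Q.union (Q.levels (Finset.range k))) fun i hi => by
      rw [mem_union, mem_levels, Finset.mem_range] at hi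
      have := Q.le_lev _ i (Q.mem_cl_index i)
      omega
  have h2 : (1 : ℝ) ≤ k := by exact_mod_cast hk
  have h3 := farTail_nonneg 0
  calc _ ≤ 7812 * C * (100 * (2 * k : ℕ) + farTail 0) := by gcongr
    _ ≤ 7812 * C * ((200 + farTail 0) * k) := by
      gcongr
      push_cast
      nlinarith
    _ = _ := by rw [growthBound]; ring

/-- The constant in the estimate of the increments. -/
def incrementBound : ℝ := 6 * growthBound + 7812

lemma incrementBound_pos : 0 < incrementBound := by
  have := growthBound_pos
  unfold incrementBound
  positivity

lemma norm_one_sub_prod_E_le (hB : ∀ q, Q.Block q a C (h q) (E q)) (k : ℕ) {z : ℂ}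
    (hz : ‖z‖ < 1) :
    k * ‖1 - ∏ q ∈ Q.level k, E q z‖ ≤ 6 * ∑ i ∈ Q.union (Q.level k), mass F z i := by
  have h1 := norm_one_sub_prod_le (s := Q.level k) (x := fun q => E q z)
    fun q _ => (hB q).norm_E z hz
  have h2 := Finset.sum_le_sum fun q (_ : q ∈ Q.level k) => (hB q).norm_one_sub_E z hz
  refine (mul_le_mul_of_nonneg_left (h1.trans h2) (Nat.cast_nonneg k)).trans ?_
  rw [← Finset.mul_sum, ← sum_union, mul_left_comm, Finset.mul_sum]
  refine mul_le_mul_of_nonneg_left (Finset.sum_le_sum fun i hi => ?_) (by norm_num)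
  rw [mem_union, mem_level] at hi
  have := Q.lev_le _ i (Q.mem_cl_index i)
  exact mul_le_mul_of_nonneg_right (by exact_mod_cast hi ▸ this) (sideWeight_nonneg _ _ _)

/-- An increment consists of the new terms and of S_k(1 - ∏E). As S_k = O(Ck), the second is also of
the order of the mass of level k. -/
lemma norm_partialSum_succ_sub_le (hF : F.Sparse m₀) (hm₀ : 2800 ≤ m₀)
    (hB : ∀ q, Q.Block q a C (h q) (E q)) (hC : 0 ≤ C) (k : ℕ) {z : ℂ} (hz : ‖z‖ < 1) :
    ‖Q.partialSum h E (k + 1) z - Q.partialSum h E k z‖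
      ≤ incrementBound * C * ∑ i ∈ Q.union (Q.level k), mass F z i := by
  have e : Q.partialSum h E (k + 1) z - Q.partialSum h E k z
      = ∑ q ∈ Q.level k, h q z * (1 - E q z)
        - Q.partialSum h E k z * (1 - ∏ q ∈ Q.level k, E q z) := by
    rw [partialSum]
    ring
  rw [e]
  refine (norm_sub_le _ _).trans ?_
  have h1 := norm_sum_term_le hB hC (Q.level k) hz
  have h2 := norm_partialSum_le hF hm₀ hB hC k hz
  have h3 := norm_one_sub_prod_E_le hB k hz
  have h4 := growthBound_pos
  rw [norm_mul]
  have h5 : ‖Q.partialSum h E k z‖ * ‖1 - ∏ q ∈ Q.level k, E q z‖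
      ≤ growthBound * C * (6 * ∑ i ∈ Q.union (Q.level k), mass F z i) := by
    calc _ ≤ growthBound * C * k * ‖1 - ∏ q ∈ Q.level k, E q z‖ := by gcongr
      _ = growthBound * C * (k * ‖1 - ∏ q ∈ Q.level k, E q z‖) := by ring
      _ ≤ _ := by gcongr
  rw [incrementBound]
  linarith

lemma norm_partialSum_sub_le (hF : F.Sparse m₀) (hm₀ : 2800 ≤ m₀)
    (hB : ∀ q, Q.Block q a C (h q) (E q)) (hC : 0 ≤ C) {k n : ℕ} (hkn : k ≤ n) {z : ℂ}
    (hz : ‖z‖ < 1) : ‖Q.partialSum h E n z - Q.partialSum h E k z‖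
      ≤ incrementBound * C * ∑ i ∈ Q.union (Q.levels (Finset.Ico k n)), mass F z i := by
  rw [sum_union, sum_levels, Finset.mul_sum,
    ← Finset.sum_Ico_sub (fun j => Q.partialSum h E j z) hkn]
  refine norm_sum_le_of_le _ fun j _ => ?_
  rw [← sum_union]
  exact norm_partialSum_succ_sub_le hF hm₀ hB hC j hz

/-- The weight of an index in gradient estimates. -/
abbrev gradWeight (F : DiscFamily ι) (z : ℂ) (i : ι) : ℝ :=
  sideWeight (F.lev i) (F.ζ i) z * depthWeight (F.lev i) z

lemma gradWeight_nonneg {z : ℂ} (hz : ‖z‖ < 1) (i : ι) : 0 ≤ gradWeight F z i :=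
  mul_nonneg (sideWeight_nonneg _ _ _) (depthWeight_nonneg _ hz)

lemma Block.differentiableAt_term {q : K} {h E : ℂ → ℂ} (hB : Q.Block q a C h E) {z : ℂ}
    (hz : ‖z‖ < 1) : DifferentiableAt ℂ (fun w => h w * (1 - E w)) z :=
  (hB.differentiableOn_h.differentiableAt_of_norm_lt_one hz).mul
    ((hB.differentiableOn_E.differentiableAt_of_norm_lt_one hz).const_sub 1)

/-- In the product rule, the gradient of h supplies the vertical weight and 1 - E the horizontal
one. In the other term the size O(lev q) of h cancels against the 1 / lev q in the gradient of E. -/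
lemma Block.norm_deriv_term {q : K} {h E : ℂ → ℂ} (hB : Q.Block q a C h E) (hC : 0 ≤ C)
    {z : ℂ} (hz : ‖z‖ < 1) : (1 - ‖z‖ ^ 2) * ‖deriv (fun w => h w * (1 - E w)) z‖
      ≤ 10 ^ 7 * C * ∑ i ∈ Q.cl q, gradWeight F z i := by
  have hz2 := one_sub_norm_sq_pos hz
  rw [deriv_fun_mul (hB.differentiableOn_h.differentiableAt_of_norm_lt_one hz)
    ((hB.differentiableOn_E.differentiableAt_of_norm_lt_one hz).const_sub 1), deriv_const_sub]
  have h1 : (1 - ‖z‖ ^ 2) * ‖deriv h z * (1 - E z)‖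
      ≤ 7800 * C * ∑ i ∈ Q.cl q, gradWeight F z i := by
    rw [norm_mul, ← mul_assoc]
    have h2 := mul_le_mul_of_nonneg_left (hB.norm_one_sub_E z hz)
      (by positivity : 0 ≤ (1 - ‖z‖ ^ 2) * ‖deriv h z‖)
    refine h2.trans ?_
    rw [Finset.mul_sum, Finset.mul_sum, Finset.mul_sum]
    refine Finset.sum_le_sum fun i hi => ?_
    have h3 := hB.norm_deriv_h z hz i hi
    have h4 := sideWeight_nonneg (F.lev i) (F.ζ i) z
    have h5 := mul_le_mul_of_nonneg_right h3 h4
    simp only [gradWeight]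
    linarith
  have h2 : (1 - ‖z‖ ^ 2) * ‖h z * -deriv E z‖
      ≤ 8332800 * C * ∑ i ∈ Q.cl q, gradWeight F z i := by
    rw [norm_mul, norm_neg, mul_left_comm]
    have h3 : 0 ≤ ∑ i ∈ Q.cl q, gradWeight F z i :=
      Finset.sum_nonneg fun i _ => gradWeight_nonneg hz i
    calc _ ≤ (1302 * C * Q.lev q) * (6400 / Q.lev q * ∑ i ∈ Q.cl q, gradWeight F z i) :=
          mul_le_mul (hB.norm_h z hz) (hB.norm_deriv_E z hz) (by positivity) (by positivity)
      _ = 8332800 * C * (Q.lev q / Q.lev q * ∑ i ∈ Q.cl q, gradWeight F z i) := by ring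
      _ ≤ 8332800 * C * (1 * ∑ i ∈ Q.cl q, gradWeight F z i) := by
          gcongr
          exact div_self_le_one _
      _ = _ := by rw [one_mul]
  have h3 : 0 ≤ ∑ i ∈ Q.cl q, gradWeight F z i :=
    Finset.sum_nonneg fun i _ => gradWeight_nonneg hz i
  have h4 := mul_nonneg hC h3
  calc _ ≤ (1 - ‖z‖ ^ 2) * (‖deriv h z * (1 - E z)‖ + ‖h z * -deriv E z‖) := by
        gcongr
        exact norm_add_le _ _
    _ ≤ _ := by rw [mul_add]; linarith

lemma differentiableAt_prod_E (hB : ∀ q, Q.Block q a C (h q) (E q)) (s : Finset K) {z : ℂ}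
    (hz : ‖z‖ < 1) : DifferentiableAt ℂ (fun w => ∏ q ∈ s, E q w) z :=
  DifferentiableAt.fun_finsetProd fun q _ =>
    (hB q).differentiableOn_E.differentiableAt_of_norm_lt_one hz

lemma differentiableAt_sum_term (hB : ∀ q, Q.Block q a C (h q) (E q)) (s : Finset K) {z : ℂ}
    (hz : ‖z‖ < 1) : DifferentiableAt ℂ (fun w => ∑ q ∈ s, h q w * (1 - E q w)) z :=
  DifferentiableAt.fun_sum fun q _ => (hB q).differentiableAt_term hz

lemma differentiableAt_partialSum (hB : ∀ q, Q.Block q a C (h q) (E q)) (k : ℕ) {z : ℂ}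
    (hz : ‖z‖ < 1) : DifferentiableAt ℂ (Q.partialSum h E k) z := by
  induction k with
  | zero => exact differentiableAt_const _
  | succ k ih =>
    exact (ih.fun_mul (differentiableAt_prod_E hB _ hz)).fun_add (differentiableAt_sum_term hB _ hz)

lemma differentiableOn_partialSum (hB : ∀ q, Q.Block q a C (h q) (E q)) (k : ℕ) :
    DifferentiableOn ℂ (Q.partialSum h E k) (Metric.ball 0 1) := fun _ hz =>
  (differentiableAt_partialSum hB k (mem_ball_zero_iff.1 hz)).differentiableWithinAt

/-- The constant in the gradient estimate. -/
def gradBound : ℝ := 6400 * growthBound + 10 ^ 7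

/-- Each new level multiplies the old gradient by factors of modulus at most 1, adds the gradients
of the new terms, and adds S_k times the gradient of ∏E, where O(k) meets O(1/k). Everything is thus
dominated by the gradient weights, whose total is bounded independently of k. -/
lemma norm_deriv_partialSum_le_sum (hF : F.Sparse m₀) (hm₀ : 2800 ≤ m₀)
    (hB : ∀ q, Q.Block q a C (h q) (E q)) (hC : 0 ≤ C) (k : ℕ) {z : ℂ} (hz : ‖z‖ < 1) :
    (1 - ‖z‖ ^ 2) * ‖deriv (Q.partialSum h E k) z‖
      ≤ gradBound * C * ∑ i ∈ Q.union (Q.levels (Finset.range k)), gradWeight F z i := by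
  have hz2 := one_sub_norm_sq_pos hz
  induction k with
  | zero =>
    rw [show Q.partialSum h E 0 = fun _ => (0 : ℂ) from rfl]
    simp [levels, union]
  | succ k ih =>
    rw [sum_union, sum_levels, Finset.sum_range_succ, ← sum_levels, ← sum_union, ← sum_union,
      mul_add]
    have hP := differentiableAt_prod_E hB (Q.level k) hz
    have hS := differentiableAt_partialSum hB k hz
    have e : deriv (Q.partialSum h E (k + 1)) z
        = deriv (Q.partialSum h E k) z * ∏ q ∈ Q.level k, E q z
          + (Q.partialSum h E k z * deriv (fun w => ∏ q ∈ Q.level k, E q w) z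
          + ∑ q ∈ Q.level k, deriv (fun w => h q w * (1 - E q w)) z) := by
      rw [show Q.partialSum h E (k + 1) = fun z => Q.partialSum h E k z * ∏ q ∈ Q.level k, E q z
        + ∑ q ∈ Q.level k, h q z * (1 - E q z) from rfl,
        deriv_fun_add (hS.fun_mul hP) (differentiableAt_sum_term hB _ hz), deriv_fun_mul hS hP,
        deriv_fun_sum fun q _ => (hB q).differentiableAt_term hz, add_assoc]
    have b1 : (1 - ‖z‖ ^ 2) * ‖deriv (Q.partialSum h E k) z * ∏ q ∈ Q.level k, E q z‖
        ≤ (1 - ‖z‖ ^ 2) * ‖deriv (Q.partialSum h E k) z‖ := by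
      rw [norm_mul]
      gcongr
      exact mul_le_of_le_one_right (norm_nonneg _)
        (norm_prod_le_one fun q _ => (hB q).norm_E z hz)
    have hw : 0 ≤ ∑ i ∈ Q.union (Q.level k), gradWeight F z i :=
      Finset.sum_nonneg fun i _ => gradWeight_nonneg hz i
    have b2 : (1 - ‖z‖ ^ 2) * ‖deriv (fun w => ∏ q ∈ Q.level k, E q w) z‖
        ≤ 6400 / k * ∑ i ∈ Q.union (Q.level k), gradWeight F z i := by
      have := norm_deriv_prod_le (s := Q.level k) (E := E) (z := z)
        (fun q _ => (hB q).differentiableOn_E.differentiableAt_of_norm_lt_one hz)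
        fun q _ => (hB q).norm_E z hz
      refine (mul_le_mul_of_nonneg_left this hz2.le).trans ?_
      rw [sum_union, Finset.mul_sum, Finset.mul_sum]
      refine Finset.sum_le_sum fun q hq => ?_
      have := (hB q).norm_deriv_E z hz
      rwa [(Q.mem_level).1 hq] at this
    have hg := growthBound_pos
    have b3 : (1 - ‖z‖ ^ 2)
        * ‖Q.partialSum h E k z * deriv (fun w => ∏ q ∈ Q.level k, E q w) z‖
        ≤ 6400 * growthBound * C * ∑ i ∈ Q.union (Q.level k), gradWeight F z i := by
      rw [norm_mul, mul_left_comm]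
      calc _ ≤ (growthBound * C * k)
            * (6400 / k * ∑ i ∈ Q.union (Q.level k), gradWeight F z i) :=
            mul_le_mul (norm_partialSum_le hF hm₀ hB hC k hz) b2 (by positivity) (by positivity)
        _ = 6400 * growthBound * C
            * (k / k * ∑ i ∈ Q.union (Q.level k), gradWeight F z i) := by ring
        _ ≤ 6400 * growthBound * C * (1 * ∑ i ∈ Q.union (Q.level k), gradWeight F z i) := by
            gcongr
            exact div_self_le_one _
        _ = _ := by rw [one_mul]
    have b4 : (1 - ‖z‖ ^ 2) * ‖∑ q ∈ Q.level k, deriv (fun w => h q w * (1 - E q w)) z‖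
        ≤ 10 ^ 7 * C * ∑ i ∈ Q.union (Q.level k), gradWeight F z i := by
      refine (mul_le_mul_of_nonneg_left (norm_sum_le _ _) hz2.le).trans ?_
      rw [sum_union, Finset.mul_sum, Finset.mul_sum]
      exact Finset.sum_le_sum fun q _ => (hB q).norm_deriv_term hC hz
    rw [e]
    have t1 := norm_add_le (deriv (Q.partialSum h E k) z * ∏ q ∈ Q.level k, E q z)
      (Q.partialSum h E k z * deriv (fun w => ∏ q ∈ Q.level k, E q w) z
        + ∑ q ∈ Q.level k, deriv (fun w => h q w * (1 - E q w)) z)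
    have t2 := norm_add_le (Q.partialSum h E k z * deriv (fun w => ∏ q ∈ Q.level k, E q w) z)
      (∑ q ∈ Q.level k, deriv (fun w => h q w * (1 - E q w)) z)
    have t3 := mul_le_mul_of_nonneg_left (t1.trans (add_le_add le_rfl t2)) hz2.le
    rw [mul_add, mul_add] at t3
    have e5 : gradBound * C * ∑ i ∈ Q.union (Q.level k), gradWeight F z i
        = 6400 * growthBound * C * ∑ i ∈ Q.union (Q.level k), gradWeight F z i
          + 10 ^ 7 * C * ∑ i ∈ Q.union (Q.level k), gradWeight F z i := by
      rw [gradBound]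
      ring
    rw [e5]
    linarith

end Clusters

end DiscFamily

/-! ### Residual estimate and iteration -/

namespace DiscFamily

variable {ι : Type*} {F : DiscFamily ι} {m₀ : ℕ} {K : Type*}

namespace Clusters

variable {Q : F.Clusters K} {a : ι → ℂ} {C : ℝ} {h E : K → ℂ → ℂ}

/-- Close to a point of cluster q, no index of another cluster of at least the same level is near,
so only the small far contributions remain. -/
lemma sum_mass_le_farTail (hF : F.Sparse m₀) (hm₀ : 2800 ≤ m₀) {q : K} {i : ι} (hi : i ∈ Q.cl q)
    {z : ℂ} (hz : ‖z - F.pt i‖ < (1 - F.r i) / 4) {s : Finset K}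
    (hs : ∀ q' ∈ s, q ≠ q' ∧ Q.lev q ≤ Q.lev q') :
    ∑ i ∈ Q.union s, mass F z i ≤ farTail m₀ := by
  have hz1 : ‖z‖ < 1 := by
    have := three_eighths_mul_le hz
    have := scaleBase_pow_pos (400 * F.lev i)
    linarith
  refine hF.sum_far_le (by omega) hz1 fun i' hi' => ?_
  have h1 := hs _ ((Q.mem_union).1 hi')
  exact Q.not_near q _ i i' z h1.1 h1.2 hi (Q.mem_cl_index i') hz

/-- The constant in the estimate of the residual. -/
def residualBound : ℝ := incrementBound + 7812

lemma residualBound_pos : 0 < residualBound := by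
  have := incrementBound_pos
  unfold residualBound
  positivity

open Classical in
-- The subtracted function is the idealised one in which cluster q is the last processed; it takes
-- the prescribed values at the points of q because E_q vanishes there. What is left comes from
-- other clusters of the same level and from later levels. The bound holds on a whole disc around
-- the point, as the Schwarz lemma will require.
lemma norm_residual_le (hF : F.Sparse m₀) (hm₀ : 2800 ≤ m₀)
    (hB : ∀ q, Q.Block q a C (h q) (E q)) (hC : 0 ≤ C) {q : K} {i : ι} (hi : i ∈ Q.cl q) {z : ℂ}
    (hz : ‖z - F.pt i‖ < (1 - F.r i) / 4) {n : ℕ} (hn : Q.lev q < n) :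
    ‖Q.partialSum h E n z - (Q.partialSum h E (Q.lev q) z * ∏ q' ∈ Q.level (Q.lev q), E q' z
      + h q z * (1 - E q z))‖ ≤ residualBound * farTail m₀ * C := by
  have hz1 : ‖z‖ < 1 := by
    have := three_eighths_mul_le hz
    have := scaleBase_pow_pos (400 * F.lev i)
    linarith
  have h1 := norm_partialSum_sub_le hF hm₀ hB hC hn hz1
  have h2 := norm_sum_term_le hB hC ((Q.level (Q.lev q)).erase q) hz1
  have s1 := sum_mass_le_farTail hF hm₀ hi hz (s := Q.levels (Finset.Ico (Q.lev q + 1) n))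
    fun q' hq' => by
      rw [mem_levels, Finset.mem_Ico] at hq'
      exact ⟨fun e => by rw [e] at hq'; omega, by omega⟩
  have s2 := sum_mass_le_farTail hF hm₀ hi hz (s := (Q.level (Q.lev q)).erase q)
    fun q' hq' => by
      rw [Finset.mem_erase, mem_level] at hq'
      exact ⟨hq'.1.symm, hq'.2.ge⟩
  have e : Q.partialSum h E n z - (Q.partialSum h E (Q.lev q) z
      * ∏ q' ∈ Q.level (Q.lev q), E q' z + h q z * (1 - E q z))
      = (Q.partialSum h E n z - Q.partialSum h E (Q.lev q + 1) z)
        + ∑ q' ∈ (Q.level (Q.lev q)).erase q, h q' z * (1 - E q' z) := by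
    have := Finset.add_sum_erase (Q.level (Q.lev q)) (fun q' => h q' z * (1 - E q' z))
      ((Q.mem_level).2 rfl)
    simp only [partialSum]
    rw [← this]
    ring
  rw [e]
  refine (norm_add_le _ _).trans ?_
  have := incrementBound_pos
  have h3 := mul_le_mul_of_nonneg_left s1 (by positivity : 0 ≤ incrementBound * C)
  have h4 := mul_le_mul_of_nonneg_left s2 (by positivity : 0 ≤ 7812 * C)
  rw [residualBound]
  linarith

lemma summable_union_level (hF : F.Sparse m₀) (hm₀ : 2800 ≤ m₀) :
    Summable (fun k => ∑ i ∈ Q.union (Q.level k), F.lev i * scaleBase ^ (399 * F.lev i)) ∧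
    ∑' k, ∑ i ∈ Q.union (Q.level k), F.lev i * scaleBase ^ (399 * F.lev i) ≤ massBound := by
  have h0 : ∀ k, 0 ≤ ∑ i ∈ Q.union (Q.level k), F.lev i * scaleBase ^ (399 * F.lev i) := fun k =>
    Finset.sum_nonneg fun i _ => mul_nonneg (Nat.cast_nonneg _) (scaleBase_pow_pos _).le
  have h1 : ∀ n, ∑ k ∈ Finset.range n, ∑ i ∈ Q.union (Q.level k),
      F.lev i * scaleBase ^ (399 * F.lev i) ≤ massBound := fun n => by
    have := hF.sum_lev_mul_le (by omega) (Q.union (Q.levels (Finset.range n)))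
    rw [sum_union, sum_levels] at this
    simpa only [sum_union] using this
  exact ⟨summable_of_sum_range_le h0 h1, Real.tsum_le_of_sum_range_le h0 h1⟩

lemma sum_mass_le {s : Finset ι} {z : ℂ} (hz : ‖z‖ < 1) :
    ∑ i ∈ s, mass F z i ≤ (∑ i ∈ s, F.lev i * scaleBase ^ (399 * F.lev i)) / (1 - ‖z‖) := by
  rw [Finset.sum_div]
  refine Finset.sum_le_sum fun i _ => ?_
  rw [mul_div_assoc]
  refine mul_le_mul_of_nonneg_left ((min_le_right _ _).trans ?_) (Nat.cast_nonneg _)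
  have := one_sub_norm_le (F := F) i z
  have := scaleBase_pow_pos (399 * F.lev i)
  have : 0 < 1 - ‖z‖ := by linarith
  gcongr

end Clusters

open Clusters Filter Topology

/-- Data for which approximate interpolation is possible. -/
structure Admissible (F : DiscFamily ι) (a : ι → ℂ) (C : ℝ) : Prop where
  nonneg : 0 ≤ C
  lipschitz : ∀ i j, ‖a i - a j‖ ≤ C * hyperbolicDist (F.pt i) (F.pt j)
  norm_le : ∀ i, ‖a i‖ ≤ C * F.lev i

/-- One step of the iteration. Besides being small, the error must again be Lipschitz with a small
constant, so that the construction can be applied to it. -/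
theorem Sparse.exists_approx (hF : F.Sparse m₀) (hm₀ : 2800 ≤ m₀) {a : ι → ℂ} {C : ℝ}
    (ha : F.Admissible a C) : ∃ f : ℂ → ℂ, DifferentiableOn ℂ f (Metric.ball 0 1) ∧
      (∀ z, ‖z‖ < 1 → (1 - ‖z‖ ^ 2) * ‖deriv f z‖ ≤ gradBound * weightBound * C) ∧
      (∀ z, ‖z‖ < 1 → ‖f z‖ ≤ incrementBound * massBound * C / (1 - ‖z‖)) ∧
      (∀ i, ‖a i - f (F.pt i)‖ ≤ residualBound * farTail m₀ * C) ∧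
      ∀ i j, ‖(a i - f (F.pt i)) - (a j - f (F.pt j))‖
        ≤ 18 * (residualBound * farTail m₀ * C) * hyperbolicDist (F.pt i) (F.pt j) := by
  obtain ⟨Q⟩ := hF.exists_clusters (by omega : 800 ≤ m₀)
  have hC := ha.nonneg
  choose h E hB using fun q => Q.exists_block hF hm₀ q hC ha.lipschitz ha.norm_le
  have hI := incrementBound_pos
  have hG : 0 ≤ gradBound := by
    have := growthBound_pos
    unfold gradBound
    positivity
  obtain ⟨hsum, htsum⟩ := Q.summable_union_level hF hm₀
  have hinc : ∀ k z, ‖z‖ < 1 → ‖Q.partialSum h E (k + 1) z - Q.partialSum h E k z‖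
      ≤ incrementBound * C * (∑ i ∈ Q.union (Q.level k), F.lev i * scaleBase ^ (399 * F.lev i))
        / (1 - ‖z‖) := fun k z hz => by
    refine (norm_partialSum_succ_sub_le hF hm₀ hB hC k hz).trans ?_
    rw [mul_div_assoc]
    exact mul_le_mul_of_nonneg_left (sum_mass_le hz) (by positivity)
  obtain ⟨f, hfd, hft, hfB⟩ := exists_limit_of_summable_increments (S := Q.partialSum h E)
    (fun _ => rfl) (differentiableOn_partialSum hB) (hsum.mul_left (incrementBound * C))
    (fun k => mul_nonneg (by positivity) (Finset.sum_nonneg fun i _ =>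
      mul_nonneg (Nat.cast_nonneg _) (scaleBase_pow_pos _).le)) hinc
    (B := gradBound * weightBound * C) fun k z hz => by
      refine (norm_deriv_partialSum_le_sum hF hm₀ hB hC k hz).trans ?_
      have := hF.sum_sideWeight_mul_depthWeight_le (by omega)
        (Q.union (Q.levels (Finset.range k))) hz
      calc _ ≤ gradBound * C * weightBound := mul_le_mul_of_nonneg_left this (by positivity)
        _ = _ := by ring
  have hsize : ∀ z, ‖z‖ < 1 → ‖f z‖ ≤ incrementBound * massBound * C / (1 - ‖z‖) := fun z hz => by
    refine le_of_tendsto (hft z hz).norm (Eventually.of_forall fun n => ?_)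
    have h1 := norm_partialSum_sub_le hF hm₀ hB hC (Nat.zero_le n) hz
    rw [show Q.partialSum h E 0 z = 0 from rfl, sub_zero] at h1
    refine h1.trans ?_
    have h2 := (sum_mass_le (F := F) (s := Q.union (Q.levels (Finset.Ico 0 n))) hz).trans
      (div_le_div_of_nonneg_right (hF.sum_lev_mul_le (by omega) _) (by linarith))
    calc _ ≤ incrementBound * C * (massBound / (1 - ‖z‖)) :=
          mul_le_mul_of_nonneg_left h2 (by positivity)
      _ = _ := by ring
  set ε := residualBound * farTail m₀ * C with hε
  have hlt : ∀ {i z}, ‖z - F.pt i‖ < (1 - F.r i) / 4 → ‖z‖ < 1 := fun {i z} hz => by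
    have := three_eighths_mul_le hz
    have := scaleBase_pow_pos (400 * F.lev i)
    linarith
  -- A holomorphic function extending the error of cluster q: its values at the points of q are f -
  -- a, and it is bounded by ε on discs around them.
  let R := fun q (z : ℂ) => f z - (Q.partialSum h E (Q.lev q) z
    * ∏ q' ∈ Q.level (Q.lev q), E q' z + h q z * (1 - E q z))
  have hR : ∀ q, ∀ i ∈ Q.cl q, ∀ z, ‖z - F.pt i‖ < (1 - F.r i) / 4 → ‖R q z‖ ≤ ε := by
    intro q i hi z hz
    refine le_of_tendsto ((hft z (hlt hz)).sub_const _).norm ?_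
    filter_upwards [eventually_gt_atTop (Q.lev q)] with n hn
    exact norm_residual_le hF hm₀ hB hC hi hz hn
  have hRd : ∀ q z, ‖z‖ < 1 → DifferentiableAt ℂ (R q) z := fun q z hz =>
    (hfd.differentiableAt_of_norm_lt_one hz).fun_sub
      (((differentiableAt_partialSum hB _ hz).fun_mul (differentiableAt_prod_E hB _ hz)).fun_add
        ((hB q).differentiableAt_term hz))
  have hRpt : ∀ q, ∀ i ∈ Q.cl q, R q (F.pt i) = f (F.pt i) - a i := by
    intro q i hi
    have h1 : ∏ q' ∈ Q.level (Q.lev q), E q' (F.pt i) = 0 :=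
      Finset.prod_eq_zero ((Q.mem_level).2 rfl) ((hB q).E_pt i hi)
    simp only [R]
    rw [h1, (hB q).E_pt i hi, (hB q).h_pt i hi]
    ring
  have hcentre : ∀ i, ‖F.pt i - F.pt i‖ < (1 - F.r i) / 4 := fun i => by
    rw [sub_self, norm_zero]
    linarith [F.r_lt_one i]
  have herr : ∀ i, ‖a i - f (F.pt i)‖ ≤ ε := fun i => by
    rw [norm_sub_rev, ← hRpt _ i (Q.mem_cl_index i)]
    exact hR _ i (Q.mem_cl_index i) _ (hcentre i)
  refine ⟨f, hfd, hfB, hsize, herr, fun i j => ?_⟩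
  have hρβ := pseudoHyperbolicDist_le_hyperbolicDist (norm_pt_lt_one (F := F) i)
    (norm_pt_lt_one (F := F) j)
  have hε0 : 0 ≤ ε := (norm_nonneg _).trans (herr i)
  refine le_trans ?_ (mul_le_mul_of_nonneg_left hρβ (by positivity))
  -- For separated points the crude bound 2ε ≤ 18ερ is enough. Close points turn out to lie in one
  -- cluster, where the Schwarz lemma for R applies.
  rcases le_or_gt (1 / 9) (pseudoHyperbolicDist (F.pt i) (F.pt j)) with hρ | hρ
  · have h1 := norm_sub_le (a i - f (F.pt i)) (a j - f (F.pt j))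
    have h2 := herr i
    have h3 := herr j
    nlinarith
  have hij := norm_sub_lt_of_pseudoHyperbolicDist_lt (norm_pt_lt_one i) (norm_pt_lt_one j) hρ
  rw [norm_pt] at hij
  have hji := norm_sub_lt_of_pseudoHyperbolicDist_lt (norm_pt_lt_one j) (norm_pt_lt_one i)
    (by rwa [pseudoHyperbolicDist_comm] at hρ)
  rw [norm_pt] at hji
  have hnear : ∀ i, F.Near (F.pt i) i := fun i => by
    unfold Near
    rw [norm_ζ_sub_pt]
    have h1 := F.one_sub_le i
    have h2 := hF.le_lev i
    have h3 : 4 * scaleBase ^ (400 * F.lev i) ≤ scaleBase ^ (398 * F.lev i) :=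
      four_mul_scaleBase_pow_le (by omega)
    have h4 : scaleBase ^ (400 * F.lev i) < scaleBase ^ (398 * F.lev i) := by
      have := scaleBase_pow_pos (400 * F.lev i)
      linarith
    have h5 := scaleBase_pow_pos (400 * F.lev i)
    refine lt_of_le_of_ne (by linarith) fun e => ?_
    have h6 : scaleBase ^ (400 * F.lev i) * 16 ≤ scaleBase ^ (398 * F.lev i) := by
      have := four_mul_scaleBase_pow_le (a := 398 * F.lev i) (b := 398 * F.lev i + 800) le_rfl
      have := four_mul_scaleBase_pow_le (a := 398 * F.lev i + 800) (b := 400 * F.lev i) (by omega)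
      linarith
    linarith
  -- Each point is near its own index, so if the clusters differed, the disc around the point from
  -- the cluster of lower level would contain a point near an index of the other one.
  have hsame : Q.index i = Q.index j := by
    by_contra hne
    rcases le_total (Q.lev (Q.index i)) (Q.lev (Q.index j)) with hl | hl
    · exact Q.not_near _ _ i j (F.pt j) hne hl (Q.mem_cl_index i) (Q.mem_cl_index j) hji (hnear j)
    · exact Q.not_near _ _ j i (F.pt i) (Ne.symm hne) hl (Q.mem_cl_index j) (Q.mem_cl_index i) hij
        (hnear i)
  have hjq := (Q.mem_cl j _).2 hsame.symm
  have hiq := Q.mem_cl_index i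
  set q := Q.index i
  have hsch := Complex.dist_le_div_mul_dist_of_mapsTo_ball (f := R q) (c := F.pt j)
    (R₁ := (1 - F.r j) / 4) (R₂ := 2 * ε) (z := F.pt i)
    (fun z hz => (hRd q z (hlt (by rwa [← dist_eq_norm]))).differentiableWithinAt)
    (fun z hz => by
      rw [Metric.mem_closedBall, dist_eq_norm]
      have h1 := hR q j hjq z (by rwa [← dist_eq_norm])
      have h2 := hR q j hjq _ (hcentre j)
      have h3 := norm_sub_le (R q z) (R q (F.pt j))
      linarith) (by rwa [Metric.mem_ball, dist_eq_norm])
  rw [dist_eq_norm, dist_eq_norm, hRpt q i hiq, hRpt q j hjq] at hsch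
  have hd := norm_sub_le_of_norm_sub_lt (norm_pt_lt_one i) (norm_pt_lt_one j)
    (by rwa [norm_pt] : ‖F.pt i - F.pt j‖ < (1 - ‖F.pt j‖) / 4)
  rw [norm_pt] at hd
  have hδ : 0 < 1 - F.r j := by linarith [F.r_lt_one j]
  have e : a i - f (F.pt i) - (a j - f (F.pt j)) = -(f (F.pt i) - a i - (f (F.pt j) - a j)) := by
    ring
  rw [e, norm_neg]
  refine hsch.trans ?_
  calc 2 * ε / ((1 - F.r j) / 4) * ‖F.pt i - F.pt j‖
      ≤ 2 * ε / ((1 - F.r j) / 4)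
        * (9 / 4 * (1 - F.r j) * pseudoHyperbolicDist (F.pt i) (F.pt j)) := by gcongr
    _ = _ := by field_simp; ring

/-- Sparse families of high level are interpolating. -/
theorem exists_forall_sparse_interpolating : ∃ m₀ : ℕ, 2800 ≤ m₀ ∧
    ∀ (ι : Type) (F : DiscFamily ι), F.Sparse m₀ → ∀ (a : ι → ℂ) (C : ℝ), F.Admissible a C →
      ∃ f : ℂ → ℂ, IsBloch f ∧ ∀ i, f (F.pt i) = a i := by
  -- Once this is below 1, the Lipschitz constant 18εC of the error is at most C/2.
  have hlim : Tendsto (fun m => 36 * (residualBound * farTail m)) atTop (𝓝 0) := by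
    simpa using (tendsto_farTail.const_mul residualBound).const_mul 36
  obtain ⟨m₀, hm, hm₀⟩ := ((hlim.eventually_lt_const one_pos).and
    (eventually_ge_atTop 2800)).exists
  refine ⟨m₀, hm₀, fun ι F hF a C ha => ?_⟩
  set ε := residualBound * farTail m₀ with hε
  have hε0 : 0 ≤ ε := mul_nonneg residualBound_pos.le (farTail_nonneg _)
  let X := {p : (ι → ℂ) × ℝ // F.Admissible p.1 p.2}
  choose g hgd hgB hgs hg0 hg1 using fun p : X => hF.exists_approx hm₀ p.2
  let step : X → X := fun p => ⟨(fun i => p.1.1 i - g p (F.pt i), p.1.2 / 2), by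
    have h0 := p.2.nonneg
    have hc : 18 * (ε * p.1.2) ≤ p.1.2 / 2 := by nlinarith
    refine ⟨by positivity, fun i j => (hg1 p i j).trans ?_, fun i => (hg0 p i).trans ?_⟩
    · exact mul_le_mul_of_nonneg_right hc
        (hyperbolicDist_nonneg (norm_pt_lt_one i) (norm_pt_lt_one j))
    · have h1 : (1 : ℝ) ≤ F.lev i := by
        exact_mod_cast (by have := hF.le_lev i; omega : 1 ≤ F.lev i)
      nlinarith⟩
  let x : ℕ → X := fun n => step^[n] ⟨(a, C), ha⟩
  have hx : ∀ n, x (n + 1) = step (x n) := fun n => Function.iterate_succ_apply' step n _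
  have hxC : ∀ n, (x n).1.2 = C * (1 / 2) ^ n := by
    intro n
    induction n with
    | zero => simp [x]
    | succ n ih =>
      rw [hx, pow_succ, ← mul_assoc, ← ih]
      simp only [step]
      ring
  let S : ℕ → ℂ → ℂ := fun n z => ∑ k ∈ Finset.range n, g (x k) z
  have hSd : ∀ n z, ‖z‖ < 1 → DifferentiableAt ℂ (S n) z := fun n z hz =>
    DifferentiableAt.fun_sum fun k _ => (hgd (x k)).differentiableAt_of_norm_lt_one hz
  have hgeom : ∀ n, ∑ k ∈ Finset.range n, (1 / 2 : ℝ) ^ k ≤ 2 := fun n => by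
    refine (Summable.sum_le_tsum _ (fun _ _ => by positivity) summable_geometric_two).trans ?_
    rw [tsum_geometric_two]
  have hC := ha.nonneg
  have hI := incrementBound_pos
  have hM : 0 ≤ massBound := tsum_nonneg fun m => by
    have := scaleBase_pow_pos m
    positivity
  have hGW : 0 ≤ gradBound * weightBound := by
    have h1 := growthBound_pos
    have h2 := farTail_nonneg 0
    have h3 : 0 ≤ ∑' m : ℕ, 3 * scaleBase ^ (10 * m) := tsum_nonneg fun m => by
      have := scaleBase_pow_pos (10 * m)
      positivity
    unfold gradBound weightBound
    positivity
  obtain ⟨f, hfd, hft, hfB⟩ := exists_limit_of_summable_increments (S := S)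
    (fun _ => rfl) (fun n z hz => (hSd n z (mem_ball_zero_iff.1 hz)).differentiableWithinAt)
    (v := fun n => incrementBound * massBound * (C * (1 / 2) ^ n))
    ((summable_geometric_two.mul_left C).mul_left _) (fun n => by positivity)
    (fun n z hz => by
      have := hgs (x n) z hz
      rw [hxC] at this
      simpa only [S, Finset.sum_range_succ, add_sub_cancel_left] using this)
    (B := gradBound * weightBound * (C * 2)) fun n z hz => by
      have h1 : deriv (S n) z = ∑ k ∈ Finset.range n, deriv (g (x k)) z :=
        deriv_fun_sum fun k _ => (hgd (x k)).differentiableAt_of_norm_lt_one hz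
      rw [h1]
      refine (mul_le_mul_of_nonneg_left (norm_sum_le _ _) (one_sub_norm_sq_pos hz).le).trans ?_
      rw [Finset.mul_sum]
      refine (Finset.sum_le_sum fun k _ => hgB (x k) z hz).trans ?_
      simp only [hxC]
      rw [← Finset.mul_sum, ← Finset.mul_sum]
      exact mul_le_mul_of_nonneg_left (mul_le_mul_of_nonneg_left (hgeom n) hC) hGW
  refine ⟨f, ⟨hfd, ⟨gradBound * weightBound * (C * 2), ?_⟩⟩, fun i => ?_⟩
  · rintro _ ⟨z, hz, rfl⟩
    exact hfB z (mem_ball_zero_iff.1 hz)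
  · have hval : ∀ n, S n (F.pt i) = a i - (x n).1.1 i := by
      intro n
      induction n with
      | zero => simp [S, x]
      | succ n ih =>
        have e : S (n + 1) (F.pt i) = S n (F.pt i) + g (x n) (F.pt i) := Finset.sum_range_succ _ _
        rw [e, ih, hx]
        simp only [step]
        ring
    have h0 : Tendsto (fun n => (x n).1.1 i) atTop (𝓝 0) := by
      refine squeeze_zero_norm (a := fun n => C * (1 / 2) ^ n * F.lev i) (fun n => ?_) ?_
      · have := (x n).2.norm_le i
        rwa [hxC] at this
      · have := ((tendsto_pow_atTop_nhds_zero_of_lt_one (r := (1 / 2 : ℝ)) (by norm_num)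
          (by norm_num)).const_mul C).mul_const (F.lev i : ℝ)
        simpa using this
    have h1 : Tendsto (fun n => S n (F.pt i)) atTop (𝓝 (a i)) := by
      simp only [hval]
      simpa using h0.const_sub (a i)
    exact tendsto_nhds_unique (hft _ (norm_pt_lt_one i)) h1

end DiscFamily

/-! ### From families to sets, and adding finitely many points -/

/-- The set version of Bloch interpolation. -/
def IsBlochInterpolatingSet (S : Set ℂ) : Prop :=
  ∀ a : ℂ → ℂ, (∃ C : ℝ, ∀ p ∈ S, ∀ q ∈ S, ‖a p - a q‖ ≤ C * hyperbolicDist p q) →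
    ∃ f : ℂ → ℂ, IsBloch f ∧ ∀ p ∈ S, f p = a p

lemma hyperbolicDist_self (z : ℂ) : hyperbolicDist z z = 0 := by
  simp [hyperbolicDist, pseudoHyperbolicDist_self]

/-- Repetitions in the sequence are harmless: admissible data agree at indices with the same point,
since the distance is 0 there. -/
lemma IsBlochInterpolatingSet.isBlochInterpolating {z : ℕ → ℂ}
    (h : IsBlochInterpolatingSet (Set.range z)) : IsBlochInterpolating z := by
  rintro a ⟨C, hC⟩
  have hinj : ∀ n m, z n = z m → a n = a m := fun n m e => by
    have := hC n m
    rw [e, hyperbolicDist_self, mul_zero] at this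
    exact sub_eq_zero.1 (norm_le_zero_iff.1 this)
  have hinv : ∀ n, z (Function.invFun z (z n)) = z n := fun n => Function.invFun_eq ⟨n, rfl⟩
  obtain ⟨f, hf, hfa⟩ := h (fun p => a (Function.invFun z p)) ⟨C, by
    rintro _ ⟨n, rfl⟩ _ ⟨m, rfl⟩
    have := hC (Function.invFun z (z n)) (Function.invFun z (z m))
    rwa [hinv, hinv] at this⟩
  exact ⟨f, hf, fun n => (hfa _ ⟨n, rfl⟩).trans (hinj _ _ (Function.invFun_eq ⟨n, rfl⟩))⟩

lemma IsBloch.add_const_mul {f g : ℂ → ℂ} (hf : IsBloch f) (hg : IsBloch g) (c : ℂ) :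
    IsBloch fun z => f z + c * g z := by
  obtain ⟨M, hM⟩ := hf.bounded
  obtain ⟨N, hN⟩ := hg.bounded
  refine ⟨hf.holomorphic.add (hg.holomorphic.const_mul c), ⟨M + ‖c‖ * N, ?_⟩⟩
  rintro _ ⟨z, hz, rfl⟩
  have h1 := hM ⟨z, hz, rfl⟩
  have h2 := hN ⟨z, hz, rfl⟩
  have hz1 := mem_ball_zero_iff.1 hz
  have hfd := hf.holomorphic.differentiableAt_of_norm_lt_one hz1
  have hgd := hg.holomorphic.differentiableAt_of_norm_lt_one hz1
  have hz2 := one_sub_norm_sq_pos hz1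
  simp only at h1 h2 ⊢
  rw [deriv_fun_add hfd (hgd.const_mul c), deriv_const_mul c hgd]
  have h3 := norm_add_le (deriv f z) (c * deriv g z)
  rw [norm_mul] at h3
  have h4 := mul_le_mul_of_nonneg_left h3 hz2.le
  have h5 := mul_le_mul_of_nonneg_left h2 (norm_nonneg c)
  linarith

/-- Much weaker than the logarithmic growth of Bloch functions, but all that is needed to multiply
by a linear factor. -/
lemma IsBloch.norm_le {f : ℂ → ℂ} (hf : IsBloch f) :
    ∃ M : ℝ, ∀ z, ‖z‖ < 1 → (1 - ‖z‖ ^ 2) * ‖f z‖ ≤ M := by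
  obtain ⟨M, hM⟩ := hf.bounded
  refine ⟨‖f 0‖ + M, fun z hz => ?_⟩
  have hz2 := one_sub_norm_sq_pos hz
  have hM0 : 0 ≤ M := le_trans (by simp) (hM ⟨0, by simp, rfl⟩)
  have h1 : ‖f z - f 0‖ ≤ M / (1 - ‖z‖ ^ 2) * ‖z - 0‖ := by
    refine (convex_closedBall (0 : ℂ) ‖z‖).norm_image_sub_le_of_norm_deriv_le (𝕜 := ℂ) (f := f)
      (fun w hw => ?_) (fun w hw => ?_) (by simp) (by simp)
    · rw [mem_closedBall_zero_iff] at hw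
      exact hf.holomorphic.differentiableAt_of_norm_lt_one (hw.trans_lt hz)
    · rw [mem_closedBall_zero_iff] at hw
      have h2 := hM ⟨w, mem_ball_zero_iff.2 (hw.trans_lt hz), rfl⟩
      simp only at h2
      rw [le_div_iff₀ hz2]
      have h3 : ‖w‖ ^ 2 ≤ ‖z‖ ^ 2 := by gcongr
      have := norm_nonneg (deriv f w)
      nlinarith
  rw [sub_zero] at h1
  have h2 : ‖f z‖ ≤ ‖f 0‖ + M / (1 - ‖z‖ ^ 2) := by
    have h3 := norm_sub_norm_le (f z) (f 0)
    have h4 : M / (1 - ‖z‖ ^ 2) * ‖z‖ ≤ M / (1 - ‖z‖ ^ 2) :=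
      mul_le_of_le_one_right (by positivity) hz.le
    linarith
  have h3 := mul_le_mul_of_nonneg_left h2 hz2.le
  rw [mul_add, mul_div_cancel₀ _ hz2.ne'] at h3
  have h4 : (1 - ‖z‖ ^ 2) * ‖f 0‖ ≤ ‖f 0‖ :=
    mul_le_of_le_one_left (norm_nonneg _) (by nlinarith [norm_nonneg z])
  linarith

lemma IsBloch.sub_mul_sub_one {f : ℂ → ℂ} (hf : IsBloch f) {p : ℂ} (hp : ‖p‖ < 1) :
    IsBloch fun z => (z - p) * f z - 1 := by
  obtain ⟨M, hM⟩ := hf.bounded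
  obtain ⟨N, hN⟩ := hf.norm_le
  refine ⟨((differentiableOn_id.sub_const p).mul hf.holomorphic).sub_const 1, ⟨N + 2 * M, ?_⟩⟩
  rintro _ ⟨z, hz, rfl⟩
  have h1 := hM ⟨z, hz, rfl⟩
  have hz1 := mem_ball_zero_iff.1 hz
  have h2 := hN z hz1
  have hfd := hf.holomorphic.differentiableAt_of_norm_lt_one hz1
  have hz2 := one_sub_norm_sq_pos hz1
  simp only at h1 ⊢
  rw [deriv_sub_const, deriv_fun_mul (by fun_prop) hfd, deriv_sub_const, deriv_id'', one_mul]
  have h3 := norm_add_le (f z) ((z - p) * deriv f z)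
  rw [norm_mul] at h3
  have h4 : ‖z - p‖ ≤ 2 := by linarith [norm_sub_le z p]
  have h5 : ‖z - p‖ * ‖deriv f z‖ ≤ 2 * ‖deriv f z‖ := by gcongr
  have h6 := mul_le_mul_of_nonneg_left (h3.trans (add_le_add le_rfl h5)) hz2.le
  linarith

/-- A point can be added to an interpolating set. -/
lemma IsBlochInterpolatingSet.insert {S : Set ℂ} (h : IsBlochInterpolatingSet S)
    (hS : ∀ z ∈ S, ‖z‖ < 1) (hfin : ∀ R < 1, (S ∩ Metric.closedBall 0 R).Finite) {p : ℂ}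
    (hp : ‖p‖ < 1) (hpS : p ∉ S) : IsBlochInterpolatingSet (insert p S) := by
  rintro a ⟨C, hC⟩
  obtain ⟨ε, hε, hd⟩ : ∃ ε > 0, ∀ z ∈ S, ε ≤ ‖z - p‖ := by
    have hR : (1 + ‖p‖) / 2 < 1 := by linarith
    have hcl := (hfin _ hR).isClosed
    obtain ⟨ε, hε, hb⟩ := Metric.isOpen_iff.1 hcl.isOpen_compl p fun hmem => hpS hmem.1
    refine ⟨min ε ((1 - ‖p‖) / 2), lt_min hε (by linarith), fun z hz => ?_⟩
    by_contra hcon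
    push Not at hcon
    refine hb (show z ∈ Metric.ball p ε from ?_) ⟨hz, ?_⟩
    · rw [Metric.mem_ball, dist_eq_norm]
      exact hcon.trans_le (min_le_left _ _)
    · rw [mem_closedBall_zero_iff]
      have h1 := hcon.trans_le (min_le_right _ _)
      have h2 := norm_sub_norm_le z p
      linarith
  have hne : ∀ z ∈ S, z - p ≠ 0 := fun z hz e => hpS (sub_eq_zero.1 e ▸ hz)
  obtain ⟨f, hf, hfa⟩ := h a ⟨C, fun z hz w hw =>
    hC z (Set.mem_insert_of_mem _ hz) w (Set.mem_insert_of_mem _ hw)⟩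
  -- Since S keeps a distance ε from p, the values 1/(z - p) are Lipschitz data. With G
  -- interpolating them, (z - p)G - 1 vanishes on S and equals -1 at p.
  obtain ⟨G, hG, hGa⟩ := h (fun z => (z - p)⁻¹) ⟨2 / ε ^ 2, fun z hz w hw => by
    have e : (z - p)⁻¹ - (w - p)⁻¹ = (w - z) / ((z - p) * (w - p)) := by
      have := hne z hz
      have := hne w hw
      field_simp
      ring
    have h1 := norm_sub_le_two_mul_pseudoHyperbolicDist (hS w hw) (hS z hz)
    have h2 := pseudoHyperbolicDist_le_hyperbolicDist (hS w hw) (hS z hz)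
    rw [e, norm_div, norm_mul, hyperbolicDist_comm]
    have h3 := hd z hz
    have h4 := hd w hw
    have h5 := hyperbolicDist_nonneg (hS w hw) (hS z hz)
    calc ‖w - z‖ / (‖z - p‖ * ‖w - p‖) ≤ (2 * hyperbolicDist w z) / (ε * ε) := by
          gcongr
          linarith
      _ = _ := by ring⟩
  refine ⟨_, hf.add_const_mul (hG.sub_mul_sub_one hp) (f p - a p), ?_⟩
  rintro z (rfl | hz)
  · simp
  · rw [hGa z hz, mul_inv_cancel₀ (hne z hz), hfa z hz]
    simp

lemma IsBlochInterpolatingSet.union_finite {S T : Set ℂ} (hT : T.Finite)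
    (h : IsBlochInterpolatingSet S) (hS : ∀ z ∈ S, ‖z‖ < 1)
    (hfin : ∀ R < 1, (S ∩ Metric.closedBall 0 R).Finite) (hT1 : ∀ z ∈ T, ‖z‖ < 1) :
    IsBlochInterpolatingSet (T ∪ S) := by
  induction T, hT using Set.Finite.induction_on with
  | empty => rwa [Set.empty_union]
  | @insert p T hp hTf ih =>
    have ih' := ih fun z hz => hT1 z (Set.mem_insert_of_mem _ hz)
    rw [Set.insert_union]
    by_cases hpS : p ∈ T ∪ S
    · rwa [Set.insert_eq_of_mem hpS]
    refine ih'.insert ?_ (fun R hR => ?_) (hT1 p (Set.mem_insert _ _)) hpS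
    · rintro z (hz | hz)
      exacts [hT1 z (Set.mem_insert_of_mem _ hz), hS z hz]
    · rw [Set.union_inter_distrib_right]
      exact (hTf.inter_of_left _).union (hfin R hR)

namespace DiscFamily

variable {ι : Type*} {F : DiscFamily ι}

lemma hyperbolicDist_zero_le {i : ι} (hi : 1 ≤ F.lev i) :
    hyperbolicDist (F.pt i) 0 ≤ 2 * F.lev i := by
  have h1 := hyperbolicDist_le_neg_log (norm_pt_lt_one (F := F) i) (w := 0) (by simp)
  have h2 : pseudoHyperbolicDist (F.pt i) 0 = F.r i := by
    simp [pseudoHyperbolicDist, norm_pt]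
  have h3 := F.le_one_sub i
  rw [h2] at h1
  have h4 : (1 / 2 : ℝ) ^ (F.lev i + 1) ≤ 1 - F.r i := by
    rw [pow_succ, ← scaleBase_pow_400_mul]
    linarith
  have h5 := Real.log_le_log (by positivity) h4
  rw [Real.log_pow, one_div, Real.log_inv] at h5
  have h6 := Real.log_two_lt_d9
  have h7 : (1 : ℝ) ≤ F.lev i := by exact_mod_cast hi
  push_cast at h5
  nlinarith

lemma finite_range_inter_closedBall {R : ℝ} (hR : R < 1) :
    (Set.range F.pt ∩ Metric.closedBall 0 R).Finite := by
  obtain ⟨m, hm⟩ := exists_pow_lt_of_lt_one (sub_pos.2 hR) (by norm_num : (1 / 2 : ℝ) < 1)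
  refine (((Set.finite_Iio m).biUnion fun k _ => F.finite_lev k).image F.pt).subset ?_
  rintro _ ⟨⟨i, rfl⟩, hi⟩
  refine ⟨i, ?_, rfl⟩
  simp only [Set.mem_iUnion, Set.mem_Iio, Set.mem_ofPred_eq, exists_prop, exists_eq_right']
  rw [mem_closedBall_zero_iff, norm_pt] at hi
  have h1 := F.one_sub_le i
  rw [scaleBase_pow_400_mul] at h1
  by_contra hcon
  push Not at hcon
  have := pow_le_pow_of_le_one (by norm_num : (0 : ℝ) ≤ 1 / 2) (by norm_num) hcon
  linarith

/-- Subtracting the value at a base point makes the data grow at most linearly in the level, because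
the hyperbolic distance from 0 to a point does. This supplies the size condition of admissibility.
-/
theorem exists_forall_sparse_isBlochInterpolatingSet : ∃ m₀ : ℕ, 1 ≤ m₀ ∧
    ∀ (ι : Type) (F : DiscFamily ι), F.Sparse m₀ → IsBlochInterpolatingSet (Set.range F.pt) := by
  obtain ⟨m₀, hm₀, H⟩ := exists_forall_sparse_interpolating
  refine ⟨m₀, by omega, fun ι F hF a ⟨C, hC⟩ => ?_⟩
  rcases isEmpty_or_nonempty ι with hι | ⟨⟨j⟩⟩
  · obtain ⟨f, hf, -⟩ := H ι F hF (fun _ => 0) 0 ⟨le_rfl, fun i => (IsEmpty.false i).elim,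
      fun i => (IsEmpty.false i).elim⟩
    refine ⟨f, hf, ?_⟩
    rintro _ ⟨i, _⟩
    exact (IsEmpty.false i).elim
  have hC' : ∀ i k, ‖a (F.pt i) - a (F.pt k)‖ ≤ max C 0 * hyperbolicDist (F.pt i) (F.pt k) :=
    fun i k => (hC _ ⟨i, rfl⟩ _ ⟨k, rfl⟩).trans (mul_le_mul_of_nonneg_right (le_max_left _ _)
      (hyperbolicDist_nonneg (norm_pt_lt_one i) (norm_pt_lt_one k)))
  have hM : 0 ≤ max C 0 := le_max_right _ _
  have hl : ∀ i, 1 ≤ F.lev i := fun i => by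
    have := hF.le_lev i
    omega
  have hadm : F.Admissible (fun i => a (F.pt i) - a (F.pt j)) (max C 0 * (2 + 2 * F.lev j)) := by
    refine ⟨by positivity, fun i k => ?_, fun i => ?_⟩
    · rw [sub_sub_sub_cancel_right]
      refine (hC' i k).trans ?_
      refine mul_le_mul_of_nonneg_right ?_
        (hyperbolicDist_nonneg (norm_pt_lt_one (F := F) i) (norm_pt_lt_one (F := F) k))
      have : (0 : ℝ) ≤ F.lev j := Nat.cast_nonneg _
      nlinarith
    · refine (hC' i j).trans ?_
      have h1 := hyperbolicDist_triangle (norm_pt_lt_one (F := F) i) (u := 0) (by simp)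
        (norm_pt_lt_one (F := F) j)
      have h2 := hyperbolicDist_zero_le (hl i)
      have h3 := hyperbolicDist_zero_le (hl j)
      rw [hyperbolicDist_comm] at h3
      have h4 : (1 : ℝ) ≤ F.lev i := by exact_mod_cast hl i
      have h5 : (0 : ℝ) ≤ F.lev j := Nat.cast_nonneg _
      rw [mul_assoc]
      refine mul_le_mul_of_nonneg_left ?_ hM
      nlinarith
  obtain ⟨f, hf, hfa⟩ := H ι F hF _ _ hadm
  have hconst : IsBloch fun _ => (1 : ℂ) := ⟨differentiableOn_const _, ⟨0, by
    rintro _ ⟨z, _, rfl⟩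
    simp⟩⟩
  refine ⟨_, hf.add_const_mul hconst (a (F.pt j)), ?_⟩
  rintro _ ⟨i, rfl⟩
  simp [hfa i]

end DiscFamily

/-! ### Random points on the circle -/

/-- The point `exp (2 π i t)` of the unit circle. -/
def circlePoint (t : ℝ) : ℂ := Complex.exp (2 * Real.pi * Complex.I * t)

lemma circlePoint_eq (t : ℝ) :
    circlePoint t = Complex.exp ((2 * Real.pi * t : ℝ) * Complex.I) := by
  rw [circlePoint]
  congr 1
  push_cast
  ring

lemma norm_circlePoint (t : ℝ) : ‖circlePoint t‖ = 1 := by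
  rw [circlePoint_eq, Complex.norm_exp_ofReal_mul_I]

lemma continuous_circlePoint : Continuous circlePoint := by
  unfold circlePoint
  fun_prop

lemma norm_circlePoint_sub (t u : ℝ) :
    ‖circlePoint t - circlePoint u‖ = 2 * |Real.sin (Real.pi * (t - u))| := by
  have e : circlePoint t - circlePoint u
      = circlePoint u * (Complex.exp (Complex.I * (2 * Real.pi * (t - u) : ℝ)) - 1) := by
    rw [mul_sub, mul_one, circlePoint, circlePoint, ← Complex.exp_add]
    congr 2
    push_cast
    ring
  rw [e, norm_mul, norm_circlePoint, one_mul, Complex.norm_exp_I_mul_ofReal_sub_one, norm_mul,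
    Real.norm_eq_abs, Real.norm_eq_abs, abs_two]
  congr 3
  ring

lemma norm_circlePoint_sub_le (t u : ℝ) : ‖circlePoint t - circlePoint u‖ ≤ 7 * |t - u| := by
  rw [norm_circlePoint_sub]
  have h1 := Real.abs_sin_le_abs (x := Real.pi * (t - u))
  rw [abs_mul, abs_of_pos Real.pi_pos] at h1
  have h2 := Real.pi_lt_d2
  have := abs_nonneg (t - u)
  nlinarith

lemma two_mul_abs_le_abs_sin {v : ℝ} (hv : |v| ≤ 1 / 2) : 2 * |v| ≤ |Real.sin (Real.pi * v)| := by
  have hπ := Real.pi_pos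
  have h1 := Real.mul_le_sin (x := Real.pi * |v|) (by positivity) (by nlinarith)
  have h2 : 2 / Real.pi * (Real.pi * |v|) = 2 * |v| := by field_simp
  rw [h2] at h1
  refine h1.trans ?_
  rcases abs_cases v with ⟨h, _⟩ | ⟨h, _⟩
  · rw [h]
    exact le_abs_self _
  · rw [h, mul_neg, Real.sin_neg]
    exact neg_le_abs _

/-- By Jordan's inequality a chord of length at most s means a parameter distance at most s/4 modulo
1. Wrapping around costs three intervals, of total length 3s/2. -/
lemma volume_circlePoint_near_le {c : ℝ} (hc : c ∈ Set.Ico (0 : ℝ) 1) (s : ℝ) :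
    volume ({t | ‖circlePoint t - circlePoint c‖ ≤ s} ∩ Set.Ico 0 1) ≤ ENNReal.ofReal (2 * s) := by
  rcases lt_or_ge s 0 with hs | hs
  · have : {t | ‖circlePoint t - circlePoint c‖ ≤ s} = ∅ := by
      ext t
      simp only [Set.mem_ofPred_eq, Set.mem_empty_iff_false, iff_false, not_le]
      exact hs.trans_le (norm_nonneg _)
    simp [this]
  have hsub : {t | ‖circlePoint t - circlePoint c‖ ≤ s} ∩ Set.Ico 0 1 ⊆
      Metric.closedBall c (s / 4) ∪ Metric.closedBall (c + 1) (s / 4)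
        ∪ Metric.closedBall (c - 1) (s / 4) := by
    rintro t ⟨ht, ht0, ht1⟩
    obtain ⟨hc0, hc1⟩ := hc
    rw [Set.mem_ofPred_eq, norm_circlePoint_sub] at ht
    have key : ∀ v : ℝ, |v| ≤ 1 / 2 → |Real.sin (Real.pi * v)| = |Real.sin (Real.pi * (t - c))| →
        |v| ≤ s / 4 := fun v hv e => by
      have := two_mul_abs_le_abs_sin hv
      rw [e] at this
      linarith
    simp only [Set.mem_union, Metric.mem_closedBall, Real.dist_eq]
    rcases le_or_gt (t - c) (1 / 2) with h1 | h1
    · rcases le_or_gt (-(1 / 2)) (t - c) with h2 | h2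
      · exact Or.inl (Or.inl (key _ (abs_le.2 ⟨h2, h1⟩) rfl))
      · refine Or.inr (key _ (abs_le.2 ⟨by linarith, by linarith⟩) ?_)
        rw [show Real.pi * (t - (c - 1)) = Real.pi * (t - c) + Real.pi by ring, Real.sin_add_pi,
          abs_neg]
    · refine Or.inl (Or.inr (key _ (abs_le.2 ⟨by linarith, by linarith⟩) ?_))
      rw [show Real.pi * (t - (c + 1)) = Real.pi * (t - c) - Real.pi by ring, Real.sin_sub_pi,
        abs_neg]
  refine (measure_mono hsub).trans ((measure_union_le _ _).trans
    ((add_le_add (measure_union_le _ _) le_rfl).trans ?_))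
  simp only [Real.volume_closedBall]
  rw [← ENNReal.ofReal_add (by positivity) (by positivity),
    ← ENNReal.ofReal_add (by positivity) (by positivity)]
  exact ENNReal.ofReal_le_ofReal (by linarith)

section Random

variable {Ω : Type*} [MeasurableSpace Ω] {P : Measure Ω} {θ : ℕ → Ω → ℝ}

lemma measure_preimage_of_uniform (hlaw : ∀ n, HasLaw (θ n) (volume.restrict (Set.Ico (0 : ℝ) 1)) P)
    (n : ℕ) {A : Set ℝ} (hA : MeasurableSet A) :
    P (θ n ⁻¹' A) = volume (A ∩ Set.Ico 0 1) := by
  rw [← Measure.map_apply_of_aemeasurable (hlaw n).aemeasurable hA, (hlaw n).map_eq,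
    Measure.restrict_apply hA]

lemma ae_mem_Ico_of_uniform (hlaw : ∀ n, HasLaw (θ n) (volume.restrict (Set.Ico (0 : ℝ) 1)) P)
    (n : ℕ) : ∀ᵐ ω ∂P, θ n ω ∈ Set.Ico (0 : ℝ) 1 := by
  have h := measure_preimage_of_uniform hlaw n (measurableSet_Ico (a := (0 : ℝ)) (b := 1)).compl
  rw [Set.compl_inter_self, measure_empty] at h
  exact measure_eq_zero_iff_ae_notMem.1 h |>.mono fun ω hω => by simpa using hω

/-- The probability that finitely many independent uniform points are all close to another one. -/
lemma measure_star_le (hlaw : ∀ n, HasLaw (θ n) (volume.restrict (Set.Ico (0 : ℝ) 1)) P)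
    (hindep : iIndepFun θ P) {x : ℕ} {J : Finset ℕ} (hx : x ∉ J) {s : ℝ} (hs : 0 < s) :
    P {ω | ∀ j ∈ J, ‖circlePoint (θ j ω) - circlePoint (θ x ω)‖ ≤ s}
      ≤ ENNReal.ofReal (4 * s) ^ J.card := by
  classical
  -- Cells of length 1/K move the circle point by at most s. Replacing the centre by the left
  -- endpoint of its cell, at the price of the radius 2s, turns the event into a finite union of
  -- product events, so no conditioning is needed.
  set K := ⌈7 / s⌉₊ with hK
  have hK0 : 0 < K := Nat.ceil_pos.2 (by positivity)
  have hK0' : (0 : ℝ) < K := by exact_mod_cast hK0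
  have hKs : 7 / (K : ℝ) ≤ s := by
    rw [div_le_iff₀ hK0', ← div_le_iff₀' hs]
    exact Nat.le_ceil _
  let A : ℕ → ℕ → Set ℝ := fun k i => if i = x then Set.Ico (k / K : ℝ) ((k + 1) / K)
    else {t | ‖circlePoint t - circlePoint (k / K)‖ ≤ 2 * s}
  have hA : ∀ k i, MeasurableSet (A k i) := fun k i => by
    by_cases h : i = x
    · simp only [A, h, if_true]
      exact measurableSet_Ico
    · simp only [A, h, if_false]
      exact (isClosed_le (continuous_circlePoint.sub continuous_const).norm
        continuous_const).measurableSet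
  have hsub : {ω | ∀ j ∈ J, ‖circlePoint (θ j ω) - circlePoint (θ x ω)‖ ≤ s} ≤ᵐ[P]
      ⋃ k ∈ Finset.range K, ⋂ i ∈ insert x J, θ i ⁻¹' A k i := by
    filter_upwards [ae_mem_Ico_of_uniform hlaw x] with ω hω hJ
    change ω ∈ ⋃ k ∈ Finset.range K, ⋂ i ∈ insert x J, θ i ⁻¹' A k i
    have hJ' : ∀ j ∈ J, ‖circlePoint (θ j ω) - circlePoint (θ x ω)‖ ≤ s := hJ
    have hfl : (⌊θ x ω * K⌋₊ : ℝ) ≤ θ x ω * K := Nat.floor_le (mul_nonneg hω.1 hK0'.le)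
    have hfl' : θ x ω * K < ⌊θ x ω * K⌋₊ + 1 := Nat.lt_floor_add_one _
    have hin : θ x ω ∈ Set.Ico ((⌊θ x ω * K⌋₊ : ℝ) / K) ((⌊θ x ω * K⌋₊ + 1) / K) :=
      ⟨by rwa [div_le_iff₀ hK0'], by rwa [lt_div_iff₀ hK0']⟩
    simp only [Set.mem_iUnion, Finset.mem_range, Set.mem_iInter, Set.mem_preimage, exists_prop]
    refine ⟨⌊θ x ω * K⌋₊, ?_, fun i hi => ?_⟩
    · have : (⌊θ x ω * K⌋₊ : ℝ) < K := by
        have := hω.2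
        nlinarith
      exact_mod_cast this
    · by_cases h : i = x
      · simp only [A, h, if_true]
        exact hin
      · simp only [A, h, if_false, Set.mem_ofPred_eq]
        have hiJ : i ∈ J := (Finset.mem_insert.1 hi).resolve_left h
        have h1 := norm_circlePoint_sub_le (θ x ω) ((⌊θ x ω * K⌋₊ : ℝ) / K)
        have h2 : |θ x ω - (⌊θ x ω * K⌋₊ : ℝ) / K| ≤ 1 / K := by
          rw [abs_of_nonneg (by linarith [hin.1])]
          have := hin.2
          rw [add_div] at this
          linarith
        have h3 : 7 * (1 / (K : ℝ)) ≤ s := by rw [← mul_div_assoc, mul_one]; exact hKs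
        have h4 := norm_sub_le_norm_sub_add_norm_sub (circlePoint (θ i ω)) (circlePoint (θ x ω))
          (circlePoint ((⌊θ x ω * K⌋₊ : ℝ) / K))
        have h5 := hJ' i hiJ
        linarith
  -- Probability at most 1/K for the centre and at most 4s for every other point; the factor 1/K
  -- cancels the number of cells.
  have hterm : ∀ k ∈ Finset.range K, P (⋂ i ∈ insert x J, θ i ⁻¹' A k i)
      ≤ ENNReal.ofReal (1 / K) * ENNReal.ofReal (4 * s) ^ J.card := by
    intro k hk
    rw [hindep.measure_inter_preimage_eq_mul (insert x J) fun i _ => hA k i,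
      Finset.prod_insert hx, ← Finset.prod_const]
    refine mul_le_mul' ?_ (Finset.prod_le_prod' fun j hj => ?_)
    · rw [measure_preimage_of_uniform hlaw x (hA k x)]
      refine (measure_mono Set.inter_subset_left).trans ?_
      simp only [A, if_true, Real.volume_Ico]
      refine ENNReal.ofReal_le_ofReal (le_of_eq ?_)
      ring
    · have hjx : j ≠ x := fun h => hx (h ▸ hj)
      rw [measure_preimage_of_uniform hlaw j (hA k j)]
      simp only [A, hjx, if_false]
      have hk' : (k : ℝ) < K := by exact_mod_cast Finset.mem_range.1 hk
      refine (volume_circlePoint_near_le ⟨by positivity, by rwa [div_lt_one hK0']⟩ _).trans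
        (le_of_eq ?_)
      congr 1
      ring
  calc _ ≤ P (⋃ k ∈ Finset.range K, ⋂ i ∈ insert x J, θ i ⁻¹' A k i) := measure_mono_ae hsub
    _ ≤ ∑ k ∈ Finset.range K, P (⋂ i ∈ insert x J, θ i ⁻¹' A k i) :=
      measure_biUnion_finset_le _ _
    _ ≤ ∑ k ∈ Finset.range K, ENNReal.ofReal (1 / K) * ENNReal.ofReal (4 * s) ^ J.card :=
      Finset.sum_le_sum hterm
    _ = _ := by
      rw [Finset.sum_const, Finset.card_range, nsmul_eq_mul, ← mul_assoc, ← ENNReal.ofReal_natCast,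
        ← ENNReal.ofReal_mul hK0'.le, mul_one_div_cancel hK0'.ne', ENNReal.ofReal_one, one_mul]

/-- The event that some point with index in `A` has `d` others with indices in `B` close to it. -/
def starEvent (θ : ℕ → Ω → ℝ) (A B : Finset ℕ) (d : ℕ) (s : ℝ) : Set Ω :=
  {ω | ∃ x ∈ A, ∃ J ⊆ B, J.card = d ∧ x ∉ J ∧
    ∀ j ∈ J, ‖circlePoint (θ j ω) - circlePoint (θ x ω)‖ ≤ s}

lemma measure_starEvent_le (hlaw : ∀ n, HasLaw (θ n) (volume.restrict (Set.Ico (0 : ℝ) 1)) P)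
    (hindep : iIndepFun θ P) (A B : Finset ℕ) (d : ℕ) {s : ℝ} (hs : 0 < s) :
    P (starEvent θ A B d s) ≤ ENNReal.ofReal (A.card * (B.card * (4 * s)) ^ d) := by
  classical
  have hsub : starEvent θ A B d s ⊆ ⋃ x ∈ A, ⋃ J ∈ (B.powersetCard d).filter (fun J => x ∉ J),
      {ω | ∀ j ∈ J, ‖circlePoint (θ j ω) - circlePoint (θ x ω)‖ ≤ s} := by
    rintro ω ⟨x, hx, J, hJ, hJd, hxJ, h⟩
    simp only [Set.mem_iUnion, exists_prop]
    exact ⟨x, hx, J, Finset.mem_filter.2 ⟨Finset.mem_powersetCard.2 ⟨hJ, hJd⟩, hxJ⟩, h⟩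
  have hx : ∀ x ∈ A, P (⋃ J ∈ (B.powersetCard d).filter (fun J => x ∉ J),
      {ω | ∀ j ∈ J, ‖circlePoint (θ j ω) - circlePoint (θ x ω)‖ ≤ s})
      ≤ (B.card : ℝ≥0∞) ^ d * ENNReal.ofReal (4 * s) ^ d := by
    intro x _
    refine (measure_biUnion_finset_le _ _).trans ?_
    calc _ ≤ ∑ J ∈ (B.powersetCard d).filter (fun J => x ∉ J), ENNReal.ofReal (4 * s) ^ d := by
          refine Finset.sum_le_sum fun J hJ => ?_
          obtain ⟨h1, h2⟩ := Finset.mem_filter.1 hJ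
          rw [← (Finset.mem_powersetCard.1 h1).2]
          exact measure_star_le hlaw hindep h2 hs
      _ = ((B.powersetCard d).filter (fun J => x ∉ J)).card * ENNReal.ofReal (4 * s) ^ d := by
          rw [Finset.sum_const, nsmul_eq_mul]
      _ ≤ _ := by
          gcongr
          have h1 := Finset.card_filter_le (B.powersetCard d) (fun J => x ∉ J)
          rw [Finset.card_powersetCard] at h1
          exact_mod_cast h1.trans (Nat.choose_le_pow _ _)
  refine (measure_mono hsub).trans ((measure_biUnion_finset_le _ _).trans
    ((Finset.sum_le_sum hx).trans (le_of_eq ?_)))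
  rw [Finset.sum_const, nsmul_eq_mul, ENNReal.ofReal_mul (p := (A.card : ℝ)) (by positivity),
    ENNReal.ofReal_pow (by positivity), ENNReal.ofReal_mul (p := (B.card : ℝ)) (by positivity),
    ENNReal.ofReal_natCast, ENNReal.ofReal_natCast, mul_pow]

end Random

/-! ### Levels of random points -/

lemma mem_dyadicAnnulus_ofReal {x : ℝ} (hx : 0 ≤ x) {m : ℕ} :
    (x : ℂ) ∈ dyadicAnnulus m ↔ (1 / 2 : ℝ) ^ m / 2 ≤ 1 - x ∧ 1 - x < (1 / 2) ^ m := by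
  rw [dyadicAnnulus, Set.mem_ofPred_eq, Complex.norm_real, Real.norm_of_nonneg hx, one_div,
    inv_pow, pow_succ, mul_inv, div_eq_mul_inv]

lemma exists_mem_dyadicAnnulus {x : ℝ} (hx : 0 < x) (hx1 : x < 1) :
    ∃ m, (x : ℂ) ∈ dyadicAnnulus m := by
  classical
  have hex : ∃ m : ℕ, (1 / 2 : ℝ) ^ m / 2 ≤ 1 - x := by
    obtain ⟨m, hm⟩ := exists_pow_lt_of_lt_one (sub_pos.2 hx1) (by norm_num : (1 / 2 : ℝ) < 1)
    refine ⟨m, ?_⟩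
    have : (0 : ℝ) < (1 / 2) ^ m := by positivity
    linarith
  refine ⟨Nat.find hex, (mem_dyadicAnnulus_ofReal hx.le).2 ⟨Nat.find_spec hex, ?_⟩⟩
  rcases h : Nat.find hex with - | k
  · simpa using hx
  · have := Nat.find_min hex (m := k) (by omega)
    rw [not_le] at this
    rw [pow_succ]
    linarith

/-- If a point is close to another one then their levels and directions are close. -/
lemma level_and_direction_close {x x' : ℝ} {ζ ζ' : ℂ} (hζ : ‖ζ‖ = 1) (hζ' : ‖ζ'‖ = 1) (hx : 0 ≤ x)
    (hx' : 0 ≤ x') {m m' : ℕ} (hm : 1 ≤ m) (h : (x : ℂ) ∈ dyadicAnnulus m)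
    (h' : (x' : ℂ) ∈ dyadicAnnulus m') (hd : ‖x' * ζ' - x * ζ‖ < (1 - x) / 4) :
    m ≤ m' + 1 ∧ m' ≤ m + 1 ∧ ‖ζ' - ζ‖ ≤ (1 / 2) ^ m := by
  rw [mem_dyadicAnnulus_ofReal hx] at h
  rw [mem_dyadicAnnulus_ofReal hx'] at h'
  have n1 : ‖(x : ℂ) * ζ‖ = x := by
    rw [norm_mul, hζ, mul_one, Complex.norm_real, Real.norm_of_nonneg hx]
  have n2 : ‖(x' : ℂ) * ζ'‖ = x' := by
    rw [norm_mul, hζ', mul_one, Complex.norm_real, Real.norm_of_nonneg hx']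
  have h1 := norm_sub_norm_le ((x : ℂ) * ζ) (x' * ζ')
  have h2 := norm_sub_norm_le ((x' : ℂ) * ζ') (x * ζ)
  rw [norm_sub_rev, n1, n2] at h1
  rw [n1, n2] at h2
  have hlt : ∀ {i j : ℕ}, (1 / 2 : ℝ) ^ i < (1 / 2) ^ j → j < i := fun {i j} hij =>
    (pow_lt_pow_iff_right_of_lt_one₀ (by norm_num) (by norm_num)).1 hij
  have p1 : (0 : ℝ) < (1 / 2) ^ m := by positivity
  have p2 : (0 : ℝ) < (1 / 2) ^ m' := by positivity
  have a1 : m < m' + 2 := hlt (by rw [pow_add]; linarith)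
  have a2 : m' < m + 2 := hlt (by rw [pow_add]; linarith)
  refine ⟨by omega, by omega, ?_⟩
  have h3 : (1 / 2 : ℝ) ^ m ≤ 1 / 2 := by
    simpa using pow_le_pow_of_le_one (by norm_num : (0 : ℝ) ≤ 1 / 2) (by norm_num) hm
  have h4 : x * ‖ζ' - ζ‖ ≤ |x - x'| + ‖x' * ζ' - x * ζ‖ := by
    have e : (x : ℂ) * (ζ' - ζ) = ((x - x' : ℝ) : ℂ) * ζ' + (x' * ζ' - x * ζ) := by
      push_cast
      ring
    have n3 : ‖(x : ℂ) * (ζ' - ζ)‖ = x * ‖ζ' - ζ‖ := by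
      rw [norm_mul, Complex.norm_real, Real.norm_of_nonneg hx]
    rw [← n3, e]
    refine (norm_add_le _ _).trans (add_le_add (le_of_eq ?_) le_rfl)
    rw [norm_mul, hζ', mul_one, Complex.norm_real, Real.norm_eq_abs]
  have h5 : |x - x'| ≤ (1 - x) / 4 := abs_le.2 ⟨by linarith, by linarith⟩
  have := norm_nonneg (ζ' - ζ)
  nlinarith

/-- Bounded terms already give N_m = O(2^(2m/3)), and 267/400 is just above 2/3. -/
lemma card_mul_scaleBase_pow_le {N : ℕ → ℕ} (hsum : Summable fun m => (N m : ℝ) ^ 3 / 4 ^ m) :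
    ∃ C : ℝ, 0 ≤ C ∧ ∀ j, N j * scaleBase ^ (267 * j) ≤ C := by
  set T := ∑' m, (N m : ℝ) ^ 3 / 4 ^ m with hT
  have hT0 : 0 ≤ T := tsum_nonneg fun _ => by positivity
  refine ⟨1 + T, by positivity, fun j => ?_⟩
  have h1 : (N j : ℝ) ^ 3 / 4 ^ j ≤ T := hsum.le_tsum j fun _ _ => by positivity
  have hb := scaleBase_pow_pos (267 * j)
  refine le_of_pow_le_pow_left₀ (n := 3) (by norm_num) (by positivity) ?_
  have h2 : (scaleBase ^ (267 * j)) ^ 3 ≤ (1 / 4) ^ j := by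
    rw [← pow_mul]
    refine (scaleBase_pow_le (show 400 * (2 * j) ≤ 267 * j * 3 by omega)).trans (le_of_eq ?_)
    rw [scaleBase_pow_400_mul, pow_mul]
    norm_num
  calc ((N j : ℝ) * scaleBase ^ (267 * j)) ^ 3 = (N j : ℝ) ^ 3 * (scaleBase ^ (267 * j)) ^ 3 :=
        mul_pow _ _ _
    _ ≤ (N j : ℝ) ^ 3 * (1 / 4) ^ j := by gcongr
    _ = (N j : ℝ) ^ 3 / 4 ^ j := by rw [one_div, inv_pow, div_eq_mul_inv]
    _ ≤ T := h1
    _ ≤ (1 + T) ^ 3 := by nlinarith [sq_nonneg T, mul_nonneg hT0 (sq_nonneg T)]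

/-! ### Almost sure interpolation when the series converges -/

section Random

variable {Ω : Type*} [MeasurableSpace Ω] {P : Measure Ω} {θ : ℕ → Ω → ℝ}

lemma ae_eventually_notMem_of_le {s : ℕ → Set Ω} {g : ℕ → ℝ} (hg : Summable g)
    (h : ∀ m, P (s m) ≤ ENNReal.ofReal (g m)) : ∀ᵐ ω ∂P, ∀ᶠ m in Filter.atTop, ω ∉ s m :=
  ae_eventually_notMem (ne_top_of_le_ne_top hg.tsum_ofReal_ne_top (ENNReal.tsum_le_tsum h))

/-- Borel-Cantelli with the centre at level m and three satellites at levels at most m. Up to a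
cubic polynomial in m, the probability is at most the power 3 · 372 - 4 · 267 = 48 of `scaleBase ^
m`, hence summable. -/
lemma ae_eventually_notMem_star_three
    (hlaw : ∀ n, HasLaw (θ n) (volume.restrict (Set.Ico (0 : ℝ) 1)) P) (hindep : iIndepFun θ P)
    {I : ℕ → Finset ℕ} (hsum : Summable fun m => ((I m).card : ℝ) ^ 3 / 4 ^ m) :
    ∀ᵐ ω ∂P, ∀ᶠ m in Filter.atTop,
      ω ∉ starEvent θ (I m) ((Finset.range (m + 1)).biUnion I) 3 (scaleBase ^ (372 * m)) := by
  obtain ⟨C, hC, hN⟩ := card_mul_scaleBase_pow_le hsum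
  refine ae_eventually_notMem_of_le (g := fun m => 64 * C ^ 4 / scaleBase
    * (((m + 1 : ℕ) : ℝ) ^ 3 * scaleBase ^ (m + 1))) (Summable.mul_left _
      ((summable_nat_add_iff 1).2 (DiscFamily.summable_pow_mul_scaleBase 3))) fun m => ?_
  refine (measure_starEvent_le hlaw hindep _ _ _ (scaleBase_pow_pos _)).trans
    (ENNReal.ofReal_le_ofReal ?_)
  set B := (Finset.range (m + 1)).biUnion I
  have hb := scaleBase_pow_pos (267 * m)
  have hB : B.card * scaleBase ^ (267 * m) ≤ (m + 1 : ℕ) * C := by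
    have h1 : (B.card : ℝ) ≤ ∑ j ∈ Finset.range (m + 1), ((I j).card : ℝ) := by
      exact_mod_cast Finset.card_biUnion_le
    calc B.card * scaleBase ^ (267 * m)
        ≤ (∑ j ∈ Finset.range (m + 1), ((I j).card : ℝ)) * scaleBase ^ (267 * m) := by gcongr
      _ = ∑ j ∈ Finset.range (m + 1), (I j).card * scaleBase ^ (267 * m) := Finset.sum_mul _ _ _
      _ ≤ ∑ j ∈ Finset.range (m + 1), C := by
        refine Finset.sum_le_sum fun j hj => le_trans ?_ (hN j)
        have := Finset.mem_range.1 hj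
        exact mul_le_mul_of_nonneg_left (scaleBase_pow_le (by omega)) (Nat.cast_nonneg _)
      _ = _ := by rw [Finset.sum_const, Finset.card_range, nsmul_eq_mul]
  have h48 : scaleBase ^ (48 * m) ≤ scaleBase ^ m := scaleBase_pow_le (by omega)
  have hbm := scaleBase_pow_pos m
  have hb0 := scaleBase_pos
  calc ((I m).card : ℝ) * (B.card * (4 * scaleBase ^ (372 * m))) ^ 3
      = 64 * ((I m).card * scaleBase ^ (267 * m)) * (B.card * scaleBase ^ (267 * m)) ^ 3
          * scaleBase ^ (48 * m) := by
        have e : (scaleBase ^ (372 * m)) ^ 3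
            = scaleBase ^ (267 * m) * (scaleBase ^ (267 * m)) ^ 3 * scaleBase ^ (48 * m) := by
          rw [← pow_mul, ← pow_mul, ← pow_add, ← pow_add]
          congr 1
          ring
        rw [mul_pow, mul_pow, mul_pow, e]
        ring
    _ ≤ 64 * C * ((m + 1 : ℕ) * C) ^ 3 * scaleBase ^ m := by
        gcongr
        exact hN m
    _ = _ := by
        rw [pow_succ scaleBase m]
        field_simp

/-- A centre and two satellites at scale 2^(-m) have expected number O(N³ 4^(-m)), with N the count
in three adjacent annuli. This is where the exact hypothesis is used, with no room to spare. -/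
lemma ae_eventually_notMem_star_two
    (hlaw : ∀ n, HasLaw (θ n) (volume.restrict (Set.Ico (0 : ℝ) 1)) P) (hindep : iIndepFun θ P)
    {I : ℕ → Finset ℕ} (hsum : Summable fun m => ((I m).card : ℝ) ^ 3 / 4 ^ m) :
    ∀ᵐ ω ∂P, ∀ᶠ m in Filter.atTop,
      ω ∉ starEvent θ (I (m + 1)) (I m ∪ I (m + 1) ∪ I (m + 2)) 2 ((1 / 2) ^ (m + 1)) := by
  have s1 := (summable_nat_add_iff 1).2 hsum
  have s2 := (summable_nat_add_iff 2).2 hsum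
  refine ae_eventually_notMem_of_le (((hsum.mul_left (36 : ℝ)).add (s1.mul_left 144)).add
    (s2.mul_left 576)) fun m => ?_
  refine (measure_starEvent_le hlaw hindep _ _ _ (by positivity)).trans
    (ENNReal.ofReal_le_ofReal ?_)
  have hB : ((I m ∪ I (m + 1) ∪ I (m + 2)).card : ℝ)
      ≤ (I m).card + (I (m + 1)).card + (I (m + 2)).card := by
    exact_mod_cast (Finset.card_union_le _ _).trans
      (Nat.add_le_add_right (Finset.card_union_le _ _) _)
  set x : ℝ := ((I m).card : ℝ)
  set y : ℝ := ((I (m + 1)).card : ℝ)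
  set z : ℝ := ((I (m + 2)).card : ℝ)
  have hx : 0 ≤ x := Nat.cast_nonneg _
  have hy : 0 ≤ y := Nat.cast_nonneg _
  have hz : 0 ≤ z := Nat.cast_nonneg _
  have key : y * (x + y + z) ^ 2 ≤ 9 * (x ^ 3 + y ^ 3 + z ^ 3) := by
    have h1 : y * (x + y + z) ^ 2 ≤ (x + y + z) ^ 3 := by
      rw [pow_succ' (x + y + z) 2]
      gcongr
      linarith
    nlinarith [mul_nonneg (add_nonneg hx hy) (sq_nonneg (x - y)),
      mul_nonneg (add_nonneg hy hz) (sq_nonneg (y - z)),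
      mul_nonneg (add_nonneg hx hz) (sq_nonneg (x - z)),
      mul_nonneg hz (sq_nonneg (x - y)), mul_nonneg hx (sq_nonneg (y - z)),
      mul_nonneg hy (sq_nonneg (x - z))]
  have hp : (0 : ℝ) < 4 ^ m := by positivity
  have e4 : ((1 / 2 : ℝ) ^ (m + 1)) ^ 2 = 1 / (4 * 4 ^ m) := by
    rw [← pow_mul, mul_comm (m + 1) 2, pow_mul, show (1 / 2 : ℝ) ^ 2 = 4⁻¹ by norm_num, inv_pow,
      pow_succ, one_div, mul_comm]
  calc y * ((I m ∪ I (m + 1) ∪ I (m + 2)).card * (4 * (1 / 2) ^ (m + 1))) ^ 2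
      ≤ y * ((x + y + z) * (4 * (1 / 2) ^ (m + 1))) ^ 2 := by gcongr
    _ = 4 * (y * (x + y + z) ^ 2) / 4 ^ m := by
        rw [mul_pow, mul_pow, e4]
        field_simp
    _ ≤ 4 * (9 * (x ^ 3 + y ^ 3 + z ^ 3)) / 4 ^ m := by gcongr
    _ = _ := by
        rw [pow_add, pow_add]
        field_simp
        ring

theorem ae_isBlochInterpolating {r : ℕ → ℝ} (hr : ∀ n, r n ∈ Set.Ico (0 : ℝ) 1)
    (hlaw : ∀ n, HasLaw (θ n) (volume.restrict (Set.Ico (0 : ℝ) 1)) P) (hindep : iIndepFun θ P)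
    {I : ℕ → Finset ℕ} (hI : ∀ m n, n ∈ I m ↔ (r n : ℂ) ∈ dyadicAnnulus m)
    (hsum : Summable fun m => ((I m).card : ℝ) ^ 3 / 4 ^ m) :
    ∀ᵐ ω ∂P, IsBlochInterpolating (randomPoint r θ ω) := by
  classical
  obtain ⟨m₀, hm₀, H⟩ := DiscFamily.exists_forall_sparse_isBlochInterpolatingSet
  -- A zero radius lies in no annulus, since 1 - 0 < 1 fails; its level is a dummy and such indices
  -- are left out of the family.
  have hL : ∀ n, ∃ m, 0 < r n → (r n : ℂ) ∈ dyadicAnnulus m := fun n => by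
    by_cases h : 0 < r n
    · obtain ⟨m, hm⟩ := exists_mem_dyadicAnnulus h (hr n).2
      exact ⟨m, fun _ => hm⟩
    · exact ⟨0, fun h' => (h h').elim⟩
  choose L hL using hL
  filter_upwards [ae_eventually_notMem_star_three hlaw hindep hsum,
    ae_eventually_notMem_star_two hlaw hindep hsum] with ω h3 h2
  obtain ⟨M₁, h3⟩ := Filter.eventually_atTop.1 h3
  obtain ⟨M₂, h2⟩ := Filter.eventually_atTop.1 h2
  set M := max m₀ (max M₁ (M₂ + 1)) with hM
  have hm₀M : m₀ ≤ M := le_max_left _ _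
  have hM₁ : M₁ ≤ M := (le_max_left _ _).trans (le_max_right _ _)
  have hM₂ : M₂ + 1 ≤ M := (le_max_right _ _).trans (le_max_right _ _)
  let S := {n : ℕ // 0 < r n ∧ M ≤ L n}
  have hlev : ∀ i : S, (1 / 2 : ℝ) ^ L i / 2 ≤ 1 - r i ∧ 1 - r i < (1 / 2) ^ L i := fun i =>
    (mem_dyadicAnnulus_ofReal (hr i).1).1 (hL i i.2.1)
  let F : DiscFamily S :=
    { r := fun i => r i
      ζ := fun i => circlePoint (θ i ω)
      lev := fun i => L i
      r_nonneg := fun i => (hr i).1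
      norm_ζ := fun i => norm_circlePoint _
      le_one_sub := fun i => by
        rw [scaleBase_pow_400_mul]
        exact (hlev i).1
      one_sub_le := fun i => by
        rw [scaleBase_pow_400_mul]
        exact (hlev i).2.le
      finite_lev := fun m => by
        refine ((I m).finite_toSet.preimage Subtype.val_injective.injOn).subset fun i hi => ?_
        exact (hI m i).2 (hi ▸ hL i i.2.1) }
  have hpt : ∀ i : S, F.pt i = randomPoint r θ ω i := fun i => rfl
  have hF : F.Sparse m₀ := by
    refine ⟨fun i => hm₀M.trans i.2.2, fun s hs => ?_, fun i j k hij hjk hik hj hk => ?_⟩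
    · by_contra hcard
      push Not at hcard
      -- The highest of four wide neighbours serves as centre, so the other three have levels at
      -- most that of x and lie within the finer of the two wide radii.
      obtain ⟨x, hx, hmax⟩ := Finset.exists_max_image s F.lev (Finset.card_pos.1 (by omega))
      obtain ⟨J, hJ, hJ3⟩ := Finset.exists_subset_card_eq (s := s.erase x) (n := 3)
        (by rw [Finset.card_erase_of_mem hx]; omega)
      have hJs : ∀ j ∈ J, j ≠ x ∧ j ∈ s := fun j hj => Finset.mem_erase.1 (hJ hj)
      refine h3 (L x) (hM₁.trans x.2.2) ⟨x, (hI _ _).2 (hL x x.2.1),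
        J.map (Function.Embedding.subtype _), fun j hj => ?_, by rw [Finset.card_map, hJ3], ?_, ?_⟩
      · obtain ⟨i, hi, rfl⟩ := Finset.mem_map.1 hj
        refine Finset.mem_biUnion.2 ⟨L i, Finset.mem_range.2 ?_, (hI _ _).2 (hL i i.2.1)⟩
        exact Nat.lt_succ_of_le (hmax i (hJs i hi).2)
      · intro hmem
        obtain ⟨i, hi, e⟩ := Finset.mem_map.1 hmem
        exact (hJs i hi).1 (Subtype.ext e)
      · intro j hj
        obtain ⟨i, hi, rfl⟩ := Finset.mem_map.1 hj
        exact (hs i (hJs i hi).2 x hx).2.2.2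
    · have hLi : 1 ≤ L i := by have := i.2.2; omega
      have key : ∀ j : S, ‖F.pt j - F.pt i‖ < (1 - F.r i) / 4 → L i ≤ L j + 1 ∧ L j ≤ L i + 1 ∧
          ‖circlePoint (θ j ω) - circlePoint (θ i ω)‖ ≤ (1 / 2) ^ L i := fun j hj =>
        level_and_direction_close (norm_circlePoint _) (norm_circlePoint _) (hr i).1 (hr j).1 hLi
          (hL i i.2.1) (hL j j.2.1) hj
      obtain ⟨m, hm⟩ : ∃ m, L i = m + 1 := ⟨L i - 1, by omega⟩
      have hmem : ∀ j : S, L i ≤ L j + 1 → L j ≤ L i + 1 →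
          (j : ℕ) ∈ I m ∪ I (m + 1) ∪ I (m + 2) := fun j h1 h2 => by
        have hj := (hI _ _).2 (hL j j.2.1)
        have : L j = m ∨ L j = m + 1 ∨ L j = m + 2 := by omega
        simp only [Finset.mem_union]
        rcases this with h | h | h <;> rw [h] at hj
        exacts [Or.inl (Or.inl hj), Or.inl (Or.inr hj), Or.inr hj]
      obtain ⟨j1, j2, j3⟩ := key j hj
      obtain ⟨k1, k2, k3⟩ := key k hk
      have hne : ∀ {a b : S}, a ≠ b → (a : ℕ) ≠ b := fun h e => h (Subtype.ext e)
      refine h2 m (by have := i.2.2; omega) ⟨i, (hI _ _).2 (hm ▸ hL i i.2.1), {(j : ℕ), (k : ℕ)},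
        ?_, Finset.card_pair (hne hjk), ?_, ?_⟩
      · intro n hn
        rcases Finset.mem_insert.1 hn with rfl | hn
        · exact hmem j j1 j2
        · rw [Finset.mem_singleton.1 hn]
          exact hmem k k1 k2
      · simp [hne hij, hne hik]
      · intro n hn
        rw [← hm]
        rcases Finset.mem_insert.1 hn with rfl | hn
        · exact j3
        · rw [Finset.mem_singleton.1 hn]
          exact k3
  have hrange : Set.range F.pt ⊆ Set.range (randomPoint r θ ω) := by
    rintro _ ⟨i, rfl⟩
    exact ⟨i, (hpt i).symm⟩
  have hnorm : ∀ n, ‖randomPoint r θ ω n‖ < 1 := fun n => by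
    change ‖(r n : ℂ) * circlePoint (θ n ω)‖ < 1
    rw [norm_mul, norm_circlePoint, mul_one, Complex.norm_real, Real.norm_of_nonneg (hr n).1]
    exact (hr n).2
  -- Finite as a set of points: even infinitely many zero radii all give the single point 0.
  have hfin : (Set.range (randomPoint r θ ω) \ Set.range F.pt).Finite := by
    refine ((((Finset.range M).biUnion I).finite_toSet.image (randomPoint r θ ω)).union
      (Set.finite_singleton 0)).subset ?_
    rintro _ ⟨⟨n, rfl⟩, hn⟩
    by_cases h0 : 0 < r n
    · left
      refine ⟨n, Finset.mem_coe.2 (Finset.mem_biUnion.2 ⟨L n, Finset.mem_range.2 ?_,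
        (hI _ _).2 (hL n h0)⟩), rfl⟩
      by_contra hcon
      exact hn ⟨⟨n, h0, not_lt.1 hcon⟩, rfl⟩
    · right
      have : r n = 0 := le_antisymm (not_lt.1 h0) (hr n).1
      simp [randomPoint, this]
  have := (H S F hF).union_finite hfin
    (by rintro _ ⟨i, rfl⟩; exact DiscFamily.norm_pt_lt_one i)
    (fun R hR => DiscFamily.finite_range_inter_closedBall hR)
    (by rintro _ ⟨⟨n, rfl⟩, -⟩; exact hnorm n)
  rw [Set.sdiff_union_of_subset hrange] at this
  exact this.isBlochInterpolating

end Random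

/-! ### The second moment method -/

lemma biInter_union_eq {α Ω : Type*} [DecidableEq α] (U U' : Finset α) (A : α → Set Ω) :
    ⋂ n ∈ U ∪ U', A n = (⋂ n ∈ U, A n) ∩ ⋂ n ∈ U', A n := by
  ext ω
  simp only [Finset.mem_union, Set.mem_iInter, Set.mem_inter_iff, or_imp, forall_and]

/-- The event that all the variables with index in `U` lie in `B`. -/
def jointEvent {Ω : Type*} (θ : ℕ → Ω → ℝ) (U : Finset ℕ) (B : Set ℝ) : Set Ω := ⋂ n ∈ U, θ n ⁻¹' B

lemma jointEvent_inter_jointEvent {Ω : Type*} {θ : ℕ → Ω → ℝ} {U U' : Finset ℕ} {B : Set ℝ} :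
    jointEvent θ U B ∩ jointEvent θ U' B = jointEvent θ (U ∪ U') B := by
  classical
  exact (biInter_union_eq U U' _).symm

section Random

variable {Ω : Type*} [MeasurableSpace Ω] {P : Measure Ω} {θ : ℕ → Ω → ℝ}

/-- The second moment method for events most pairs of which are not positively correlated. -/
lemma measureReal_inter_compl_mul_sum_le [IsProbabilityMeasure P] {κ : Type*} {S : Finset κ}
    {E : κ → Set Ω} (hE : ∀ e, NullMeasurableSet (E e) P) {dep : κ → κ → Prop}
    [DecidableRel dep] {K : ℝ} (hK : 0 ≤ K)
    (h1 : ∀ e ∈ S, ∀ e' ∈ S, ¬ dep e e' → P.real (E e ∩ E e') ≤ P.real (E e) * P.real (E e'))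
    (h2 : ∀ e ∈ S, ∑ e' ∈ S.filter (dep e), P.real (E e ∩ E e') ≤ K * P.real (E e)) :
    P.real (⋂ e ∈ S, (E e)ᶜ) * ∑ e ∈ S, P.real (E e) ≤ K := by
  classical
  set μ := ∑ e ∈ S, P.real (E e) with hμ
  have hμ0 : 0 ≤ μ := Finset.sum_nonneg fun _ _ => measureReal_nonneg
  rcases hμ0.eq_or_lt with h0 | hpos
  · rw [← h0, mul_zero]
    exact hK
  have hint : ∀ A : Set Ω, NullMeasurableSet A P → Integrable (A.indicator fun _ => (1 : ℝ)) P :=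
    fun A hA => (integrable_const 1).indicator₀ hA
  have hval : ∀ A : Set Ω, NullMeasurableSet A P →
      ∫ ω, A.indicator (fun _ => (1 : ℝ)) ω ∂P = P.real A := fun A hA => by
    rw [integral_indicator₀ hA, setIntegral_const, smul_eq_mul, mul_one]
  set N := ⋂ e ∈ S, (E e)ᶜ with hN
  have hNm : NullMeasurableSet N P := Finset.nullMeasurableSet_biInter S fun e _ => (hE e).compl
  let X : Ω → ℝ := fun ω => ∑ e ∈ S, (E e).indicator (fun _ => 1) ω
  have hX : Integrable X P := integrable_finsetSum _ fun e _ => hint _ (hE e)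
  have hXX : ∀ ω, (X ω - μ) ^ 2 = (∑ e ∈ S, ∑ e' ∈ S, (E e ∩ E e').indicator (fun _ => 1) ω)
      - 2 * μ * X ω + μ ^ 2 := by
    intro ω
    have : X ω * X ω = ∑ e ∈ S, ∑ e' ∈ S, (E e ∩ E e').indicator (fun _ => 1) ω := by
      simp only [X]
      rw [Finset.sum_mul_sum]
      refine Finset.sum_congr rfl fun e _ => Finset.sum_congr rfl fun e' _ => ?_
      rw [← Set.inter_indicator_mul]
      simp
    rw [← this]
    ring
  have hI2 : Integrable (fun ω => ∑ e ∈ S, ∑ e' ∈ S, (E e ∩ E e').indicator (fun _ => (1 : ℝ)) ω)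
      P := integrable_finsetSum _ fun e _ => integrable_finsetSum _ fun e' _ =>
    hint _ ((hE e).inter (hE e'))
  have hXval : ∫ ω, X ω ∂P = μ := by
    rw [integral_finsetSum _ fun e _ => hint _ (hE e)]
    exact Finset.sum_congr rfl fun e _ => hval _ (hE e)
  have hI2val : ∫ ω, ∑ e ∈ S, ∑ e' ∈ S, (E e ∩ E e').indicator (fun _ => (1 : ℝ)) ω ∂P
      = ∑ e ∈ S, ∑ e' ∈ S, P.real (E e ∩ E e') := by
    rw [integral_finsetSum _ fun e _ => integrable_finsetSum _ fun e' _ =>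
      hint _ ((hE e).inter (hE e'))]
    refine Finset.sum_congr rfl fun e _ => ?_
    rw [integral_finsetSum _ fun e' _ => hint _ ((hE e).inter (hE e'))]
    exact Finset.sum_congr rfl fun e' _ => hval _ ((hE e).inter (hE e'))
  have hsq : ∫ ω, (X ω - μ) ^ 2 ∂P = (∑ e ∈ S, ∑ e' ∈ S, P.real (E e ∩ E e')) - μ ^ 2 := by
    have hI3 : Integrable (fun ω => (∑ e ∈ S, ∑ e' ∈ S,
        (E e ∩ E e').indicator (fun _ => (1 : ℝ)) ω) - 2 * μ * X ω) P := hI2.sub (hX.const_mul _)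
    simp only [hXX]
    rw [integral_add hI3 (integrable_const _),
      integral_sub hI2 (hX.const_mul _), integral_const_mul, hXval, hI2val, integral_const]
    simp
    ring
  -- Dependent pairs contribute at most Kμ and the others at most μ², so the variance of the
  -- counting variable X is at most Kμ.
  have hle : ∑ e ∈ S, ∑ e' ∈ S, P.real (E e ∩ E e') ≤ K * μ + μ ^ 2 := by
    have : ∀ e ∈ S, ∑ e' ∈ S, P.real (E e ∩ E e') ≤ K * P.real (E e) + P.real (E e) * μ := by
      intro e he
      rw [← Finset.sum_filter_add_sum_filter_not S (dep e)]
      refine add_le_add (h2 e he) ?_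
      refine (Finset.sum_le_sum fun e' he' => h1 e he e' (Finset.mem_filter.1 he').1
        (Finset.mem_filter.1 he').2).trans ?_
      rw [← Finset.mul_sum]
      refine mul_le_mul_of_nonneg_left ?_ measureReal_nonneg
      exact Finset.sum_le_sum_of_subset_of_nonneg (Finset.filter_subset _ _)
        fun _ _ _ => measureReal_nonneg
    refine (Finset.sum_le_sum this).trans (le_of_eq ?_)
    rw [Finset.sum_add_distrib, ← Finset.mul_sum, ← Finset.sum_mul, sq]
  -- Chebyshev: on N no event occurs, so X = 0 and (X - μ)² = μ².
  have hlow : P.real N * μ ^ 2 ≤ ∫ ω, (X ω - μ) ^ 2 ∂P := by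
    have e : P.real N * μ ^ 2 = ∫ ω, N.indicator (fun _ => (1 : ℝ)) ω * μ ^ 2 ∂P := by
      rw [integral_mul_const, hval _ hNm]
    rw [e]
    refine integral_mono ((hint _ hNm).mul_const _) ?_ fun ω => ?_
    · have := ((hI2.sub (hX.const_mul (2 * μ))).add (integrable_const (μ ^ 2)))
      refine this.congr (Filter.Eventually.of_forall fun ω => ?_)
      simp only [Pi.add_apply, Pi.sub_apply]
      exact (hXX ω).symm
    · by_cases hω : ω ∈ N
      · have hX0 : X ω = 0 := Finset.sum_eq_zero fun e he => by
          have := Set.mem_iInter₂.1 hω e he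
          exact Set.indicator_of_notMem this _
        simp only [Set.indicator_of_mem hω, hX0, one_mul, zero_sub, neg_sq, le_refl]
      · simp only [Set.indicator_of_notMem hω, zero_mul]
        positivity
  have hfin : P.real N * μ * μ ≤ K * μ := by nlinarith
  exact le_of_mul_le_mul_right hfin hpos

/-- The `b`-th of `L` bins of the unit interval. -/
def bin (L b : ℕ) : Set ℝ := Set.Ico (b / L : ℝ) ((b + 1) / L)

lemma measurableSet_bin (L b : ℕ) : MeasurableSet (bin L b) := measurableSet_Ico

lemma nullMeasurableSet_jointEvent
    (hlaw : ∀ n, HasLaw (θ n) (volume.restrict (Set.Ico (0 : ℝ) 1)) P) (U : Finset ℕ)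
    {B : Set ℝ} (hB : MeasurableSet B) : NullMeasurableSet (jointEvent θ U B) P :=
  Finset.nullMeasurableSet_biInter U fun n _ => (hlaw n).aemeasurable.nullMeasurable hB

lemma measureReal_preimage_bin
    (hlaw : ∀ n, HasLaw (θ n) (volume.restrict (Set.Ico (0 : ℝ) 1)) P) (n : ℕ) {L b : ℕ}
    (hb : b < L) : P.real (θ n ⁻¹' bin L b) = 1 / L := by
  have hL : (0 : ℝ) < L := by exact_mod_cast (by omega : 0 < L)
  have hsub : bin L b ⊆ Set.Ico 0 1 := Set.Ico_subset_Ico (by positivity) (by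
    rw [div_le_one hL]
    exact_mod_cast hb)
  rw [measureReal_def, measure_preimage_of_uniform hlaw n (measurableSet_bin L b),
    Set.inter_eq_left.2 hsub, bin, Real.volume_Ico, ENNReal.toReal_ofReal]
  · ring
  · rw [← sub_div]
    simp

lemma measureReal_jointEvent_inter
    (hlaw : ∀ n, HasLaw (θ n) (volume.restrict (Set.Ico (0 : ℝ) 1)) P) (hindep : iIndepFun θ P)
    {U U' : Finset ℕ} (hU : Disjoint U U') {L b L' b' : ℕ} (hb : b < L) (hb' : b' < L') :
    P.real (jointEvent θ U (bin L b) ∩ jointEvent θ U' (bin L' b'))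
      = (1 / L : ℝ) ^ U.card * (1 / L' : ℝ) ^ U'.card := by
  classical
  let A : ℕ → Set ℝ := fun n => if n ∈ U then bin L b else bin L' b'
  have hA : ∀ n, MeasurableSet (A n) := fun n => by
    simp only [A]
    split_ifs
    exacts [measurableSet_bin _ _, measurableSet_bin _ _]
  have hAU : ∀ n ∈ U, A n = bin L b := fun n hn => if_pos hn
  have hAU' : ∀ n ∈ U', A n = bin L' b' := fun n hn =>
    if_neg (Finset.disjoint_right.1 hU hn)
  have e : jointEvent θ U (bin L b) ∩ jointEvent θ U' (bin L' b') = ⋂ n ∈ U ∪ U', θ n ⁻¹' A n := by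
    rw [jointEvent, jointEvent, biInter_union_eq]
    congr 1
    · exact Set.iInter₂_congr fun n hn => by rw [hAU n hn]
    · exact Set.iInter₂_congr fun n hn => by rw [hAU' n hn]
  rw [e, measureReal_def, hindep.measure_inter_preimage_eq_mul _ fun n _ => hA n,
    Finset.prod_union hU, ENNReal.toReal_mul, ENNReal.toReal_prod, ENNReal.toReal_prod]
  congr 1
  · refine Finset.prod_eq_pow_card fun n hn => ?_
    rw [hAU n hn]
    exact measureReal_preimage_bin hlaw n hb
  · refine Finset.prod_eq_pow_card fun n hn => ?_
    rw [hAU' n hn]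
    exact measureReal_preimage_bin hlaw n hb'

lemma measureReal_jointEvent [IsProbabilityMeasure P]
    (hlaw : ∀ n, HasLaw (θ n) (volume.restrict (Set.Ico (0 : ℝ) 1)) P) (hindep : iIndepFun θ P)
    {U : Finset ℕ} {L b : ℕ} (hb : b < L) :
    P.real (jointEvent θ U (bin L b)) = (1 / L : ℝ) ^ U.card := by
  have := measureReal_jointEvent_inter hlaw hindep (Finset.disjoint_empty_right U) hb hb
  simpa [jointEvent] using this

lemma bin_disjoint {L b b' : ℕ} (h : b ≠ b') : Disjoint (bin L b) (bin L b') := by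
  rcases L.eq_zero_or_pos with rfl | hL
  · simp [bin]
  have hL' : (0 : ℝ) < L := by exact_mod_cast hL
  rw [Set.disjoint_left]
  rintro t ⟨h1, h2⟩ ⟨h3, h4⟩
  rw [div_le_iff₀ hL'] at h1 h3
  rw [lt_div_iff₀ hL'] at h2 h4
  have a1 : (b : ℝ) < b' + 1 := by linarith
  have a2 : (b' : ℝ) < b + 1 := by linarith
  have a3 : b < b' + 1 := by exact_mod_cast a1
  have a4 : b' < b + 1 := by exact_mod_cast a2
  omega

/-- Almost surely some bin at a level at least `M` is occupied by indices from three disjoint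
groups. -/
lemma ae_exists_triple [IsProbabilityMeasure P]
    (hlaw : ∀ n, HasLaw (θ n) (volume.restrict (Set.Ico (0 : ℝ) 1)) P) (hindep : iIndepFun θ P)
    {k L : ℕ → ℕ} (hkL : ∀ m, k m ≤ L m) (a : ∀ m, Fin 3 × Fin (k m) ↪ ℕ)
    (ha : ∀ m m' x x', a m x = a m' x' → m = m')
    (hdiv : ¬ Summable fun m => (k m : ℝ) ^ 3 / (L m : ℝ) ^ 2) (M : ℕ) :
    ∀ᵐ ω ∂P, ∃ m ≥ M, ∃ b : ℕ, ∃ i : Fin 3 → Fin (k m), ∀ c, θ (a m (c, i c)) ω ∈ bin (L m) b := by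
  classical
  let κ := Σ m : ℕ, Fin (L m) × (Fin 3 → Fin (k m))
  let U : κ → Finset ℕ := fun e => Finset.univ.image fun c => a e.1 (c, e.2.2 c)
  let E : κ → Set Ω := fun e => jointEvent θ (U e) (bin (L e.1) e.2.1)
  let S : ℕ → Finset κ := fun n => (Finset.Ico M n).sigma fun _ => Finset.univ
  have hUinj : ∀ e : κ, Function.Injective fun c => a e.1 (c, e.2.2 c) := fun e c c' h =>
    congrArg Prod.fst ((a e.1).injective h)
  have hUcard : ∀ e, (U e).card = 3 := fun e => by
    rw [Finset.card_image_of_injective _ (hUinj e), Finset.card_univ, Fintype.card_fin]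
  have hPE : ∀ e, P.real (E e) = (1 / L e.1 : ℝ) ^ 3 := fun e => by
    rw [measureReal_jointEvent hlaw hindep e.2.1.2, hUcard]
  -- Only events for the same level and the same bin can be positively correlated. Otherwise the
  -- index sets are disjoint, which gives independence, or they share an index that would have to
  -- lie in two disjoint bins.
  let dep : κ → κ → Prop := fun e e' => ∃ i : Fin 3 → Fin (k e.1), e' = ⟨e.1, e.2.1, i⟩
  have h1 : ∀ e e', ¬ dep e e' → P.real (E e ∩ E e') ≤ P.real (E e) * P.real (E e') := by
    intro e e' hdep
    by_cases hdisj : Disjoint (U e) (U e')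
    · rw [measureReal_jointEvent_inter hlaw hindep hdisj e.2.1.2 e'.2.1.2, hPE, hPE, hUcard, hUcard]
    · obtain ⟨n, hn, hn'⟩ := Finset.not_disjoint_iff.1 hdisj
      obtain ⟨m, b, i⟩ := e
      obtain ⟨m', b', i'⟩ := e'
      obtain ⟨c, -, hc⟩ := Finset.mem_image.1 hn
      obtain ⟨c', -, hc'⟩ := Finset.mem_image.1 hn'
      obtain rfl : m = m' := ha _ _ _ _ (hc.trans hc'.symm)
      have hbb : (b : ℕ) ≠ b' := fun h => hdep ⟨i', by rw [Fin.ext h]⟩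
      have : E ⟨m, b, i⟩ ∩ E ⟨m, b', i'⟩ = ∅ := by
        refine Set.eq_empty_of_forall_notMem fun ω hω => ?_
        exact Set.disjoint_left.1 (bin_disjoint hbb) (Set.mem_iInter₂.1 hω.1 n hn)
          (Set.mem_iInter₂.1 hω.2 n hn')
      rw [this, measureReal_empty]
      exact mul_nonneg measureReal_nonneg measureReal_nonneg
  have hinter : ∀ m (b : Fin (L m)) (i i' : Fin 3 → Fin (k m)),
      P.real (E ⟨m, b, i⟩ ∩ E ⟨m, b, i'⟩)
        = ∏ c, (1 / L m : ℝ) * (if i' c = i c then 1 else (1 / L m : ℝ)) := by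
    intro m b i i'
    have hU : U ⟨m, b, i⟩ ∪ U ⟨m, b, i'⟩
        = Finset.univ.biUnion fun c : Fin 3 => {a m (c, i c), a m (c, i' c)} := by
      ext n
      simp only [U, Finset.mem_union, Finset.mem_image, Finset.mem_univ, true_and,
        Finset.mem_biUnion, Finset.mem_insert, Finset.mem_singleton, ← exists_or, eq_comm]
    have hcard : (U ⟨m, b, i⟩ ∪ U ⟨m, b, i'⟩).card
        = ∑ c : Fin 3, ({a m (c, i c), a m (c, i' c)} : Finset ℕ).card := by
      rw [hU]
      refine Finset.card_biUnion fun c _ c' _ hcc => ?_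
      refine Finset.disjoint_left.2 fun n hn hn' => hcc ?_
      simp only [Finset.mem_insert, Finset.mem_singleton] at hn hn'
      have key : ∀ {x y : Fin (k m)}, a m (c, x) = a m (c', y) → c = c' := fun h =>
        congrArg Prod.fst ((a m).injective h)
      rcases hn with rfl | rfl <;> rcases hn' with h | h <;> exact key h
    change P.real (jointEvent θ _ _ ∩ jointEvent θ _ _) = _
    rw [jointEvent_inter_jointEvent, measureReal_jointEvent hlaw hindep b.2, hcard,
      ← Finset.prod_pow_eq_pow_sum]
    refine Finset.prod_congr rfl fun c _ => ?_
    split_ifs with h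
    · rw [h, Finset.pair_eq_singleton, Finset.card_singleton, pow_one, mul_one]
    · rw [Finset.card_pair, sq]
      exact fun h' => h (congrArg Prod.snd ((a m).injective h')).symm
  -- The three groups are disjoint, so the sum factorises into three sums, each at most (1/L)(1 +
  -- k/L) ≤ 2/L because k ≤ L. Hence the constant 2³ = 8.
  have h2 : ∀ n, ∀ e ∈ S n, ∑ e' ∈ (S n).filter (dep e), P.real (E e ∩ E e')
      ≤ 8 * P.real (E e) := by
    rintro n ⟨m, b, i⟩ he
    have hLpos : (0 : ℝ) < L m := by exact_mod_cast b.pos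
    have hsub : (S n).filter (dep ⟨m, b, i⟩)
        ⊆ Finset.univ.image fun i' : Fin 3 → Fin (k m) => (⟨m, b, i'⟩ : κ) := by
      intro e' he'
      obtain ⟨i', rfl⟩ := (Finset.mem_filter.1 he').2
      exact Finset.mem_image_of_mem _ (Finset.mem_univ i')
    refine (Finset.sum_le_sum_of_subset_of_nonneg hsub fun _ _ _ => measureReal_nonneg).trans ?_
    have hinj : Function.Injective fun i' : Fin 3 → Fin (k m) => (⟨m, b, i'⟩ : κ) :=
      fun i' i'' h => (Prod.mk.inj (eq_of_heq (Sigma.mk.inj h).2)).2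
    rw [Finset.sum_image hinj.injOn]
    simp only [hinter]
    rw [← Fintype.prod_sum (fun (c : Fin 3) (x : Fin (k m)) =>
      (1 / L m : ℝ) * (if x = i c then 1 else (1 / L m : ℝ))), hPE]
    have hc : ∀ c, ∑ x : Fin (k m), (1 / L m : ℝ) * (if x = i c then 1 else (1 / L m : ℝ))
        ≤ 2 * (1 / L m) := by
      intro c
      rw [← Finset.mul_sum, mul_comm]
      refine mul_le_mul_of_nonneg_right ?_ (by positivity)
      calc ∑ x : Fin (k m), (if x = i c then 1 else (1 / L m : ℝ))
          ≤ ∑ x : Fin (k m), ((if x = i c then 1 else 0) + (1 / L m : ℝ)) := by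
            refine Finset.sum_le_sum fun x _ => ?_
            split_ifs
            · have : (0 : ℝ) ≤ 1 / L m := by positivity
              linarith
            · linarith
        _ = 1 + k m * (1 / L m) := by
            rw [Finset.sum_add_distrib, Finset.sum_ite_eq' Finset.univ (i c)]
            simp
        _ ≤ 2 := by
            have : (k m : ℝ) ≤ L m := by exact_mod_cast hkL m
            have : (k m : ℝ) * (1 / L m) ≤ 1 := by
              rw [mul_one_div, div_le_one hLpos]
              exact this
            linarith
    calc _ ≤ ∏ _c : Fin 3, 2 * (1 / L m : ℝ) :=
          Finset.prod_le_prod (fun c _ => Finset.sum_nonneg fun x _ => by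
            split_ifs <;> positivity) fun c _ => hc c
      _ = _ := by
          rw [Finset.prod_const, Finset.card_univ, Fintype.card_fin]
          ring
  have hsum : ∀ n, ∑ e ∈ S n, P.real (E e) = ∑ m ∈ Finset.Ico M n, (k m : ℝ) ^ 3 / (L m) ^ 2 := by
    intro n
    rw [Finset.sum_sigma]
    refine Finset.sum_congr rfl fun m _ => ?_
    simp only [hPE]
    rw [Finset.sum_const, Finset.card_univ, Fintype.card_prod, Fintype.card_fun, Fintype.card_fin,
      Fintype.card_fin, Fintype.card_fin, nsmul_eq_mul]
    rcases (L m).eq_zero_or_pos with h | h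
    · have : k m = 0 := by have := hkL m; omega
      simp [h]
    · have : (0 : ℝ) < L m := by exact_mod_cast h
      push_cast
      field_simp
  have hlim : Filter.Tendsto (fun n => ∑ e ∈ S n, P.real (E e)) Filter.atTop Filter.atTop := by
    have h3 := (not_summable_iff_tendsto_nat_atTop_of_nonneg fun m => by positivity).1 hdiv
    refine (Filter.tendsto_atTop_add_const_right _
      (-∑ m ∈ Finset.range M, (k m : ℝ) ^ 3 / (L m) ^ 2) h3).congr' ?_
    filter_upwards [Filter.eventually_ge_atTop M] with n hn
    rw [hsum, Finset.sum_Ico_eq_sub _ hn, sub_eq_add_neg]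
  have hbound : ∀ n, P.real (⋂ e ∈ S n, (E e)ᶜ) * ∑ e ∈ S n, P.real (E e) ≤ 8 := fun n =>
    measureReal_inter_compl_mul_sum_le (fun e => nullMeasurableSet_jointEvent hlaw _
      (measurableSet_bin _ _)) (by norm_num) (fun e _ e' _ => h1 e e') (h2 n)
  set Z : Set Ω := {ω | ¬ ∃ m ≥ M, ∃ b : ℕ, ∃ i : Fin 3 → Fin (k m),
    ∀ c, θ (a m (c, i c)) ω ∈ bin (L m) b} with hZ
  have hZsub : ∀ n, Z ⊆ ⋂ e ∈ S n, (E e)ᶜ := by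
    intro n ω hω
    refine Set.mem_iInter₂.2 fun e he hmem => hω ?_
    refine ⟨e.1, (Finset.mem_Ico.1 (Finset.mem_sigma.1 he).1).1, e.2.1, e.2.2, fun c => ?_⟩
    exact Set.mem_iInter₂.1 hmem _ (Finset.mem_image_of_mem _ (Finset.mem_univ c))
  have hZ0 : P.real Z = 0 := by
    by_contra hne
    have hpos : 0 < P.real Z := lt_of_le_of_ne measureReal_nonneg (Ne.symm hne)
    obtain ⟨n, hn⟩ := (hlim.eventually_gt_atTop (8 / P.real Z)).exists
    rw [div_lt_iff₀ hpos] at hn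
    have h4 := measureReal_mono (μ := P) (hZsub n)
    have h5 := hbound n
    have h6 : 0 ≤ ∑ e ∈ S n, P.real (E e) := Finset.sum_nonneg fun _ _ => measureReal_nonneg
    nlinarith
  rw [measureReal_eq_zero_iff] at hZ0
  exact hZ0

end Random

/-! ### Almost sure failure of interpolation -/

/-- A large finite set of radii in a dyadic annulus has three disjoint large groups of nearby
radii. -/
lemma exists_embedding_of_card_le {r : ℕ → ℝ} (hr : ∀ n, 0 ≤ r n) {I : Finset ℕ} {m p k : ℕ}
    (hp : 1 ≤ p) (hI : ∀ n ∈ I, (r n : ℂ) ∈ dyadicAnnulus m) (hk : p * (3 * k) ≤ I.card) :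
    ∃ a : Fin 3 × Fin k ↪ ℕ, (∀ x, a x ∈ I) ∧
      ∀ x y, |r (a x) - r (a y)| ≤ (1 / 2) ^ m / p := by
  classical
  have hp0 : (0 : ℝ) < p := by exact_mod_cast hp
  -- Cut the annulus into bands of width 2^(-m)/p; the values below p label those that meet it, and
  -- by pigeonhole one band holds at least 3k indices.
  let f : ℕ → ℕ := fun n => ⌊(1 - r n) * (2 ^ m * p)⌋₊
  have hpow : (1 / 2 : ℝ) ^ m * 2 ^ m = 1 := by rw [← mul_pow]; norm_num
  have hf : ∀ n ∈ I, f n ∈ Finset.range p := fun n hn => by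
    have h1 := ((mem_dyadicAnnulus_ofReal (hr n)).1 (hI n hn)).2
    have h0 := ((mem_dyadicAnnulus_ofReal (hr n)).1 (hI n hn)).1
    have hpos : (0 : ℝ) ≤ (1 / 2) ^ m / 2 := by positivity
    rw [Finset.mem_range, Nat.floor_lt (mul_nonneg (hpos.trans h0) (by positivity))]
    calc (1 - r n) * (2 ^ m * p) < (1 / 2) ^ m * (2 ^ m * p) := by gcongr
      _ = p := by rw [← mul_assoc, hpow, one_mul]
  obtain ⟨y, -, hy⟩ := Finset.exists_le_card_fiber_of_mul_le_card_of_maps_to hf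
    ⟨0, Finset.mem_range.2 hp⟩ (n := 3 * k) (by rwa [Finset.card_range])
  obtain ⟨e⟩ : Nonempty (Fin 3 × Fin k ↪ {n // n ∈ I.filter fun n => f n = y}) :=
    Function.Embedding.nonempty_of_card_le (by simpa using hy)
  have he : ∀ x, (e x : ℕ) ∈ I ∧ f (e x) = y := fun x => Finset.mem_filter.1 (e x).2
  refine ⟨e.trans (Function.Embedding.subtype _), fun x => (he x).1, fun x x' => ?_⟩
  have key : ∀ x, (y : ℝ) ≤ (1 - r (e x)) * (2 ^ m * p) ∧ (1 - r (e x)) * (2 ^ m * p) < y + 1 := by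
    intro x
    have h0 := ((mem_dyadicAnnulus_ofReal (hr _)).1 (hI _ (he x).1)).1
    have hpos : (0 : ℝ) ≤ (1 / 2) ^ m / 2 := by positivity
    have h1 : (0 : ℝ) ≤ (1 - r (e x)) * (2 ^ m * p) :=
      mul_nonneg (hpos.trans h0) (by positivity)
    have h2 := Nat.floor_le h1
    have h3 := Nat.lt_floor_add_one ((1 - r (e x)) * (2 ^ m * p))
    have h4 : ⌊(1 - r (e x)) * (2 ^ m * p)⌋₊ = y := (he x).2
    rw [h4] at h2 h3
    exact ⟨h2, h3⟩
  obtain ⟨a1, a2⟩ := key x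
  obtain ⟨b1, b2⟩ := key x'
  have hq : (1 / 2 : ℝ) ^ m / p * (2 ^ m * p) = 1 := by
    rw [div_mul_eq_mul_div, ← mul_assoc, hpow, one_mul, div_self hp0.ne']
  have hmul : (0 : ℝ) < 2 ^ m * p := by positivity
  change |r (e x) - r (e x')| ≤ _
  rw [abs_le]
  constructor
  · refine le_of_mul_le_mul_right ?_ hmul
    linarith
  · refine le_of_mul_le_mul_right ?_ hmul
    linarith

/-- The group sizes are truncated so as not to exceed the number of bins. A truncated term equals p
2^m ≥ 1, so summability would make the truncation eventually inactive, and then N³/4^m is bounded by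
a multiple of the summable term plus a geometric one that accounts for rounding. -/
lemma not_summable_min {N : ℕ → ℕ} {p : ℕ} (hp : 1 ≤ p)
    (h : ¬ Summable fun m => (N m : ℝ) ^ 3 / 4 ^ m) :
    ¬ Summable fun m => ((min (N m / (3 * p)) (p * 2 ^ m) : ℕ) : ℝ) ^ 3
      / ((p * 2 ^ m : ℕ) : ℝ) ^ 2 := by
  intro hs
  apply h
  have hp0 : (0 : ℝ) < p := by exact_mod_cast hp
  have hev := hs.tendsto_atTop_zero.eventually_lt_const one_pos
  have hgeo : Summable fun m : ℕ => (1 / 4 : ℝ) ^ m :=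
    summable_geometric_of_lt_one (by norm_num) (by norm_num)
  refine Summable.of_norm_bounded_eventually_nat ((hs.mul_left (108 * (p : ℝ) ^ 5)).add
    (hgeo.mul_left (108 * (p : ℝ) ^ 3))) ?_
  filter_upwards [hev] with m hm
  have hL1 : 1 ≤ p * 2 ^ m := Nat.one_le_iff_ne_zero.2 (by positivity)
  have hL : (1 : ℝ) ≤ ((p * 2 ^ m : ℕ) : ℝ) := by exact_mod_cast hL1
  have hlt : N m / (3 * p) < p * 2 ^ m := by
    by_contra hcon
    push Not at hcon
    rw [min_eq_right hcon, div_lt_one (by positivity)] at hm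
    nlinarith [sq_nonneg ((p * 2 ^ m : ℕ) : ℝ)]
  rw [min_eq_left hlt.le]
  set k := N m / (3 * p) with hk
  have hN : N m < 3 * p * (k + 1) := Nat.lt_mul_div_succ (N m) (by omega)
  have hN' : (N m : ℝ) ≤ 3 * p * (k + 1) := by exact_mod_cast hN.le
  rw [Real.norm_of_nonneg (by positivity)]
  have h4 : (4 : ℝ) ^ m = (2 ^ m) ^ 2 := by rw [← pow_mul, mul_comm, pow_mul]; norm_num
  have hk0 : (0 : ℝ) ≤ k := Nat.cast_nonneg _
  have hcube : (N m : ℝ) ^ 3 ≤ 108 * (p : ℝ) ^ 3 * ((k : ℝ) ^ 3 + 1) := by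
    calc (N m : ℝ) ^ 3 ≤ (3 * (p : ℝ) * ((k : ℝ) + 1)) ^ 3 := by gcongr
      _ = 27 * (p : ℝ) ^ 3 * ((k : ℝ) + 1) ^ 3 := by ring
      _ ≤ 27 * (p : ℝ) ^ 3 * (4 * ((k : ℝ) ^ 3 + 1)) := by
        gcongr
        nlinarith [mul_nonneg (add_nonneg hk0 zero_le_one) (sq_nonneg ((k : ℝ) - 1))]
      _ = _ := by ring
  calc (N m : ℝ) ^ 3 / 4 ^ m ≤ 108 * (p : ℝ) ^ 3 * ((k : ℝ) ^ 3 + 1) / 4 ^ m := by gcongr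
    _ = _ := by
      push_cast
      rw [one_div, inv_pow, h4]
      field_simp

lemma randomPoint_eq {Ω : Type*} (r : ℕ → ℝ) (θ : ℕ → Ω → ℝ) (ω : Ω) (n : ℕ) :
    randomPoint r θ ω n = r n * circlePoint (θ n ω) := rfl

lemma norm_randomPoint {Ω : Type*} {r : ℕ → ℝ} (hr : ∀ n, r n ∈ Set.Ico (0 : ℝ) 1) {θ : ℕ → Ω → ℝ} (ω : Ω) (n : ℕ) :
    ‖randomPoint r θ ω n‖ = r n := by
  rw [randomPoint_eq, norm_mul, norm_circlePoint, mul_one, Complex.norm_real,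
    Real.norm_of_nonneg (hr n).1]

lemma randomPoint_ne {Ω : Type*} {θ : ℕ → Ω → ℝ} {r : ℕ → ℝ}
    (hr : ∀ n, r n ∈ Set.Ico (0 : ℝ) 1) {ω : Ω}
    (hω : Function.Injective fun n => circlePoint (θ n ω)) {n k : ℕ} (hnk : n ≠ k)
    (hn : 0 < r n) : randomPoint r θ ω n ≠ randomPoint r θ ω k := by
  intro h
  have h1 : r n = r k := by rw [← norm_randomPoint hr ω n, h, norm_randomPoint hr ω k]
  rw [randomPoint_eq, randomPoint_eq, ← h1] at h
  have h2 : (r n : ℂ) ≠ 0 := by exact_mod_cast hn.ne'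
  exact hnk (hω (mul_left_cancel₀ h2 h))

section Random

variable {Ω : Type*} [MeasurableSpace Ω] {P : Measure Ω} {θ : ℕ → Ω → ℝ}

/-- Coincidence of two directions has probability at most that of their being within ε/4 of each
other, which is at most ε. -/
lemma ae_injective_circlePoint
    (hlaw : ∀ n, HasLaw (θ n) (volume.restrict (Set.Ico (0 : ℝ) 1)) P) (hindep : iIndepFun θ P) :
    ∀ᵐ ω ∂P, Function.Injective fun n => circlePoint (θ n ω) := by
  have h : ∀ n k, n ≠ k → ∀ᵐ ω ∂P, circlePoint (θ n ω) ≠ circlePoint (θ k ω) := by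
    intro n k hnk
    rw [ae_iff]
    simp only [not_not]
    refine le_antisymm (ENNReal.le_of_forall_pos_le_add fun ε hε _ => ?_) zero_le
    have hs : (0 : ℝ) < ε / 4 := by
      have : (0 : ℝ) < ε := hε
      positivity
    have h1 := measure_star_le hlaw hindep (x := k) (J := {n}) (by simpa using hnk.symm) hs
    rw [Finset.card_singleton, pow_one, mul_div_cancel₀ _ (by norm_num : (4 : ℝ) ≠ 0),
      ENNReal.ofReal_coe_nnreal] at h1
    rw [zero_add]
    refine (measure_mono fun ω hω => ?_).trans h1
    have hω' : circlePoint (θ n ω) = circlePoint (θ k ω) := hω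
    intro j hj
    rw [Finset.mem_singleton.1 hj, hω', sub_self, norm_zero]
    exact hs.le
  have h' : ∀ᵐ ω ∂P, ∀ n k, n ≠ k → circlePoint (θ n ω) ≠ circlePoint (θ k ω) := by
    rw [ae_all_iff]
    intro n
    rw [ae_all_iff]
    intro k
    by_cases hnk : n = k
    · exact Filter.Eventually.of_forall fun _ h => (h hnk).elim
    · exact (h n k hnk).mono fun _ h _ => h
  filter_upwards [h'] with ω hω n k hnk
  by_contra hne
  exact hω n k hne hnk

lemma pos_of_mem_dyadicAnnulus {x : ℝ} (hx : 0 ≤ x) {m : ℕ} (h : (x : ℂ) ∈ dyadicAnnulus m) :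
    0 < x := by
  have h1 := ((mem_dyadicAnnulus_ofReal hx).1 h).2
  have h2 : (1 / 2 : ℝ) ^ m ≤ 1 := pow_le_one₀ (by norm_num) (by norm_num)
  linarith

theorem ae_not_isBlochInterpolating_of_infinite {r : ℕ → ℝ} (hr : ∀ n, r n ∈ Set.Ico (0 : ℝ) 1)
    (hlaw : ∀ n, HasLaw (θ n) (volume.restrict (Set.Ico (0 : ℝ) 1)) P) (hindep : iIndepFun θ P)
    {m : ℕ} (hm : {n | (r n : ℂ) ∈ dyadicAnnulus m}.Infinite) :
    ∀ᵐ ω ∂P, ¬ IsBlochInterpolating (randomPoint r θ ω) := by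
  filter_upwards [ae_injective_circlePoint hlaw hindep] with ω hω
  have hR : 1 - (1 / 2 : ℝ) ^ m / 2 < 1 := by
    have : (0 : ℝ) < (1 / 2) ^ m := by positivity
    linarith
  refine not_isBlochInterpolating_of_infinite (fun n => by
    rw [norm_randomPoint hr]; exact (hr n).2) hR ?_
  have hinj : Set.InjOn (randomPoint r θ ω) {n | (r n : ℂ) ∈ dyadicAnnulus m} := by
    intro n hn k _ h
    by_contra hne
    exact randomPoint_ne hr hω hne (pos_of_mem_dyadicAnnulus (hr n).1 hn) h
  refine (hm.image hinj).mono ?_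
  rintro _ ⟨n, hn, rfl⟩
  refine ⟨⟨n, rfl⟩, ?_⟩
  rw [mem_closedBall_zero_iff, norm_randomPoint hr]
  have := ((mem_dyadicAnnulus_ofReal (hr n).1).1 hn).1
  linarith

/-- Radial and angular differences give a numerator of at most 8 · 2^(-m)/p, while the denominator
is at least the depth 2^(-m)/2. -/
lemma pseudoHyperbolicDist_le_of_bin {x y : ℝ} (hx : 0 ≤ x) (hy : y ∈ Set.Ico (0 : ℝ) 1) {m p b : ℕ}
    (hp : 1 ≤ p) (hxm : (x : ℂ) ∈ dyadicAnnulus m) (hxy : |x - y| ≤ (1 / 2) ^ m / p) {t u : ℝ}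
    (ht : t ∈ bin (p * 2 ^ m) b) (hu : u ∈ bin (p * 2 ^ m) b) :
    pseudoHyperbolicDist (x * circlePoint t) (y * circlePoint u) ≤ 16 / p := by
  have hp0 : (0 : ℝ) < p := by exact_mod_cast hp
  set q : ℝ := (1 / 2) ^ m with hq
  have hq0 : 0 < q := by positivity
  have hx1 := ((mem_dyadicAnnulus_ofReal hx).1 hxm).1
  have hnx : ‖(x : ℂ) * circlePoint t‖ = x := by
    rw [norm_mul, norm_circlePoint, mul_one, Complex.norm_real, Real.norm_of_nonneg hx]
  have hny : ‖(y : ℂ) * circlePoint u‖ = y := by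
    rw [norm_mul, norm_circlePoint, mul_one, Complex.norm_real, Real.norm_of_nonneg hy.1]
  have htu : |t - u| ≤ q / p := by
    have e : q / p = (((b : ℝ) + 1) / (p * 2 ^ m : ℕ)) - b / (p * 2 ^ m : ℕ) := by
      rw [← sub_div, hq]
      push_cast
      rw [one_div, inv_pow]
      field_simp
      ring
    rw [e, abs_le]
    have h1 := ht.1
    have h2 := ht.2
    have h3 := hu.1
    have h4 := hu.2
    constructor <;> linarith
  have hnum : ‖(x : ℂ) * circlePoint t - y * circlePoint u‖ ≤ 8 * (q / p) := by
    have e : (x : ℂ) * circlePoint t - y * circlePoint u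
        = ((x - y : ℝ) : ℂ) * circlePoint t + y * (circlePoint t - circlePoint u) := by
      push_cast
      ring
    rw [e]
    refine (norm_add_le _ _).trans ?_
    rw [norm_mul, norm_mul, norm_circlePoint, mul_one, Complex.norm_real, Real.norm_eq_abs,
      Complex.norm_real, Real.norm_of_nonneg hy.1]
    have h1 := norm_circlePoint_sub_le t u
    have h2 := mul_le_of_le_one_left (norm_nonneg (circlePoint t - circlePoint u)) hy.2.le
    linarith
  have hden : q / 2 ≤ ‖1 - conj ((y : ℂ) * circlePoint u) * (x * circlePoint t)‖ := by
    refine hx1.trans ?_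
    have := one_sub_norm_le_norm_one_sub_conj_mul (z := (x : ℂ) * circlePoint t)
      (w := y * circlePoint u) (by rw [hny]; exact hy.2.le)
    rwa [hnx] at this
  rw [pseudoHyperbolicDist, norm_div]
  calc _ ≤ 8 * (q / p) / (q / 2) := by gcongr
    _ = _ := by field_simp; norm_num

theorem ae_not_isBlochInterpolating_of_not_summable [IsProbabilityMeasure P] {r : ℕ → ℝ}
    (hr : ∀ n, r n ∈ Set.Ico (0 : ℝ) 1)
    (hlaw : ∀ n, HasLaw (θ n) (volume.restrict (Set.Ico (0 : ℝ) 1)) P) (hindep : iIndepFun θ P)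
    {I : ℕ → Finset ℕ} (hI : ∀ m n, n ∈ I m ↔ (r n : ℂ) ∈ dyadicAnnulus m)
    (hsum : ¬ Summable fun m => ((I m).card : ℝ) ^ 3 / 4 ^ m) :
    ∀ᵐ ω ∂P, ¬ IsBlochInterpolating (randomPoint r θ ω) := by
  have huniq : ∀ m m' n, n ∈ I m → n ∈ I m' → m = m' := by
    have key : ∀ m m' n, n ∈ I m → n ∈ I m' → m < m' + 1 := fun m m' n hn hn' => by
      have h1 := ((mem_dyadicAnnulus_ofReal (hr n).1).1 ((hI _ _).1 hn)).2
      have h2 := ((mem_dyadicAnnulus_ofReal (hr n).1).1 ((hI _ _).1 hn')).1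
      refine (pow_lt_pow_iff_right_of_lt_one₀ (by norm_num : (0 : ℝ) < 1 / 2) (by norm_num)).1 ?_
      rw [pow_succ]
      linarith
    intro m m' n hn hn'
    have := key m m' n hn hn'
    have := key m' m n hn' hn
    omega
  have hT : ∀ p : ℕ, ∀ M : ℕ, ∀ᵐ ω ∂P, ∃ m ≥ M, ∃ b : ℕ, ∃ n : Fin 3 → ℕ, Function.Injective n ∧
      (∀ c, n c ∈ I m) ∧ (∀ c c', |r (n c) - r (n c')| ≤ (1 / 2) ^ m / (p + 1 : ℕ)) ∧
      ∀ c, θ (n c) ω ∈ bin ((p + 1) * 2 ^ m) b := by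
    intro p M
    choose a haI har using fun m => exists_embedding_of_card_le (fun n => (hr n).1)
      (I := I m) (m := m) (p := p + 1)
      (k := min ((I m).card / (3 * (p + 1))) ((p + 1) * 2 ^ m)) (by omega)
      (fun n hn => (hI m n).1 hn) (by
        calc (p + 1) * (3 * min ((I m).card / (3 * (p + 1))) ((p + 1) * 2 ^ m))
            ≤ (p + 1) * (3 * ((I m).card / (3 * (p + 1)))) := by
              gcongr
              exact min_le_left _ _
          _ = 3 * (p + 1) * ((I m).card / (3 * (p + 1))) := by ring
          _ ≤ _ := Nat.mul_div_le _ _)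
    have := ae_exists_triple hlaw hindep (k := fun m =>
      min ((I m).card / (3 * (p + 1))) ((p + 1) * 2 ^ m)) (L := fun m => (p + 1) * 2 ^ m)
      (fun m => min_le_right _ _) a
      (fun m m' x x' h => huniq _ _ _ (haI m x) (h ▸ haI m' x'))
      (not_summable_min (by omega) hsum) M
    filter_upwards [this] with ω hω
    obtain ⟨m, hm, b, i, hi⟩ := hω
    exact ⟨m, hm, b, fun c => a m (c, i c), fun c c' h => congrArg Prod.fst ((a m).injective h),
      fun c => haI m _, fun c c' => har m _ _, hi⟩
  -- Countably many almost sure events: the parameter p produces every tightness ε and the parameter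
  -- M every distance to the circle.
  have hT' : ∀ᵐ ω ∂P, ∀ p M : ℕ, ∃ m ≥ M, ∃ b : ℕ, ∃ n : Fin 3 → ℕ, Function.Injective n ∧
      (∀ c, n c ∈ I m) ∧ (∀ c c', |r (n c) - r (n c')| ≤ (1 / 2) ^ m / (p + 1 : ℕ)) ∧
      ∀ c, θ (n c) ω ∈ bin ((p + 1) * 2 ^ m) b := by
    rw [ae_all_iff]
    intro p
    rw [ae_all_iff]
    exact hT p
  filter_upwards [hT', ae_injective_circlePoint hlaw hindep] with ω hω hinj
  refine not_isBlochInterpolating_of_tight_triples (fun n => by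
    rw [norm_randomPoint hr]; exact (hr n).2) fun ε hε R hR => ?_
  obtain ⟨p, hp⟩ := exists_nat_gt (16 / ε)
  obtain ⟨M, hM⟩ := exists_pow_lt_of_lt_one (sub_pos.2 hR) (by norm_num : (1 / 2 : ℝ) < 1)
  obtain ⟨m, hm, b, n, hn, hnI, hnr, hnb⟩ := hω p M
  have hnI' : ∀ c, (r (n c) : ℂ) ∈ dyadicAnnulus m := fun c => (hI _ _).1 (hnI c)
  have hne : ∀ c c', c ≠ c' → randomPoint r θ ω (n c) ≠ randomPoint r θ ω (n c') :=
    fun c c' h => randomPoint_ne hr hinj (fun e => h (hn e))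
      (pos_of_mem_dyadicAnnulus (hr _).1 (hnI' c))
  have hnorm : ∀ c, R ≤ ‖randomPoint r θ ω (n c)‖ := fun c => by
    rw [norm_randomPoint hr]
    have h1 := ((mem_dyadicAnnulus_ofReal (hr _).1).1 (hnI' c)).2
    have h2 := pow_le_pow_of_le_one (by norm_num : (0 : ℝ) ≤ 1 / 2) (by norm_num) hm
    linarith
  have hρ : ∀ c c', pseudoHyperbolicDist (randomPoint r θ ω (n c)) (randomPoint r θ ω (n c')) ≤ ε :=
    fun c c' => by
      refine (pseudoHyperbolicDist_le_of_bin (hr _).1 (hr _) (by omega) (hnI' c) (hnr c c')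
        (hnb c) (hnb c')).trans ?_
      rw [div_lt_iff₀ hε] at hp
      rw [div_le_iff₀ (by positivity)]
      push_cast
      linarith
  exact ⟨n 0, n 1, n 2, hne _ _ (by decide), hne _ _ (by decide), hne _ _ (by decide), hnorm _,
    hnorm _, hnorm _, hρ _ _, hρ _ _, hρ _ _⟩

end Random

/-! ### The dichotomy -/

lemma dyadicCount_eq_card {r : ℕ → ℝ} {m : ℕ} {I : Finset ℕ}
    (hI : ∀ n, n ∈ I ↔ (r n : ℂ) ∈ dyadicAnnulus m) :
    (dyadicCount r m : ℝ≥0∞) = (I.card : ℝ≥0∞) := by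
  have e : {n : ℕ | (r n : ℂ) ∈ dyadicAnnulus m} = (I : Set ℕ) := by
    ext n
    exact (hI n).symm
  rw [dyadicCount, e, Set.encard_coe_eq_coe_finsetCard, ENat.toENNReal_coe]

lemma natCast_pow_three_div_eq_ofReal (N m : ℕ) :
    (N : ℝ≥0∞) ^ 3 / 2 ^ (2 * m) = ENNReal.ofReal ((N : ℝ) ^ 3 / 4 ^ m) := by
  rw [ENNReal.ofReal_div_of_pos (by positivity), ENNReal.ofReal_pow (by positivity),
    ENNReal.ofReal_pow (by norm_num), ENNReal.ofReal_natCast, pow_mul]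
  norm_num

end

theorem mainTheorem4 {Ω : Type*} [MeasurableSpace Ω] (P : Measure Ω) [IsProbabilityMeasure P]
    (r : ℕ → ℝ) (hr : ∀ n, r n ∈ Set.Ico (0 : ℝ) 1)
    (θ : ℕ → Ω → ℝ) (hlaw : ∀ n, HasLaw (θ n) (volume.restrict (Set.Ico (0 : ℝ) 1)) P)
    (hindep : iIndepFun θ P) :
    ((∑' m : ℕ, (dyadicCount r m : ℝ≥0∞) ^ 3 / 2 ^ (2 * m) < ∞ →
        ∀ᵐ ω ∂P, IsBlochInterpolating (randomPoint r θ ω)) ∧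
      (∑' m : ℕ, (dyadicCount r m : ℝ≥0∞) ^ 3 / 2 ^ (2 * m) = ∞ →
        ∀ᵐ ω ∂P, ¬ IsBlochInterpolating (randomPoint r θ ω))) := by
  -- A single infinite count makes the series infinite, so in that case only the second assertion
  -- has content, and it follows from the accumulation argument rather than from triples.
  by_cases hfin : ∀ m, {n | (r n : ℂ) ∈ dyadicAnnulus m}.Finite
  · have hI : ∀ m n, n ∈ (hfin m).toFinset ↔ (r n : ℂ) ∈ dyadicAnnulus m := fun m n => by simp
    simp only [dyadicCount_eq_card (hI _), natCast_pow_three_div_eq_ofReal]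
    refine ⟨fun h => ae_isBlochInterpolating hr hlaw hindep hI ?_,
      fun h => ae_not_isBlochInterpolating_of_not_summable hr hlaw hindep hI fun hs =>
        hs.tsum_ofReal_ne_top h⟩
    refine (ENNReal.summable_toReal h.ne).congr fun m => ?_
    rw [ENNReal.toReal_ofReal (by positivity)]
  · push Not at hfin
    obtain ⟨m, hm⟩ := hfin
    refine ⟨fun h => ?_, fun _ => ae_not_isBlochInterpolating_of_infinite hr hlaw hindep hm⟩
    have htop : (dyadicCount r m : ℝ≥0∞) ^ 3 / 2 ^ (2 * m) = ∞ := by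
      rw [dyadicCount, Set.Infinite.encard_eq hm, ENat.toENNReal_top, ENNReal.top_pow (by norm_num),
        ENNReal.top_div_of_ne_top (by simp)]
    exact (h.ne (top_unique (htop ▸ ENNReal.le_tsum m))).elim
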